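/- Let $G$ be a locally compact (Hausdorff) group with a fixed left Haar measure $m$ and left regular representation $\lambda$ on $\mathrm{L}^2(G)$, and let $\mathrm{VN}(G)=\lambda(G)''$. Let $\mathrm{A}(G)$ be the Fourier algebra: the predual of $\mathrm{VN}(G)$, realized as the space of functions $u(s)=\sum_k\langle\lambda(s)f_k|g_k\rangle$ on $G$ with $f_k,g_k\in\mathrm{L}^2(G)$, $\sum_k\|f_k\|^2<\infty$, $\sum_k\|g_k\|^2<\infty$ (by a theorem of Eymard one term suffices), with duality $\langle T,u\rangle=\sum_k\langle Tf_k|g_k\rangle$ for $T\in\mathrm{VN}(G)$, norm $\|u\|_{\mathrm{A}(G)}=\sup\{|\langle T,u\rangle|:T\in\mathrm{VN}(G),\ \|T\|\le 1\}$, and the predual operator space structure $$\|[u_{ij}]\|_{\mathrm{M}_n(\mathrm{A}(G))}=\sup\bigl\{\bigl\|[\langle T_{pq},u_{ij}\rangle]\bigr\|_{\mathrm{M}_{nr}(\mathbb{C})}: r\in\mathbb{N},\ [T_{pq}]\in\mathrm{M}_r(\mathrm{VN}(G)),\ \|[T_{pq}]\|\le 1\bigr\}.$$ Let $\mathrm{S}^1\!\mathrm{A}(G)=\mathrm{A}(G)\cap\mathrm{L}^1(G)$,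 with the operator space structure inherited from the embedding $u\mapsto(u,u)$ into $\mathrm{A}(G)\oplus_1\mathrm{L}^1(G)$, the predual of $\mathrm{VN}(G)\oplus_\infty\mathrm{L}^\infty(G)$: $$\|[u_{ij}]\|_{\mathrm{M}_n(\mathrm{S}^1\!\mathrm{A}(G))}=\sup\Bigl\{\Bigl\|\Bigl[\langle T_{pq},u_{ij}\rangle+\int_G\varphi_{pq}u_{ij}\,dm\Bigr]\Bigr\|_{\mathrm{M}_{nr}(\mathbb{C})}: r\in\mathbb{N},\ \|[T_{pq}]\|_{\mathrm{M}_r(\mathrm{VN}(G))}\le 1,\ \|[\varphi_{pq}]\|_{\mathrm{M}_r(\mathrm{L}^\infty(G))}\le 1\Bigr\}.$$ Let $\mathrm{B}(G)$ be the Fourier-Stieltjes algebra: the functions $b(s)=\langle\pi(s)\xi|\eta\rangle$ with $\pi$ a strongly continuous unitary representation of $G$, normed by the infimum of $\|\xi\|\|\eta\|$ over all such representations of $b$. For a closed subgroup $H$ of $G$, a bounded approximate indicator for $H$ in $G$ is a bounded net $(u_\alpha)$ in $\mathrm{B}(G)$ such that (i) $\lim_\alpha\|u_\alpha|_H\,v-v\|_{\mathrm{A}(H)}=0$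 for each $v\in\mathrm{A}(H)$, and (ii) $\lim_\alpha\|u_\alpha w\|_{\mathrm{A}(G)}=0$ for each $w\in\mathrm{A}(G)$ with $w|_H=0$. **Theorem.** If $H$ is a closed, non-open subgroup of $G$ which admits a bounded approximate indicator in $G$, then restriction $u\mapsto u|_H$ is a well-defined linear map from $\mathrm{S}^1\!\mathrm{A}(G)$ to $\mathrm{A}(H)$, and it is a surjective complete quotient map: it is onto, and for every $n$ the map $[u_{ij}]\mapsto[u_{ij}|_H]$ carries the open unit ball of $\mathrm{M}_n(\mathrm{S}^1\!\mathrm{A}(G))$ onto the open unit ball of $\mathrm{M}_n(\mathrm{A}(H))$. -/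

import Mathlib

open MeasureTheory Filter Topology
open scoped ENNReal NNReal InnerProductSpace Matrix.Norms.L2Operator

set_option linter.unusedSectionVars false

namespace SegalFourier

universe u

/-! ### Ultraweakly continuous functionals on bounded operators -/

section Functionals

variable {E : Type*} [NormedAddCommGroup E] [InnerProductSpace ℂ E]

/-- A square-summable sequence of vectors. -/
def SqSummable (f : ℕ → E) : Prop := Summable fun k => ‖f k‖ ^ 2

/-- The functional `T ↦ ∑ₖ ⟨T fₖ | gₖ⟩` (the scalar product being linear in the first entry
on paper; Mathlib's `inner` is linear in the second one). For square-summable `f`, `g` these are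
exactly the ultraweakly continuous (= normal) functionals. -/
noncomputable def vecFunctional (f g : ℕ → E) (T : E →L[ℂ] E) : ℂ := ∑' k, inner ℂ (g k) (T (f k))

theorem summable_inner_apply {f g : ℕ → E} (hf : SqSummable f) (hg : SqSummable g)
    (T : E →L[ℂ] E) : Summable fun k => inner ℂ (g k) (T (f k)) := by
  refine Summable.of_norm_bounded (g := fun k => ‖T‖ * (‖f k‖ ^ 2 + ‖g k‖ ^ 2))
    ((Summable.add hf hg).mul_left _) fun k => ?_
  calc ‖inner ℂ (g k) (T (f k))‖ ≤ ‖g k‖ * ‖T (f k)‖ := norm_inner_le_norm _ _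
    _ ≤ ‖g k‖ * (‖T‖ * ‖f k‖) := by gcongr; exact T.le_opNorm _
    _ = ‖T‖ * (‖f k‖ * ‖g k‖) := by ring
    _ ≤ ‖T‖ * (‖f k‖ ^ 2 + ‖g k‖ ^ 2) := by
        gcongr; nlinarith [sq_nonneg (‖f k‖ - ‖g k‖), sq_nonneg (‖f k‖), sq_nonneg (‖g k‖)]

/-- Two sequences, merged into one. -/
def merge (f f' : ℕ → E) : ℕ → E := fun k => Sum.elim f f' (Equiv.natSumNatEquivNat.symm k)

theorem SqSummable.merge {f f' : ℕ → E} (hf : SqSummable f) (hf' : SqSummable f') :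
    SqSummable (merge f f') := by
  have h : Summable (fun i : ℕ ⊕ ℕ => ‖Sum.elim f f' i‖ ^ 2) := Summable.sum _ hf hf'
  exact (Equiv.natSumNatEquivNat.symm.summable_iff (f := fun i : ℕ ⊕ ℕ => ‖Sum.elim f f' i‖ ^ 2)).2 h

theorem vecFunctional_merge {f f' g g' : ℕ → E} (hf : SqSummable f) (hf' : SqSummable f')
    (hg : SqSummable g) (hg' : SqSummable g') (T : E →L[ℂ] E) :
    vecFunctional (merge f f') (merge g g') T = vecFunctional f g T + vecFunctional f' g' T := by
  have h : HasSum (fun i : ℕ ⊕ ℕ => inner ℂ (Sum.elim g g' i) (T (Sum.elim f f' i)))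
      (vecFunctional f g T + vecFunctional f' g' T) :=
    HasSum.sum (summable_inner_apply hf hg T).hasSum (summable_inner_apply hf' hg' T).hasSum
  exact ((Equiv.natSumNatEquivNat.symm.hasSum_iff
    (f := fun i : ℕ ⊕ ℕ => inner ℂ (Sum.elim g g' i) (T (Sum.elim f f' i)))).2 h).tsum_eq

theorem vecFunctional_smul (c : ℂ) (f g : ℕ → E) (T : E →L[ℂ] E) :
    vecFunctional (fun k => c • f k) g T = c * vecFunctional f g T := by
  simp [vecFunctional, tsum_mul_left]

theorem vecFunctional_neg (f g : ℕ → E) (T : E →L[ℂ] E) :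
    vecFunctional f (fun k => -g k) T = -vecFunctional f g T := by
  simp [vecFunctional, tsum_neg]

theorem SqSummable.smul {f : ℕ → E} (hf : SqSummable f) (c : ℂ) :
    SqSummable fun k => c • f k := by
  simpa [SqSummable, norm_smul, mul_pow] using Summable.mul_left (‖c‖ ^ 2) hf

theorem SqSummable.neg {f : ℕ → E} (hf : SqSummable f) : SqSummable fun k => -f k := by
  simpa [SqSummable] using hf

theorem SqSummable.zero : SqSummable fun _ : ℕ => (0 : E) := by simp [SqSummable, summable_zero]

/-- The norm of a matrix of operators, acting on the Hilbert space `E ⊕ ⋯ ⊕ E` (`r` times),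
is at most one. -/
def IsContractiveMatrix {r : ℕ} (T : Matrix (Fin r) (Fin r) (E →L[ℂ] E)) : Prop :=
  ∀ ξ : Fin r → E, ∑ p, ‖∑ q, T p q (ξ q)‖ ^ 2 ≤ ∑ q, ‖ξ q‖ ^ 2

/-! A normal functional that vanishes on a group of operators closed under adjoints vanishes on
the von Neumann algebra which that group generates. -/

/-- The operator `T ⊕ T ⊕ ⋯` on `E ⊕ E ⊕ ⋯`. -/
noncomputable def amp (T : E →L[ℂ] E) (x : lp (fun _ : ℕ => E) 2) : lp (fun _ : ℕ => E) 2 :=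
  ⟨fun k => T (x k), by
    have hx := lp.memℓp x
    refine memℓp_gen ?_
    have h2 := hx.summable (by norm_num)
    refine Summable.of_nonneg_of_le (fun k => by positivity) (fun k => ?_)
      (h2.mul_left (‖T‖ ^ 2))
    norm_num
    rw [← mul_pow]
    gcongr
    exact T.le_opNorm _⟩

@[simp] theorem amp_apply (T : E →L[ℂ] E) (x : lp (fun _ : ℕ => E) 2) (k : ℕ) :
    amp T x k = T (x k) := rfl

variable [CompleteSpace E]

theorem inner_amp (T : E →L[ℂ] E) (x y : lp (fun _ : ℕ => E) 2) :
    inner ℂ (amp T x) y = inner ℂ x (amp (star T) y) := by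
  simp only [lp.inner_eq_tsum, amp_apply, ContinuousLinearMap.star_eq_adjoint,
    ContinuousLinearMap.adjoint_inner_right]

theorem eq_zero_of_mem_bicommutant {Γ : Type*} [Group Γ] (l : Γ →* (E →L[ℂ] E))
    (hl : ∀ s, star (l s) = l s⁻¹) {T : E →L[ℂ] E}
    (hT : T ∈ Set.centralizer (Set.centralizer (Set.range l)))
    (ξ η : lp (fun _ : ℕ => E) 2) (h : ∀ s, inner ℂ η (amp (l s) ξ) = 0) :
    inner ℂ η (amp T ξ) = 0 := by
  classical
  set W : Submodule ℂ (lp (fun _ : ℕ => E) 2) :=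
    Submodule.span ℂ (Set.range fun s => amp (l s) ξ) with hW
  have memW : ∀ y, y ∈ Wᗮ ↔ ∀ s, inner ℂ (amp (l s) ξ) y = 0 := by
    intro y
    constructor
    · intro hy s
      exact hy _ (Submodule.subset_span ⟨s, rfl⟩)
    · intro hy
      rw [Submodule.mem_orthogonal]
      intro w hw
      induction hw using Submodule.span_induction with
      | mem x hx => obtain ⟨s, rfl⟩ := hx; exact hy s
      | zero => simp
      | add a b _ _ ha hb => rw [inner_add_left, ha, hb, add_zero]
      | smul c a _ ha => rw [inner_smul_left, ha, mul_zero]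
  have amp_mul : ∀ s t x, amp (l s) (amp (l t) x) = amp (l (s * t)) x := by
    intro s t x; ext k; simp
  have inv1 : ∀ t y, y ∈ Wᗮ → amp (l t) y ∈ Wᗮ := by
    intro t y hy
    rw [memW] at hy ⊢
    intro s
    have := inner_amp (l t⁻¹) (amp (l s) ξ) y
    rw [hl, inv_inv, amp_mul] at this
    rw [← this]; exact hy _
  have inv2 : ∀ t y, y ∈ Wᗮᗮ → amp (l t) y ∈ Wᗮᗮ := by
    intro t y hy w hw
    have := inner_amp (l t⁻¹) w y
    rw [hl, inv_inv] at this
    rw [← this]; exact hy _ (inv1 _ _ hw)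
  set P := Wᗮ.starProjection with hP
  have Pamp : ∀ t x, P (amp (l t) x) = amp (l t) (P x) := by
    intro t x
    refine Submodule.eq_starProjection_of_mem_orthogonal
      (inv1 t _ (Submodule.starProjection_apply_mem _ _)) ?_
    have : amp (l t) x - amp (l t) (P x) = amp (l t) (x - P x) := by ext k; simp
    rw [this]
    exact inv2 t _ (Submodule.sub_starProjection_mem_orthogonal _)
  have hξ : P ξ = 0 := by
    rw [hP, Submodule.starProjection_apply_eq_zero_iff]
    refine Submodule.le_orthogonal_orthogonal W (Submodule.subset_span ⟨1, ?_⟩)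
    ext k; simp
  have hη : P η = η := by
    rw [hP, Submodule.starProjection_eq_self_iff, memW]
    intro s
    rw [← inner_conj_symm, h s, map_zero]
  -- the matrix entries of the projection lie in the commutant
  let D : ℕ → ℕ → (E →L[ℂ] E) := fun j k =>
    (lp.evalCLM ℂ (fun _ : ℕ => E) 2 j).comp
      (P.comp (lp.singleContinuousLinearMap ℂ (fun _ : ℕ => E) 2 k))
  have hD : ∀ j k x, D j k x = (P (lp.single 2 k x) : lp (fun _ : ℕ => E) 2) j := fun j k x => rfl
  have Dcomm : ∀ j k, D j k ∈ Set.centralizer (Set.range l) := by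
    rintro j k _ ⟨t, rfl⟩
    ext x
    have h1 : amp (l t) (lp.single 2 k x) = lp.single 2 k (l t x) := by
      ext i
      by_cases hik : i = k
      · subst hik; simp
      · simp [Pi.single_eq_of_ne hik]
    change l t (D j k x) = D j k (l t x)
    rw [hD, hD, ← h1, Pamp, amp_apply]
  have hsum : ∀ (x : lp (fun _ : ℕ => E) 2) j, HasSum (fun k => D j k (x k)) (P x j) := by
    intro x j
    have := ((lp.evalCLM ℂ (fun _ : ℕ => E) 2 j).comp P).hasSum
      (lp.hasSum_single (by norm_num) x)
    exact this
  have PT : P (amp T ξ) = 0 := by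
    ext j
    have h1 := hsum (amp T ξ) j
    have h2 := T.hasSum (hsum ξ j)
    have h3 : (fun k => D j k (amp T ξ k)) = fun k => T (D j k (ξ k)) := by
      funext k
      exact congrArg (fun S : E →L[ℂ] E => S (ξ k)) (hT _ (Dcomm j k))
    rw [h3] at h1
    have := h1.unique h2
    rw [this, hξ]; simp
  rw [← hη, hP, Submodule.inner_starProjection_left_eq_right, ← hP, PT, inner_zero_right]

theorem vecFunctional_eq_zero {Γ : Type*} [Group Γ] (l : Γ →* (E →L[ℂ] E))
    (hl : ∀ s, star (l s) = l s⁻¹) {T : E →L[ℂ] E}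
    (hT : T ∈ Set.centralizer (Set.centralizer (Set.range l)))
    {f g : ℕ → E} (hf : SqSummable f) (hg : SqSummable g)
    (h : ∀ s, vecFunctional f g (l s) = 0) : vecFunctional f g T = 0 := by
  let ξ : lp (fun _ : ℕ => E) 2 := ⟨f, memℓp_gen (by simpa [SqSummable] using hf)⟩
  let η : lp (fun _ : ℕ => E) 2 := ⟨g, memℓp_gen (by simpa [SqSummable] using hg)⟩
  have key : ∀ S : E →L[ℂ] E, inner ℂ η (amp S ξ) = vecFunctional f g S := fun S =>
    lp.inner_eq_tsum _ _
  rw [← key]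
  exact eq_zero_of_mem_bicommutant l hl hT ξ η fun s => by rw [key]; exact h s

theorem vecFunctional_congr {Γ : Type*} [Group Γ] (l : Γ →* (E →L[ℂ] E))
    (hl : ∀ s, star (l s) = l s⁻¹) {T : E →L[ℂ] E}
    (hT : T ∈ Set.centralizer (Set.centralizer (Set.range l)))
    {f g f' g' : ℕ → E} (hf : SqSummable f) (hg : SqSummable g)
    (hf' : SqSummable f') (hg' : SqSummable g')
    (h : ∀ s, vecFunctional f g (l s) = vecFunctional f' g' (l s)) :
    vecFunctional f g T = vecFunctional f' g' T := by
  have := vecFunctional_eq_zero l hl hT (hf.merge hf') (hg.merge hg'.neg) fun s => by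
    rw [vecFunctional_merge hf hf' hg hg'.neg, vecFunctional_neg, h, add_neg_cancel]
  rw [vecFunctional_merge hf hf' hg hg'.neg, vecFunctional_neg] at this
  exact add_neg_eq_zero.1 this

end Functionals

section Group

variable {G : Type u} [Group G] [TopologicalSpace G] [IsTopologicalGroup G]
  [MeasurableSpace G] [BorelSpace G] (μ : Measure G) [μ.IsHaarMeasure]

/-! ### The left regular representation and the group von Neumann algebra -/

/-- The left regular representation on `L²(G)`: `(λ(s) f)(t) = f(s⁻¹ t)`. -/
noncomputable def leftRegular : G →* (Lp ℂ 2 μ →L[ℂ] Lp ℂ 2 μ) where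
  toFun s := (Lp.compMeasurePreservingₗᵢ ℂ (fun t : G => s⁻¹ * t)
    (measurePreserving_mul_left μ s⁻¹)).toContinuousLinearMap
  map_one' := by
    ext1 f
    refine Lp.ext ((Lp.coeFn_compMeasurePreserving f (measurePreserving_mul_left μ 1⁻¹)).trans ?_)
    filter_upwards with t
    simp
  map_mul' s t := by
    ext1 f
    have h := Lp.compMeasurePreserving_comp_apply f (measurePreserving_mul_left μ t⁻¹)
      (measurePreserving_mul_left μ s⁻¹)
    have h' : ((fun x : G => t⁻¹ * x) ∘ fun x : G => s⁻¹ * x) = fun x : G => (s * t)⁻¹ * x := by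
      funext x; simp [mul_assoc]
    simp only [h'] at h
    exact h

theorem coeFn_leftRegular (s : G) (f : Lp ℂ 2 μ) :
    leftRegular μ s f =ᵐ[μ] fun t => f (s⁻¹ * t) :=
  Lp.coeFn_compMeasurePreserving f (measurePreserving_mul_left μ s⁻¹)

theorem star_leftRegular (s : G) : star (leftRegular μ s) = leftRegular μ s⁻¹ := by
  have hiso : ∀ f g : Lp ℂ 2 μ, inner ℂ (leftRegular μ s f) (leftRegular μ s g) = inner ℂ f g :=
    fun f g => (Lp.compMeasurePreservingₗᵢ ℂ (fun t : G => s⁻¹ * t)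
      (measurePreserving_mul_left μ s⁻¹)).inner_map_map f g
  rw [ContinuousLinearMap.star_eq_adjoint, eq_comm, ContinuousLinearMap.eq_adjoint_iff]
  intro f g
  have h : leftRegular μ s (leftRegular μ s⁻¹ f) = f := by
    change (leftRegular μ s * leftRegular μ s⁻¹) f = f
    rw [← map_mul, mul_inv_cancel, map_one]
    rfl
  rw [← hiso, h]

/-- The group von Neumann algebra `VN(G)`, generated by the operators `λ(s)`. -/
noncomputable def groupVN : VonNeumannAlgebra (Lp ℂ 2 μ) where
  toStarSubalgebra := StarSubalgebra.centralizer ℂ (Set.centralizer (Set.range (leftRegular μ)))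
  centralizer_centralizer' := by
    have h := StarSubalgebra.coe_centralizer ℂ (Set.centralizer (Set.range (leftRegular μ)))
    change Set.centralizer (Set.centralizer (SetLike.coe (StarSubalgebra.centralizer ℂ
      (Set.centralizer (Set.range (leftRegular μ)))))) = SetLike.coe (StarSubalgebra.centralizer ℂ
      (Set.centralizer (Set.range (leftRegular μ))))
    rw [h, Set.centralizer_centralizer_centralizer]

theorem mem_groupVN {T : Lp ℂ 2 μ →L[ℂ] Lp ℂ 2 μ} :
    T ∈ groupVN μ ↔ T ∈ Set.centralizer (Set.centralizer (Set.range (leftRegular μ))) := by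
  have hstar : star (Set.centralizer (Set.range (leftRegular μ))) ⊆
      Set.centralizer (Set.range (leftRegular μ)) := by
    rintro S hS _ ⟨s, rfl⟩
    have := hS (leftRegular μ s⁻¹) ⟨s⁻¹, rfl⟩
    have h2 := congrArg star this
    simp only [star_mul, star_star, star_leftRegular, inv_inv] at h2
    exact h2.symm
  change T ∈ SetLike.coe (StarSubalgebra.centralizer ℂ
    (Set.centralizer (Set.range (leftRegular μ)))) ↔ _
  rw [StarSubalgebra.coe_centralizer, Set.union_eq_self_of_subset_right hstar]

/-! ### The Fourier algebra, as the predual of `VN(G)` -/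

/-- The Fourier algebra `A(G)`: the predual of `VN(G)`, realized as a space of functions on `G`
by sending a normal functional `ω` to the function `s ↦ ω(λ(s))`. -/
noncomputable def fourierAlgebra : Submodule ℂ (G → ℂ) where
  carrier := {u | ∃ f g : ℕ → Lp ℂ 2 μ, SqSummable f ∧ SqSummable g ∧
    ∀ s, u s = vecFunctional f g (leftRegular μ s)}
  zero_mem' := ⟨_, _, SqSummable.zero, SqSummable.zero, fun s => by simp [vecFunctional]⟩
  add_mem' := by
    rintro u v ⟨f, g, hf, hg, h⟩ ⟨f', g', hf', hg', h'⟩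
    exact ⟨_, _, hf.merge hf', hg.merge hg', fun s => by
      rw [vecFunctional_merge hf hf' hg hg', Pi.add_apply, h, h']⟩
  smul_mem' := by
    rintro c u ⟨f, g, hf, hg, h⟩
    exact ⟨_, _, hf.smul c, hg, fun s => by
      rw [vecFunctional_smul, Pi.smul_apply, h, smul_eq_mul]⟩

/-- The coefficient functions `s ↦ ⟨λ(s) f | g⟩` belong to `A(G)`. -/
theorem coefficient_mem_fourierAlgebra (f g : Lp ℂ 2 μ) :
    (fun s => inner ℂ g (leftRegular μ s f)) ∈ fourierAlgebra μ := by
  have hs : ∀ x : Lp ℂ 2 μ, SqSummable (fun k : ℕ => if k = 0 then x else 0) := fun x =>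
    summable_of_ne_finset_zero (s := {0}) fun k hk => by
      have : k ≠ 0 := by simpa using hk
      simp [this]
  refine ⟨_, _, hs f, hs g, fun s => ?_⟩
  rw [vecFunctional, tsum_eq_single 0 fun k hk => by simp [hk]]
  simp

/-- The duality `⟨T, u⟩` between `T ∈ VN(G)` and `u ∈ A(G)`: the value at `T` of the normal
functional `ω` with `u(s) = ω(λ(s))`. It does not depend on how `ω` is written, see
`pairing_eq`. -/
noncomputable def pairing (T : Lp ℂ 2 μ →L[ℂ] Lp ℂ 2 μ) (u : fourierAlgebra μ) : ℂ :=
  vecFunctional u.2.choose u.2.choose_spec.choose T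

theorem pairing_eq {T : Lp ℂ 2 μ →L[ℂ] Lp ℂ 2 μ} (hT : T ∈ groupVN μ) (u : fourierAlgebra μ)
    {f g : ℕ → Lp ℂ 2 μ} (hf : SqSummable f) (hg : SqSummable g)
    (h : ∀ s, (u : G → ℂ) s = vecFunctional f g (leftRegular μ s)) :
    pairing μ T u = vecFunctional f g T := by
  obtain ⟨hf', hg', h'⟩ := u.2.choose_spec.choose_spec
  exact vecFunctional_congr (leftRegular μ) (star_leftRegular μ) ((mem_groupVN μ).1 hT)
    hf' hg' hf hg fun s => (h' s).symm.trans (h s)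

/-- The norm of `A(G)` as the predual of `VN(G)`, extended by `∞` to all functions on `G`. -/
noncomputable def fourierNorm (u : G → ℂ) : ℝ≥0∞ :=
  ⨅ h : u ∈ fourierAlgebra μ,
    ⨆ (T : Lp ℂ 2 μ →L[ℂ] Lp ℂ 2 μ) (_ : T ∈ groupVN μ) (_ : ‖T‖ ≤ 1), ‖pairing μ T ⟨u, h⟩‖ₑ

/-- The norm of `M_n(A(G))` in the operator space structure of the predual of `VN(G)`: the
supremum of `‖[⟨T_pq, u_ij⟩]‖` (in `M_{nr}(ℂ)`) over `r` and the unit ball of `M_r(VN(G))`. -/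
noncomputable def fourierMatrixNorm (n : ℕ) (u : Matrix (Fin n) (Fin n) (fourierAlgebra μ)) :
    ℝ≥0∞ :=
  ⨆ (r : ℕ) (T : Matrix (Fin r) (Fin r) (Lp ℂ 2 μ →L[ℂ] Lp ℂ 2 μ))
    (_ : ∀ p q, T p q ∈ groupVN μ) (_ : IsContractiveMatrix T),
    ‖(Matrix.of fun a b : Fin n × Fin r => pairing μ (T a.2 b.2) (u a.1 b.1) :
      Matrix (Fin n × Fin r) (Fin n × Fin r) ℂ)‖ₑ

/-! ### The 1-Segal Fourier algebra -/

/-- The 1-Segal Fourier algebra `S¹A(G) = A(G) ∩ L¹(G)`. -/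
noncomputable def segalFourierAlgebra : Submodule ℂ (fourierAlgebra μ) where
  carrier := {u | Integrable (u : G → ℂ) μ}
  zero_mem' := integrable_zero G ℂ μ
  add_mem' hu hv := Integrable.add hu hv
  smul_mem' c _ hu := Integrable.smul c hu

/-- The norm of `M_n(S¹A(G))`, as a subspace of `M_n(A(G) ⊕₁ L¹(G))` where `A(G) ⊕₁ L¹(G)` is the
predual of `VN(G) ⊕_∞ L^∞(G)`: the supremum of `‖[⟨T_pq, u_ij⟩ + ∫ φ_pq u_ij]‖` (in `M_{nr}(ℂ)`)
over `r` and the unit balls of `M_r(VN(G))` and `M_r(L^∞(G))`. -/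
noncomputable def segalFourierMatrixNorm (n : ℕ)
    (u : Matrix (Fin n) (Fin n) (segalFourierAlgebra μ)) : ℝ≥0∞ :=
  ⨆ (r : ℕ) (T : Matrix (Fin r) (Fin r) (Lp ℂ 2 μ →L[ℂ] Lp ℂ 2 μ))
    (_ : ∀ p q, T p q ∈ groupVN μ) (_ : IsContractiveMatrix T)
    (φ : Matrix (Fin r) (Fin r) (Lp ℂ ∞ μ))
    (_ : ∀ᵐ s ∂μ, ‖(Matrix.of fun p q => φ p q s : Matrix (Fin r) (Fin r) ℂ)‖ ≤ 1),
    ‖(Matrix.of fun a b : Fin n × Fin r =>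
        pairing μ (T a.2 b.2) (u a.1 b.1 : fourierAlgebra μ) +
          ∫ s, φ a.2 b.2 s * ((u a.1 b.1 : fourierAlgebra μ) : G → ℂ) s ∂μ :
      Matrix (Fin n × Fin r) (Fin n × Fin r) ℂ)‖ₑ

end Group

/-! ### The Fourier-Stieltjes algebra and approximate indicators -/

section Indicator

variable {G : Type u} [Group G] [TopologicalSpace G]

/-- The norm of the Fourier-Stieltjes algebra `B(G)`: the infimum of `‖ξ‖ ‖η‖` over all ways to
write `b(s) = ⟨π(s) ξ | η⟩` with a strongly continuous unitary representation `π` of `G`.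
A function belongs to `B(G)` if and only if this is finite. -/
noncomputable def fourierStieltjesNorm (b : G → ℂ) : ℝ≥0∞ :=
  sInf {c : ℝ≥0∞ | ∃ (K : Type u) (_ : NormedAddCommGroup K) (_ : InnerProductSpace ℂ K)
    (_ : CompleteSpace K) (π : G →* unitary (K →L[ℂ] K)) (ξ η : K),
    (∀ x : K, Continuous fun s => (π s : K →L[ℂ] K) x) ∧
    (∀ s, b s = inner ℂ η ((π s : K →L[ℂ] K) ξ)) ∧ c = ‖ξ‖ₑ * ‖η‖ₑ}

variable [IsTopologicalGroup G] [MeasurableSpace G] [BorelSpace G]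

/-- The net `(u_α)` is a bounded approximate indicator for the subgroup `H` of `G`. The Haar
measures `μ` of `G` and `ν` of `H` serve to define `A(G)` and `A(H)`. -/
structure IsBoundedApproximateIndicator (μ : Measure G) [μ.IsHaarMeasure] (H : Subgroup G)
    (ν : Measure H) [ν.IsHaarMeasure] {ι : Type*} [Preorder ι] (u : ι → G → ℂ) : Prop where
  /-- a bounded net in `B(G)` -/
  bounded : ∃ C : ℝ≥0, ∀ α, fourierStieltjesNorm (u α) ≤ C
  /-- `u_α|_H v → v` in `A(H)` for `v ∈ A(H)` -/
  tendsto_subgroup : ∀ v ∈ fourierAlgebra ν,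
    Tendsto (fun α => fourierNorm ν fun h : H => u α h * v h - v h) atTop (𝓝 0)
  /-- `u_α w → 0` in `A(G)` for `w ∈ A(G)` with `w|_H = 0` -/
  tendsto_ideal : ∀ w ∈ fourierAlgebra μ, (∀ h ∈ H, w h = 0) →
    Tendsto (fun α => fourierNorm μ fun s => u α s * w s) atTop (𝓝 0)

end Indicator

/-! ### Complete quotient maps -/

/-- A linear map between spaces with matrix norms is a complete quotient map if, for every `n`, its
`n`-th amplification maps the open unit ball of `M_n(V)` onto the open unit ball of `M_n(W)`. -/
def IsCompleteQuotientMap {V W : Type*} [AddCommGroup V] [Module ℂ V] [AddCommGroup W] [Module ℂ W]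
    (normV : ∀ n : ℕ, Matrix (Fin n) (Fin n) V → ℝ≥0∞)
    (normW : ∀ n : ℕ, Matrix (Fin n) (Fin n) W → ℝ≥0∞) (R : V →ₗ[ℂ] W) : Prop :=
  ∀ n : ℕ, (fun v : Matrix (Fin n) (Fin n) V => v.map R) '' {v | normV n v < 1} =
    {w | normW n w < 1}

end SegalFourier

open SegalFourier

/-! Everything rests on a concrete description of the matrix norms of the Fourier algebra. If
`[u_ij]` has norm less than `c` in `M_n(A(G))`, then `u_ij(s) = ⟨(λ(s) ⊗ 1) b_j | a_i⟩` for vectors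
`a_i`, `b_j` of `ℓ²(L²(G))` whose Gram matrices are at most `c`, and such a factorization in turn
bounds the norm by `c` (`hasFactorization_of_matrixNorm_lt`, `HasFactorization.matrixNorm_le`). The
first implication is a Hahn-Banach argument, the second a product estimate. Restriction and lifting
then become operations on the vectors `a_i`, `b_j`.

Restriction is completely contractive (`HasFactorization.restrict`, a matrix form of Herz's
theorem): on the vectors that occur in a factorization, a partial isometry `J : L²(G) → ℓ²(L²(H))`
embeds `λ_G|_H` into a multiple of `λ_H`, and replacing `a`, `b` by `Ja`, `Jb` keeps the constant.

For lifting, let `κ` be a bump near the identity of `G`, scaled so that `⟨λ(h)κ|κ⟩` is nonnegative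
with integral one over `H`. Then `V f = ∫_H f(h) λ_G(h)κ dh` is a contraction `L²(H) → L²(G)` that
intertwines the actions of `H`, and `V*V` is close to the identity on prescribed vectors when `κ` is
concentrated enough. Given `v_ij(h) = ⟨λ_H(h) b_j | a_i⟩`, the function `u_ij(s) = ⟨λ_G(s) V b_j | V
a_i⟩` restricts to `⟨λ_H(h) b_j | V*V a_i⟩`, which is close to `v_ij` (`exists_approximate_lift`).

The `L¹` part costs nothing. If `a`, `b` are built from test functions supported in a compact `K ⊆
H`, then `u` vanishes off `K W K⁻¹`, where `W` is a small neighbourhood of the identity. These sets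
shrink to `K K⁻¹`, a compact subset of `H`, which is Haar null because a closed subgroup that is not
open contains no compact set of positive measure. So `‖u‖_1` can be made arbitrarily small while `u`
stays bounded. The error is again factorable with a small constant, and iterating along a geometric
series gives exact lifts (`exists_lift`). -/

namespace SegalFourier

universe u

/-! ### Square-summable sequences of vectors and amplified operators. -/

section Sequences

variable {E F : Type*} [NormedAddCommGroup E] [InnerProductSpace ℂ E]
  [NormedAddCommGroup F] [InnerProductSpace ℂ F]

/-- The Hilbert space of square-summable sequences in `E`. -/
abbrev SeqSpace (E : Type*) [NormedAddCommGroup E] := lp (fun _ : ℕ => E) 2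

theorem hasSum_sq_norm (x : SeqSpace E) : HasSum (fun k => ‖x k‖ ^ 2) (‖x‖ ^ 2) := by
  have := lp.hasSum_norm (p := 2) (by norm_num) x
  simpa using this

theorem memℓp_two_of_summable {f : ℕ → E} (hf : SqSummable f) : Memℓp f 2 :=
  memℓp_gen (by simpa [SqSummable] using hf)

theorem sqSummable_coe (x : SeqSpace E) : SqSummable (x : ℕ → E) := (hasSum_sq_norm x).summable

theorem sum_smul_apply {ι : Type*} (s : Finset ι) (c : ι → ℂ) (A : ι → SeqSpace E) (m : ℕ) :
    (∑ i ∈ s, c i • A i : SeqSpace E) m = ∑ i ∈ s, c i • A i m := by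
  have := map_sum (lp.evalCLM ℂ (fun _ : ℕ => E) 2 m) (fun i => c i • A i) s
  simp only [map_smul] at this
  exact this

theorem sq_norm_le_of_hasSum_le {x : SeqSpace E} {c : ℝ} {f : ℕ → ℝ} (hf : HasSum f c)
    (h : ∀ k, ‖x k‖ ^ 2 ≤ f k) : ‖x‖ ^ 2 ≤ c :=
  hasSum_le h (hasSum_sq_norm x) hf

/-- A bounded operator acts coordinatewise on square-summable sequences. -/
noncomputable def ampMap (V : E →L[ℂ] F) : SeqSpace E →L[ℂ] SeqSpace F :=
  LinearMap.mkContinuous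
    { toFun := fun x => ⟨fun k => V (x k), memℓp_two_of_summable (by
        refine Summable.of_nonneg_of_le (fun k => by positivity) (fun k => ?_)
          ((sqSummable_coe x).mul_left (‖V‖ ^ 2))
        rw [← mul_pow]
        gcongr
        exact V.le_opNorm _)⟩
      map_add' := fun x y => lp.ext (funext fun k => map_add V (x k) (y k))
      map_smul' := fun c x => lp.ext (funext fun k => map_smul V c (x k)) }
    ‖V‖ fun x => by
      refine le_of_sq_le_sq ?_ (by positivity)
      rw [mul_pow]
      refine sq_norm_le_of_hasSum_le ((hasSum_sq_norm x).mul_left _) fun k => ?_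
      rw [← mul_pow]
      change ‖V (x k)‖ ^ 2 ≤ _
      gcongr
      exact V.le_opNorm _

@[simp] theorem ampMap_apply (V : E →L[ℂ] F) (x : SeqSpace E) (k : ℕ) : ampMap V x k = V (x k) :=
  rfl

theorem norm_ampMap_le_of_contraction {V : E →L[ℂ] F} (hV : ‖V‖ ≤ 1) (x : SeqSpace E) :
    ‖ampMap V x‖ ≤ ‖x‖ := by
  refine le_of_sq_le_sq ?_ (by positivity)
  refine sq_norm_le_of_hasSum_le (hasSum_sq_norm x) fun k => ?_
  gcongr
  exact (V.le_opNorm _).trans (mul_le_of_le_one_left (norm_nonneg _) hV)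

theorem inner_ampMap_single [DecidableEq ℕ] (η : SeqSpace F) (V : E →L[ℂ] F) (k : ℕ) (f : E) :
    inner ℂ η (ampMap V (lp.single 2 k f)) = inner ℂ (η k) (V f) := by
  have : ampMap V (lp.single 2 k f) = (lp.single 2 k (V f) : SeqSpace F) := by
    ext i
    by_cases hik : i = k
    · subst hik; simp
    · simp [Pi.single_eq_of_ne hik]
  rw [this, lp.inner_single_right]

theorem inner_ampMap_eq_vecFunctional (ξ η : SeqSpace E) (T : E →L[ℂ] E) :
    inner ℂ η (ampMap T ξ) = vecFunctional ξ η T := lp.inner_eq_tsum _ _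

theorem hasSum_flatten (x : SeqSpace (SeqSpace E)) :
    HasSum (fun n : ℕ => ‖x n.unpair.1 n.unpair.2‖ ^ 2) (‖x‖ ^ 2) := by
  have hs : Summable (fun p : ℕ × ℕ => ‖x p.1 p.2‖ ^ 2) := by
    rw [summable_prod_of_nonneg (fun p => by positivity)]
    refine ⟨fun m => sqSummable_coe (x m), ?_⟩
    have : (fun m => ∑' k, ‖x m k‖ ^ 2) = fun m => ‖x m‖ ^ 2 :=
      funext fun m => (hasSum_sq_norm (x m)).tsum_eq
    exact this ▸ sqSummable_coe x
  have h2 : HasSum (fun p : ℕ × ℕ => ‖x p.1 p.2‖ ^ 2) (‖x‖ ^ 2) := by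
    rw [(hasSum_sq_norm x).unique (hs.hasSum.prod_fiberwise fun m => hasSum_sq_norm (x m))]
    exact hs.hasSum
  exact (Nat.pairEquiv.symm.hasSum_iff (f := fun p : ℕ × ℕ => ‖x p.1 p.2‖ ^ 2)).2 h2

/-- A square-summable double sequence, read as a square-summable sequence. -/
noncomputable def flatten : SeqSpace (SeqSpace E) →ₗᵢ[ℂ] SeqSpace E where
  toFun x := ⟨fun n => x n.unpair.1 n.unpair.2, memℓp_two_of_summable (hasSum_flatten x).summable⟩
  map_add' _ _ := rfl
  map_smul' _ _ := rfl
  norm_map' x := (sq_eq_sq₀ (norm_nonneg _) (norm_nonneg _)).1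
    ((hasSum_sq_norm _).unique (hasSum_flatten x))

@[simp] theorem flatten_apply (x : SeqSpace (SeqSpace E)) (n : ℕ) :
    flatten x n = x n.unpair.1 n.unpair.2 := rfl

theorem ampMap_flatten (T : E →L[ℂ] F) (x : SeqSpace (SeqSpace E)) :
    ampMap T (flatten x) = flatten (ampMap (ampMap T) x) := by
  ext n; simp

/-- Amplification commutes with flattening, which is isometric. A series of coefficient functions
thus becomes a single coefficient function. -/
theorem inner_flatten_ampMap (T : E →L[ℂ] F) (x : SeqSpace (SeqSpace E))
    (y : SeqSpace (SeqSpace F)) :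
    inner ℂ (flatten y) (ampMap T (flatten x)) = ∑' m, inner ℂ (y m) (ampMap T (x m)) := by
  rw [ampMap_flatten, LinearIsometry.inner_map_map, lp.inner_eq_tsum]
  rfl

end Sequences

/-! ### Bounds on Gram matrices. -/

section Bessel

variable {E F : Type*} [NormedAddCommGroup E] [InnerProductSpace ℂ E]
  [NormedAddCommGroup F] [InnerProductSpace ℂ F] {n : ℕ}

/-- The Gram matrix of the vectors `a i` is at most `c`. -/
def BesselBound (a : Fin n → E) (c : ℝ) : Prop :=
  ∀ x : Fin n → ℂ, ‖∑ i, x i • a i‖ ^ 2 ≤ c * ∑ i, ‖x i‖ ^ 2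

theorem BesselBound.mono {a : Fin n → E} {c d : ℝ} (h : BesselBound a c) (hcd : c ≤ d) :
    BesselBound a d := fun x =>
  (h x).trans (mul_le_mul_of_nonneg_right hcd (Finset.sum_nonneg fun _ _ => by positivity))

theorem BesselBound.zero : BesselBound (fun _ : Fin n => (0 : E)) 0 := fun x => by simp

theorem BesselBound.map {a : Fin n → E} {c : ℝ} (h : BesselBound a c) (V : E →ₗ[ℂ] F)
    (hV : ∀ x, ‖V x‖ ≤ ‖x‖) : BesselBound (fun i => V (a i)) c := fun x => by
  refine le_trans ?_ (h x)
  have : ∑ i, x i • V (a i) = V (∑ i, x i • a i) := by simp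
  rw [this]
  gcongr
  exact hV _

theorem BesselBound.smul {a : Fin n → E} {c : ℝ} (h : BesselBound a c) (t : ℂ) :
    BesselBound (fun i => t • a i) (‖t‖ ^ 2 * c) := fun x => by
  have : ∑ i, x i • t • a i = t • ∑ i, x i • a i := by
    rw [Finset.smul_sum]; exact Finset.sum_congr rfl fun i _ => smul_comm _ _ _
  rw [this, norm_smul, mul_pow, mul_assoc]
  gcongr
  exact h x

theorem besselBound_sum_sq (a : Fin n → E) : BesselBound a (∑ i, ‖a i‖ ^ 2) := fun x => by
  calc ‖∑ i, x i • a i‖ ^ 2 ≤ (∑ i, ‖a i‖ * ‖x i‖) ^ 2 := by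
        gcongr
        refine (norm_sum_le _ _).trans_eq (Finset.sum_congr rfl fun i _ => ?_)
        rw [norm_smul, mul_comm]
    _ ≤ _ := Finset.sum_mul_sq_le_sq_mul_sq _ _ _

theorem BesselBound.norm_sq_le {a : Fin n → E} {c : ℝ} (h : BesselBound a c) (i : Fin n) :
    ‖a i‖ ^ 2 ≤ c := by
  classical
  have := h (Pi.single i 1)
  simpa [Pi.single_apply, Finset.sum_ite_eq, apply_ite] using this

/-- The map `w ↦ (⟨a i, w⟩)` is the adjoint of `x ↦ ∑ x i • a i`, so it has the same norm bound.
Concretely, the Gram bound is tested at `x i = ⟨a i, w⟩`, which gives `S² ≤ c S ‖w‖²`. -/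
theorem BesselBound.sum_sq_inner_le {a : Fin n → E} {c : ℝ} (hc : 0 ≤ c) (h : BesselBound a c)
    (w : E) : ∑ i, ‖inner ℂ (a i) w‖ ^ 2 ≤ c * ‖w‖ ^ 2 := by
  set S := ∑ i, ‖inner ℂ (a i) w‖ ^ 2 with hS
  have hS0 : 0 ≤ S := Finset.sum_nonneg fun _ _ => by positivity
  have h1 : inner ℂ (∑ i, (inner ℂ (a i) w : ℂ) • a i) w = (S : ℂ) := by
    rw [sum_inner, hS]
    push_cast
    refine Finset.sum_congr rfl fun i _ => ?_
    rw [inner_smul_left, RCLike.conj_mul]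
    rfl
  have h2 : S ≤ ‖∑ i, (inner ℂ (a i) w : ℂ) • a i‖ * ‖w‖ := by
    have := norm_inner_le_norm (𝕜 := ℂ) (∑ i, (inner ℂ (a i) w : ℂ) • a i) w
    rw [h1] at this
    simpa [abs_of_nonneg hS0] using this
  have h3 : S ^ 2 ≤ c * S * ‖w‖ ^ 2 := by
    calc S ^ 2 ≤ (‖∑ i, (inner ℂ (a i) w : ℂ) • a i‖ * ‖w‖) ^ 2 := by gcongr
      _ = ‖∑ i, (inner ℂ (a i) w : ℂ) • a i‖ ^ 2 * ‖w‖ ^ 2 := mul_pow _ _ _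
      _ ≤ _ := by gcongr; exact h _
  rcases hS0.eq_or_lt with h0 | h0
  · rw [← h0]; positivity
  · nlinarith

theorem BesselBound.add_lp {a : ℕ → Fin n → E} {A : Fin n → SeqSpace E} {c : ℕ → ℝ} {C : ℝ}
    (hA : ∀ i m, A i m = a m i) (h : ∀ m, BesselBound (a m) (c m)) (hc : HasSum c C) :
    BesselBound A C := fun x => by
  refine sq_norm_le_of_hasSum_le (hc.mul_right _) fun m => ?_
  simp only [sum_smul_apply, hA]
  exact h m x

end Bessel

/-! ### Operator norms of scalar matrices. -/

section MatrixNorm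

variable {ι κ : Type*} [Fintype ι] [Fintype κ] [DecidableEq ι] [DecidableEq κ]

theorem sum_sq_mulVec_le (M : Matrix ι κ ℂ) (x : κ → ℂ) :
    ∑ i, ‖(M.mulVec x) i‖ ^ 2 ≤ ‖M‖ ^ 2 * ∑ j, ‖x j‖ ^ 2 := by
  have h := Matrix.l2_opNorm_mulVec M (WithLp.toLp 2 x)
  have h2 := pow_le_pow_left₀ (norm_nonneg _) h 2
  rw [mul_pow, EuclideanSpace.norm_sq_eq, EuclideanSpace.norm_sq_eq] at h2
  exact h2

theorem l2_opNorm_le_of_sum_sq (M : Matrix ι κ ℂ) {c : ℝ} (hc : 0 ≤ c)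
    (h : ∀ x : κ → ℂ, ∑ i, ‖(M.mulVec x) i‖ ^ 2 ≤ c ^ 2 * ∑ j, ‖x j‖ ^ 2) : ‖M‖ ≤ c := by
  rw [Matrix.l2_opNorm_def]
  refine ContinuousLinearMap.opNorm_le_bound _ hc fun x => ?_
  refine le_of_sq_le_sq ?_ (by positivity)
  rw [mul_pow, EuclideanSpace.norm_sq_eq, EuclideanSpace.norm_sq_eq]
  exact h x.ofLp

theorem norm_bilinear_le (M : Matrix ι κ ℂ) (y : ι → ℂ) (x : κ → ℂ) :
    ‖∑ i, ∑ j, y i * M i j * x j‖ ≤ ‖M‖ * Real.sqrt (∑ i, ‖y i‖ ^ 2) * Real.sqrt (∑ j, ‖x j‖ ^ 2) := by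
  have h1 : ∑ i, ∑ j, y i * M i j * x j = ∑ i, y i * (M.mulVec x) i := by
    refine Finset.sum_congr rfl fun i _ => ?_
    simp [Matrix.mulVec, dotProduct, Finset.mul_sum, mul_assoc]
  rw [h1]
  refine le_of_sq_le_sq ?_ (by positivity)
  rw [mul_pow, mul_pow, Real.sq_sqrt (by positivity), Real.sq_sqrt (by positivity)]
  calc ‖∑ i, y i * (M.mulVec x) i‖ ^ 2 ≤ (∑ i, ‖y i‖ * ‖(M.mulVec x) i‖) ^ 2 := by
        gcongr
        refine (norm_sum_le _ _).trans_eq (Finset.sum_congr rfl fun i _ => norm_mul _ _)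
    _ ≤ (∑ i, ‖y i‖ ^ 2) * ∑ i, ‖(M.mulVec x) i‖ ^ 2 := Finset.sum_mul_sq_le_sq_mul_sq _ _ _
    _ ≤ (∑ i, ‖y i‖ ^ 2) * (‖M‖ ^ 2 * ∑ j, ‖x j‖ ^ 2) := by
        gcongr; exact sum_sq_mulVec_le M x
    _ = _ := by ring

theorem l2_opNorm_le_of_bilinear (M : Matrix ι κ ℂ) {c : ℝ} (hc : 0 ≤ c)
    (h : ∀ (y : ι → ℂ) (x : κ → ℂ), ‖∑ i, ∑ j, y i * M i j * x j‖ ≤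
      c * Real.sqrt (∑ i, ‖y i‖ ^ 2) * Real.sqrt (∑ j, ‖x j‖ ^ 2)) : ‖M‖ ≤ c := by
  refine l2_opNorm_le_of_sum_sq M hc fun x => ?_
  set S := ∑ i, ‖(M.mulVec x) i‖ ^ 2 with hS
  have hS0 : 0 ≤ S := by positivity
  have h1 := h (fun i => star ((M.mulVec x) i)) x
  have h2 : ∑ i, ∑ j, star ((M.mulVec x) i) * M i j * x j = (S : ℂ) := by
    rw [hS]
    push_cast
    refine Finset.sum_congr rfl fun i _ => ?_
    have : ((‖(M.mulVec x) i‖ : ℂ)) ^ 2 = star ((M.mulVec x) i) * (M.mulVec x) i :=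
      (RCLike.conj_mul _).symm
    rw [this]
    simp [Matrix.mulVec, dotProduct, Finset.mul_sum, mul_assoc]
  rw [h2] at h1
  simp only [norm_star, Complex.norm_real, Real.norm_eq_abs, abs_of_nonneg hS0] at h1
  rw [← hS] at h1
  have h3 := pow_le_pow_left₀ hS0 h1 2
  rw [mul_pow, mul_pow, Real.sq_sqrt hS0, Real.sq_sqrt (by positivity)] at h3
  rcases hS0.eq_or_lt with h0 | h0
  · rw [← h0]; positivity
  · nlinarith

end MatrixNorm

/-! ### Contractive matrices of operators. -/

section Contractive

variable {E : Type*} [NormedAddCommGroup E] [InnerProductSpace ℂ E] {r n : ℕ}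

theorem IsContractiveMatrix.ampMap {T : Matrix (Fin r) (Fin r) (E →L[ℂ] E)}
    (hT : IsContractiveMatrix T) (ξ : Fin r → SeqSpace E) :
    ∑ p, ‖∑ q, SegalFourier.ampMap (T p q) (ξ q)‖ ^ 2 ≤ ∑ q, ‖ξ q‖ ^ 2 := by
  refine hasSum_le (fun k => ?_) (hasSum_sum fun p _ => hasSum_sq_norm _)
    (hasSum_sum fun q _ => hasSum_sq_norm (ξ q))
  have : ∀ p, (∑ q, SegalFourier.ampMap (T p q) (ξ q) : SeqSpace E) k = ∑ q, T p q (ξ q k) :=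
    fun p => by
      have := sum_smul_apply Finset.univ (fun _ => 1) (fun q => SegalFourier.ampMap (T p q) (ξ q)) k
      simpa using this
  simp only [this]
  exact hT fun q => ξ q k

/-- The matrix is a product of three operators: synthesis by `b`, the amplification of `T`, analysis
by `a`. The outer two have norm at most `√c`, the middle one is a contraction. This is the easy half
of the description of the norm of `M_n(A(G))`. -/
theorem norm_inner_matrix_le {T : Matrix (Fin r) (Fin r) (E →L[ℂ] E)}
    (hT : IsContractiveMatrix T) {a b : Fin n → SeqSpace E} {c : ℝ} (hc : 0 ≤ c)
    (ha : BesselBound a c) (hb : BesselBound b c) :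
    ‖(Matrix.of fun p q : Fin n × Fin r => inner ℂ (a p.1) (ampMap (T p.2 q.2) (b q.1)) :
      Matrix (Fin n × Fin r) (Fin n × Fin r) ℂ)‖ ≤ c := by
  refine l2_opNorm_le_of_sum_sq _ hc fun x => ?_
  set β : Fin r → SeqSpace E := fun q => ∑ j, x (j, q) • b j with hβ
  set w : Fin r → SeqSpace E := fun p => ∑ q, ampMap (T p q) (β q) with hw
  have h1 : ∀ p : Fin n × Fin r, ((Matrix.of fun p q : Fin n × Fin r =>
      inner ℂ (a p.1) (ampMap (T p.2 q.2) (b q.1))).mulVec x) p = inner ℂ (a p.1) (w p.2) := by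
    intro p
    simp only [Matrix.mulVec, dotProduct, Matrix.of_apply, hw, hβ, map_sum, map_smul, inner_sum,
      inner_smul_right, Fintype.sum_prod_type_right]
    exact Finset.sum_congr rfl fun q _ => Finset.sum_congr rfl fun j _ => mul_comm _ _
  simp only [h1]
  rw [Fintype.sum_prod_type_right, Fintype.sum_prod_type_right]
  calc ∑ p, ∑ i, ‖inner ℂ (a i) (w p)‖ ^ 2 ≤ ∑ p, c * ‖w p‖ ^ 2 :=
        Finset.sum_le_sum fun p _ => ha.sum_sq_inner_le hc _
    _ = c * ∑ p, ‖w p‖ ^ 2 := by rw [Finset.mul_sum]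
    _ ≤ c * ∑ q, ‖β q‖ ^ 2 := mul_le_mul_of_nonneg_left (hT.ampMap β) hc
    _ ≤ c * ∑ q, c * ∑ j, ‖x (j, q)‖ ^ 2 := by
        gcongr with q
        exact hb _
    _ = _ := by rw [← Finset.mul_sum]; ring

end Contractive

/-! ### Factorizations of matrices over the Fourier algebra. -/

section Factorization

variable {G : Type*} [Group G] [TopologicalSpace G] [IsTopologicalGroup G]
  [MeasurableSpace G] [BorelSpace G] (μ : Measure G) [μ.IsHaarMeasure] {n : ℕ}

/-- The function `s ↦ ⟨(λ(s) ⊗ 1) ξ | η⟩`, as an element of the Fourier algebra. -/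
noncomputable def coefficient (ξ η : SeqSpace (Lp ℂ 2 μ)) : fourierAlgebra μ :=
  ⟨fun s => inner ℂ η (ampMap (leftRegular μ s) ξ), ξ, η, sqSummable_coe ξ, sqSummable_coe η,
    fun _ => inner_ampMap_eq_vecFunctional _ _ _⟩

theorem coefficient_apply (ξ η : SeqSpace (Lp ℂ 2 μ)) (s : G) :
    (coefficient μ ξ η : G → ℂ) s = inner ℂ η (ampMap (leftRegular μ s) ξ) := rfl

theorem exists_eq_coefficient (u : fourierAlgebra μ) : ∃ ξ η, u = coefficient μ ξ η := by
  obtain ⟨u, f, g, hf, hg, h⟩ := u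
  refine ⟨⟨f, memℓp_two_of_summable hf⟩, ⟨g, memℓp_two_of_summable hg⟩, ?_⟩
  ext s
  rw [coefficient_apply, inner_ampMap_eq_vecFunctional]
  exact h s

theorem pairing_coefficient {T : Lp ℂ 2 μ →L[ℂ] Lp ℂ 2 μ} (hT : T ∈ groupVN μ)
    (ξ η : SeqSpace (Lp ℂ 2 μ)) :
    pairing μ T (coefficient μ ξ η) = inner ℂ η (ampMap T ξ) := by
  rw [inner_ampMap_eq_vecFunctional]
  exact pairing_eq μ hT _ (sqSummable_coe ξ) (sqSummable_coe η)
    fun s => inner_ampMap_eq_vecFunctional _ _ _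

/-- The matrix `u` of functions is factored as `u i j s = ⟨(λ(s) ⊗ 1) (b j) | a i⟩`, where the
rows `a` and `b` have Gram matrices at most `c`. -/
def HasFactorization (u : Fin n → Fin n → G → ℂ) (c : ℝ) : Prop :=
  0 ≤ c ∧ ∃ a b : Fin n → SeqSpace (Lp ℂ 2 μ), BesselBound a c ∧ BesselBound b c ∧
    ∀ i j s, u i j s = inner ℂ (a i) (ampMap (leftRegular μ s) (b j))

variable {μ}

theorem HasFactorization.mem {u : Fin n → Fin n → G → ℂ} {c : ℝ} (h : HasFactorization μ u c)
    (i j : Fin n) : u i j ∈ fourierAlgebra μ := by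
  obtain ⟨-, a, b, -, -, h⟩ := h
  rw [funext (h i j)]
  exact (coefficient μ (b j) (a i)).2

theorem HasFactorization.mono {u : Fin n → Fin n → G → ℂ} {c d : ℝ} (h : HasFactorization μ u c)
    (hcd : c ≤ d) : HasFactorization μ u d := by
  obtain ⟨h0, a, b, ha, hb, h⟩ := h
  exact ⟨h0.trans hcd, a, b, ha.mono hcd, hb.mono hcd, h⟩

theorem HasFactorization.zero : HasFactorization μ (0 : Fin n → Fin n → G → ℂ) 0 :=
  ⟨le_rfl, fun _ => 0, fun _ => 0, BesselBound.zero, BesselBound.zero, fun i j s => by simp⟩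

/-- Multiplying `a` by `t` and `b` by `t⁻¹` leaves the functions unchanged; the choice `t² = q / p`
turns both Gram bounds into `p * q`. -/
theorem HasFactorization.of_mul {u : Fin n → Fin n → G → ℂ} {a b : Fin n → SeqSpace (Lp ℂ 2 μ)}
    {p q : ℝ} (hp : 0 < p) (hq : 0 < q) (ha : BesselBound a (p ^ 2)) (hb : BesselBound b (q ^ 2))
    (h : ∀ i j s, u i j s = inner ℂ (a i) (ampMap (leftRegular μ s) (b j))) :
    HasFactorization μ u (p * q) := by
  set t := Real.sqrt (q / p) with ht
  have ht0 : 0 < t := Real.sqrt_pos.2 (by positivity)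
  have ht2 : t ^ 2 = q / p := Real.sq_sqrt (by positivity)
  refine ⟨by positivity, fun i => (t : ℂ) • a i, fun j => ((t⁻¹ : ℝ) : ℂ) • b j,
    (ha.smul _).mono (le_of_eq ?_), (hb.smul _).mono (le_of_eq ?_), fun i j s => ?_⟩
  · rw [Complex.norm_real, Real.norm_eq_abs, sq_abs, ht2]; field_simp
  · rw [Complex.norm_real, Real.norm_eq_abs, sq_abs, inv_pow, ht2]; field_simp
  · rw [h, map_smul, inner_smul_left, inner_smul_right, Complex.conj_ofReal, ← mul_assoc,
      ← Complex.ofReal_mul, mul_inv_cancel₀ ht0.ne', Complex.ofReal_one, one_mul]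

/-- The arithmetic-geometric mean inequality after balancing the rows. The additive form of the
bound is the one that Hahn-Banach can handle. -/
theorem HasFactorization.of_add_lt {u : Fin n → Fin n → G → ℂ}
    {a b : Fin n → SeqSpace (Lp ℂ 2 μ)} {p q c : ℝ} (hp : 0 ≤ p) (hq : 0 ≤ q) (hc : p + q < 2 * c)
    (ha : BesselBound a p) (hb : BesselBound b q)
    (h : ∀ i j s, u i j s = inner ℂ (a i) (ampMap (leftRegular μ s) (b j))) :
    HasFactorization μ u c := by
  -- Adding `δ` makes both bounds positive, as balancing requires, and the mean of `p + δ` and `q +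
  -- δ` is exactly `c`.
  set δ := (2 * c - (p + q)) / 2 with hδ
  have hδ0 : 0 < δ := by rw [hδ]; linarith
  have h1 : BesselBound a (Real.sqrt (p + δ) ^ 2) := by
    rw [Real.sq_sqrt (by positivity)]; exact ha.mono (by linarith)
  have h2 : BesselBound b (Real.sqrt (q + δ) ^ 2) := by
    rw [Real.sq_sqrt (by positivity)]; exact hb.mono (by linarith)
  refine (HasFactorization.of_mul (Real.sqrt_pos.2 (by positivity))
    (Real.sqrt_pos.2 (by positivity)) h1 h2 h).mono ?_
  nlinarith [sq_nonneg (Real.sqrt (p + δ) - Real.sqrt (q + δ)),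
    Real.sq_sqrt (show 0 ≤ p + δ by positivity), Real.sq_sqrt (show 0 ≤ q + δ by positivity)]

theorem HasFactorization.norm_apply_le {u : Fin n → Fin n → G → ℂ} {c : ℝ}
    (h : HasFactorization μ u c) (i j : Fin n) (s : G) : ‖u i j s‖ ≤ c := by
  obtain ⟨h0, a, b, ha, hb, h⟩ := h
  have hs : ‖leftRegular μ s‖ ≤ 1 :=
    ContinuousLinearMap.opNorm_le_bound _ zero_le_one fun f => by
      rw [one_mul]
      exact (Lp.norm_compMeasurePreserving f (measurePreserving_mul_left μ s⁻¹)).le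
  have h1 : ‖u i j s‖ ≤ ‖a i‖ * ‖b j‖ := by
    rw [h]
    refine (norm_inner_le_norm _ _).trans ?_
    gcongr
    exact norm_ampMap_le_of_contraction hs _
  have := ha.norm_sq_le i
  have := hb.norm_sq_le j
  nlinarith [sq_nonneg (‖a i‖ - ‖b j‖)]

/-- The rows of the summands are placed in orthogonal copies of the Hilbert space, so Gram matrices
add and mixed terms vanish. This takes the place of completeness of `M_n(A(G))`: pointwise
convergence with summable constants suffices. -/
theorem HasFactorization.hasSum {u : ℕ → Fin n → Fin n → G → ℂ} {v : Fin n → Fin n → G → ℂ}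
    {c : ℕ → ℝ} {C : ℝ} (h : ∀ m, HasFactorization μ (u m) (c m)) (hc : HasSum c C)
    (hv : ∀ i j s, HasSum (fun m => u m i j s) (v i j s)) : HasFactorization μ v C := by
  choose h0 a b ha hb h using h
  have hsum : ∀ (a : ℕ → Fin n → SeqSpace (Lp ℂ 2 μ)) (_ : ∀ m, BesselBound (a m) (c m)) (i : Fin n),
      SqSummable fun m => a m i := fun a ha i =>
    Summable.of_nonneg_of_le (fun m => by positivity) (fun m => (ha m).norm_sq_le i) hc.summable
  set A : Fin n → SeqSpace (SeqSpace (Lp ℂ 2 μ)) := fun i =>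
    ⟨fun m => a m i, memℓp_two_of_summable (hsum a ha i)⟩ with hA
  set B : Fin n → SeqSpace (SeqSpace (Lp ℂ 2 μ)) := fun i =>
    ⟨fun m => b m i, memℓp_two_of_summable (hsum b hb i)⟩ with hB
  refine ⟨hc.nonneg h0, fun i => flatten (A i), fun j => flatten (B j), ?_, ?_, fun i j s => ?_⟩
  · exact (BesselBound.add_lp (A := A) (fun _ _ => rfl) ha hc).map flatten.toLinearMap
      fun x => (flatten.norm_map x).le
  · exact (BesselBound.add_lp (A := B) (fun _ _ => rfl) hb hc).map flatten.toLinearMap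
      fun x => (flatten.norm_map x).le
  · rw [inner_flatten_ampMap]
    refine (hv i j s).unique ?_ |>.trans rfl
    have : (fun m => u m i j s) = fun m => inner ℂ (A i m) (ampMap (leftRegular μ s) (B j m)) :=
      funext fun m => h m i j s
    rw [← this]
    exact (hv i j s).summable.hasSum

theorem HasFactorization.add {u v : Fin n → Fin n → G → ℂ} {c d : ℝ}
    (hu : HasFactorization μ u c) (hv : HasFactorization μ v d) :
    HasFactorization μ (u + v) (c + d) := by
  have key : ∀ {M : Type} [AddCommMonoid M] [TopologicalSpace M] (x y : M),
      HasSum (fun m : ℕ => if m = 0 then x else if m = 1 then y else 0) (x + y) := by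
    intro M _ _ x y
    have := hasSum_sum_of_ne_finset_zero
      (f := fun m : ℕ => if m = 0 then x else if m = 1 then y else 0) (s := Finset.range 2)
      (L := .unconditional ℕ) (fun m hm => by
        have : 1 < m := by simpa using hm
        rw [if_neg (by lia), if_neg (by lia)])
    simpa [Finset.sum_range_succ] using this
  refine HasFactorization.hasSum (u := fun m => if m = 0 then u else if m = 1 then v else 0)
    (fun m => ?_) (key c d) fun i j s => ?_
  · split_ifs
    · exact hu
    · exact hv
    · exact HasFactorization.zero
  · convert key (u i j s) (v i j s) using 2 with m
    · split_ifs <;> rfl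
    · rfl

end Factorization

/-! ### Positive functionals on scalar matrices and their density matrices. -/

section Density

variable {n : ℕ}

/-- The real part of the sesquilinear form `∑ conj (x i) * x j * P i j`. -/
noncomputable def quadForm (P : Fin n → Fin n → ℂ) (x : Fin n → ℂ) : ℝ :=
  (∑ i, ∑ j, star (x i) * x j * P i j).re

theorem quadForm_add (P Q : Fin n → Fin n → ℂ) (x : Fin n → ℂ) :
    quadForm (P + Q) x = quadForm P x + quadForm Q x := by
  simp [quadForm, mul_add, Finset.sum_add_distrib]

theorem quadForm_smul (c : ℝ) (P : Fin n → Fin n → ℂ) (x : Fin n → ℂ) :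
    quadForm (c • P) x = c * quadForm P x := by
  have : ∑ i, ∑ j, star (x i) * x j * (c • P) i j
      = (c : ℂ) * ∑ i, ∑ j, star (x i) * x j * P i j := by
    simp only [Finset.mul_sum, Pi.smul_apply, Complex.real_smul]
    exact Finset.sum_congr rfl fun i _ => Finset.sum_congr rfl fun j _ => by ring
  rw [quadForm, this, Complex.re_ofReal_mul, quadForm]

theorem quadForm_neg (P : Fin n → Fin n → ℂ) (x : Fin n → ℂ) :
    quadForm (-P) x = -quadForm P x := by
  simp [quadForm]

theorem quadForm_le (P : Fin n → Fin n → ℂ) (x : Fin n → ℂ) :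
    quadForm P x ≤ (∑ i, ∑ j, ‖P i j‖) * ∑ i, ‖x i‖ ^ 2 := by
  refine (Complex.re_le_norm _).trans ((norm_sum_le _ _).trans ?_)
  rw [Finset.sum_mul]
  refine Finset.sum_le_sum fun i _ => (norm_sum_le _ _).trans ?_
  rw [Finset.sum_mul]
  refine Finset.sum_le_sum fun j _ => ?_
  rw [norm_mul, norm_mul, norm_star, mul_comm]
  gcongr
  have hi := Finset.single_le_sum (f := fun i => ‖x i‖ ^ 2) (fun _ _ => by positivity)
    (Finset.mem_univ i)
  have hj := Finset.single_le_sum (f := fun i => ‖x i‖ ^ 2) (fun _ _ => by positivity)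
    (Finset.mem_univ j)
  nlinarith [sq_nonneg (‖x i‖ - ‖x j‖)]

/-- The Gram matrix of a finite family of vectors. -/
noncomputable def gram {E : Type*} [NormedAddCommGroup E] [InnerProductSpace ℂ E]
    (a : Fin n → E) : Fin n → Fin n → ℂ := fun i j => inner ℂ (a i) (a j)

theorem quadForm_gram {E : Type*} [NormedAddCommGroup E] [InnerProductSpace ℂ E]
    (a : Fin n → E) (x : Fin n → ℂ) : quadForm (gram a) x = ‖∑ i, x i • a i‖ ^ 2 := by
  have : ∑ i, ∑ j, star (x i) * x j * gram a i j
      = inner ℂ (∑ i, x i • a i) (∑ j, x j • a j) := by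
    rw [sum_inner]
    refine Finset.sum_congr rfl fun i _ => ?_
    rw [inner_sum]
    refine Finset.sum_congr rfl fun j _ => ?_
    rw [inner_smul_left, inner_smul_right, gram, mul_assoc]
    rfl
  rw [quadForm, this, inner_self_eq_norm_sq_to_K]
  norm_cast

open scoped ComplexOrder in
-- A positive functional on `M_n(ℂ)` is given by a positive semidefinite density matrix whose trace
-- is its value at the identity. Adding `ε` on the diagonal makes the density definite, hence of the
-- form `αᴴ α` with `α` invertible, at the price of `n * ε` in the trace; the sum of the `‖α p i‖ ^
-- 2` is that trace.
theorem exists_factor_of_le_quadForm (F : (Fin n → Fin n → ℂ) →ₗ[ℝ] ℝ)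
    (hF : ∀ P, (∀ x, quadForm P x ≤ 0) → F P ≤ 0)
    (hF1 : F (fun i j => if i = j then 1 else 0) ≤ 1) {ε : ℝ} (hε : 0 < ε) :
    ∃ α : Matrix (Fin n) (Fin n) ℂ, IsUnit α ∧ ∑ p, ∑ i, ‖α p i‖ ^ 2 ≤ 1 + n * ε ∧
      ∀ {E : Type u} [NormedAddCommGroup E] [InnerProductSpace ℂ E] (a : Fin n → E),
        F (gram a) ≤ ∑ p, ‖∑ i, α p i • a i‖ ^ 2 := by
  classical
  -- `quadForm` takes real parts, so it sees only the Hermitian part of `P`; `F` must vanish on the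
  -- rest. This makes the complexified functional `Fc` Hermitian.
  have hzero : ∀ P, (∀ x, quadForm P x = 0) → F P = 0 := fun P hP => by
    refine le_antisymm (hF P fun x => (hP x).le) ?_
    have := hF (-P) fun x => by rw [quadForm_neg, hP x, neg_zero]
    rwa [map_neg, neg_nonpos] at this
  set Fc : Module.Dual ℂ (Fin n → Fin n → ℂ) := Module.Dual.extendRCLike F with hFc
  have re_Fc : ∀ P, (Fc P).re = F P := fun P => Module.Dual.re_extendRCLike_apply (𝕜 := ℂ) F P
  have im_Fc : ∀ P, (Fc P).im = -F (Complex.I • P) := fun P =>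
    Module.Dual.im_extendRCLike_apply (𝕜 := ℂ) F P
  set e : Fin n → Fin n → (Fin n → Fin n → ℂ) := fun i j => Pi.single i (Pi.single j 1) with he
  have he_apply : ∀ i j k l, e i j k l = if k = i then (if l = j then 1 else 0) else 0 := by
    intro i j k l
    simp only [he, Pi.single_apply]
    split_ifs <;> simp_all
  have hdecomp : ∀ P : Fin n → Fin n → ℂ, P = ∑ i, ∑ j, P i j • e i j := by
    intro P
    funext k l
    simp only [Finset.sum_apply, Pi.smul_apply, he_apply, smul_eq_mul, mul_ite, mul_one, mul_zero]
    simp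
  have hFcP : ∀ P : Fin n → Fin n → ℂ, Fc P = ∑ i, ∑ j, P i j * Fc (e i j) := by
    intro P
    conv_lhs => rw [hdecomp P]
    simp only [map_sum, map_smul, smul_eq_mul]
  have hquad_e : ∀ (i j) (x : Fin n → ℂ), ∑ k, ∑ l, star (x k) * x l * e i j k l = star (x i) * x j := by
    intro i j x
    simp [he_apply]
  have hherm : ∀ i j, Fc (e j i) = star (Fc (e i j)) := by
    intro i j
    have h1 : F (e i j - e j i) = 0 := hzero _ fun x => by
      simp only [quadForm, Pi.sub_apply, mul_sub, Finset.sum_sub_distrib, hquad_e]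
      simp [Complex.sub_re, Complex.mul_re]
      ring
    have h2 : F (Complex.I • (e i j + e j i)) = 0 := hzero _ fun x => by
      have : ∑ k, ∑ l, star (x k) * x l * (Complex.I • (e i j + e j i)) k l
          = Complex.I * (star (x i) * x j + star (x j) * x i) := by
        rw [← hquad_e i j x, ← hquad_e j i x, ← Finset.sum_add_distrib, Finset.mul_sum]
        refine Finset.sum_congr rfl fun k _ => ?_
        rw [← Finset.sum_add_distrib, Finset.mul_sum]
        refine Finset.sum_congr rfl fun l _ => ?_
        simp only [Pi.smul_apply, Pi.add_apply, smul_eq_mul]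
        ring
      rw [quadForm, this]
      simp [Complex.mul_re, Complex.mul_im]
      ring
    rw [map_sub] at h1
    rw [smul_add, map_add] at h2
    refine Complex.ext ?_ ?_
    · rw [Complex.star_def, Complex.conj_re, re_Fc, re_Fc]; linarith
    · rw [Complex.star_def, Complex.conj_im, im_Fc, im_Fc]; linarith
  set M : Matrix (Fin n) (Fin n) ℂ := Matrix.of fun i j =>
    Fc (e i j) + if i = j then (ε : ℂ) else 0 with hM
  have hMherm : M.IsHermitian := by
    ext i j
    simp only [hM, Matrix.conjTranspose_apply, Matrix.of_apply, star_add, ← hherm]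
    by_cases h : i = j
    · subst h; simp
    · simp [h, Ne.symm h]
  have hMpos : M.PosDef := by
    refine Matrix.PosDef.of_dotProduct_mulVec_pos hMherm fun x hx => ?_
    set P : Fin n → Fin n → ℂ := fun i j => star (x i) * x j with hP
    have h1 : star x ⬝ᵥ M.mulVec x = Fc P + (ε : ℂ) * ∑ i, ((‖x i‖ ^ 2 : ℝ) : ℂ) := by
      rw [hFcP P, Finset.mul_sum, ← Finset.sum_add_distrib]
      simp only [dotProduct, Matrix.mulVec, Pi.star_apply]
      refine Finset.sum_congr rfl fun i _ => ?_
      have h2 : ∑ j, M i j * x j = (∑ j, Fc (e i j) * x j) + ε * x i := by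
        simp [hM, add_mul, Finset.sum_add_distrib]
      have h3 : ((‖x i‖ ^ 2 : ℝ) : ℂ) = star (x i) * x i := by
        push_cast
        exact (RCLike.conj_mul _).symm
      rw [h2, h3, mul_add, Finset.mul_sum]
      congr 1
      · exact Finset.sum_congr rfl fun j _ => by rw [hP]; ring
      · ring
    -- `P` has rank one: its form at `y` is `|∑ x i * y i|²`, so positivity of `F` applies.
    have hre : 0 ≤ (Fc P).re := by
      rw [re_Fc]
      have := hF (-P) fun y => by
        rw [quadForm_neg, neg_nonpos]
        have : ∑ i, ∑ j, star (y i) * y j * P i j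
            = star (∑ i, x i * y i) * ∑ j, x j * y j := by
          rw [star_sum, Finset.sum_mul_sum]
          refine Finset.sum_congr rfl fun i _ => Finset.sum_congr rfl fun j _ => ?_
          rw [hP, star_mul']; ring
        rw [quadForm, this]
        have h4 : star (∑ i, x i * y i) * ∑ j, x j * y j = ((‖∑ i, x i * y i‖ ^ 2 : ℝ) : ℂ) := by
          push_cast
          exact RCLike.conj_mul _
        rw [h4, Complex.ofReal_re]
        positivity
      rw [map_neg] at this
      linarith
    have him : (Fc P).im = 0 := by
      rw [im_Fc, neg_eq_zero]
      refine hzero _ fun y => ?_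
      have : ∑ i, ∑ j, star (y i) * y j * (Complex.I • P) i j
          = Complex.I * (star (∑ i, x i * y i) * ∑ j, x j * y j) := by
        rw [star_sum, Finset.sum_mul_sum, Finset.mul_sum]
        refine Finset.sum_congr rfl fun i _ => ?_
        rw [Finset.mul_sum]
        refine Finset.sum_congr rfl fun j _ => ?_
        simp only [hP, Pi.smul_apply, smul_eq_mul, star_mul']; ring
      have h4 : star (∑ i, x i * y i) * ∑ j, x j * y j = ((‖∑ i, x i * y i‖ ^ 2 : ℝ) : ℂ) := by
        push_cast
        exact RCLike.conj_mul _
      rw [quadForm, this, h4, Complex.I_mul_re, Complex.ofReal_im, neg_zero]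
    have hsum : 0 < ∑ i, ‖x i‖ ^ 2 := by
      obtain ⟨i, hi⟩ := Function.ne_iff.1 hx
      exact Finset.sum_pos' (fun _ _ => by positivity)
        ⟨i, Finset.mem_univ i, by have := norm_pos_iff.2 hi; positivity⟩
    have h5 : Fc P = ((Fc P).re : ℂ) := Complex.ext (by simp) (by simp [him])
    rw [h1, h5, ← Complex.ofReal_sum, ← Complex.ofReal_mul, ← Complex.ofReal_add]
    have : 0 < (Fc P).re + ε * ∑ i, ‖x i‖ ^ 2 := by positivity
    exact_mod_cast this
  obtain ⟨α, hα, hαM⟩ : ∃ α : Matrix (Fin n) (Fin n) ℂ, IsUnit α ∧ M = star α * α := by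
    open scoped MatrixOrder in
    exact CStarAlgebra.isStrictlyPositive_iff_eq_star_mul_self.1
      (Matrix.isStrictlyPositive_iff_posDef.2 hMpos)
  have hMentry : ∀ i j, ∑ p, star (α p i) * α p j = M i j := by
    intro i j
    rw [hαM]
    simp [Matrix.mul_apply, Matrix.star_eq_conjTranspose]
  refine ⟨α, hα, ?_, ?_⟩
  · have h1 : ((∑ p, ∑ i, ‖α p i‖ ^ 2 : ℝ) : ℂ) = ∑ i, M i i := by
      rw [Finset.sum_comm]
      push_cast
      refine Finset.sum_congr rfl fun i _ => ?_
      rw [← hMentry]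
      exact Finset.sum_congr rfl fun p _ => (RCLike.conj_mul _).symm
    have h2 : ∑ i, M i i = Fc (fun i j => if i = j then 1 else 0) + n * ε := by
      rw [hFcP]
      simp [hM, Finset.sum_add_distrib]
    have h3 := congrArg Complex.re (h1.trans h2)
    rw [Complex.ofReal_re, Complex.add_re, re_Fc] at h3
    rw [h3]
    have : ((n : ℂ) * ε).re = n * ε := by norm_cast
    rw [this]
    linarith
  · intro E _ _ a
    have h1 : ((∑ p, ‖∑ i, α p i • a i‖ ^ 2 : ℝ) : ℂ) = ∑ i, ∑ j, gram a i j * M i j := by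
      push_cast
      have : ∀ p, ((‖∑ i, α p i • a i‖ : ℂ)) ^ 2
          = ∑ i, ∑ j, star (α p i) * α p j * gram a i j := fun p => by
        rw [← Complex.coe_algebraMap, ← inner_self_eq_norm_sq_to_K (𝕜 := ℂ), sum_inner]
        refine Finset.sum_congr rfl fun i _ => ?_
        rw [inner_sum]
        refine Finset.sum_congr rfl fun j _ => ?_
        rw [inner_smul_left, inner_smul_right, gram, mul_assoc]
        rfl
      simp only [this]
      rw [Finset.sum_comm]
      refine Finset.sum_congr rfl fun i _ => ?_
      rw [Finset.sum_comm]
      refine Finset.sum_congr rfl fun j _ => ?_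
      rw [← hMentry, ← Finset.sum_mul, mul_comm]
    have h2 : ∑ i, ∑ j, gram a i j * M i j = Fc (gram a) + ε * ∑ i, ((‖a i‖ ^ 2 : ℝ) : ℂ) := by
      rw [hFcP]
      simp only [hM, Matrix.of_apply, mul_add, Finset.sum_add_distrib, mul_ite, mul_zero,
        Finset.sum_ite_eq, Finset.mem_univ, if_true]
      rw [Finset.mul_sum]
      congr 1
      refine Finset.sum_congr rfl fun i _ => ?_
      rw [mul_comm, gram, inner_self_eq_norm_sq_to_K]
      norm_cast
      exact (Complex.ofReal_mul _ _).symm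
    have h3 := congrArg Complex.re (h1.trans h2)
    rw [Complex.ofReal_re, Complex.add_re, re_Fc, ← Complex.ofReal_sum, ← Complex.ofReal_mul,
      Complex.ofReal_re] at h3
    rw [h3]
    have : 0 ≤ ε * ∑ i, ‖a i‖ ^ 2 := by positivity
    linarith

end Density

/-! ### Orthogonal sums of two sequences. -/

section Join

variable {E F : Type*} [NormedAddCommGroup E] [InnerProductSpace ℂ E]
  [NormedAddCommGroup F] [InnerProductSpace ℂ F]

/-- Two square-summable sequences, merged into one. -/
noncomputable def join (x y : SeqSpace E) : SeqSpace E :=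
  flatten (lp.single 2 0 x + lp.single 2 1 y)

theorem inner_join_ampMap (T : E →L[ℂ] F) (x y : SeqSpace E) (x' y' : SeqSpace F) :
    inner ℂ (join x' y') (ampMap T (join x y)) =
      inner ℂ x' (ampMap T x) + inner ℂ y' (ampMap T y) := by
  rw [join, join, ampMap_flatten, LinearIsometry.inner_map_map, map_add, inner_add_right,
    inner_ampMap_single, inner_ampMap_single]
  simp

theorem norm_sq_join (x y : SeqSpace E) : ‖join x y‖ ^ 2 = ‖x‖ ^ 2 + ‖y‖ ^ 2 := by
  have := inner_join_ampMap (ContinuousLinearMap.id ℂ E) x y x y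
  have h : ∀ z : SeqSpace E, ampMap (ContinuousLinearMap.id ℂ E) z = z := fun z => rfl
  rw [h, h, h, inner_self_eq_norm_sq_to_K, inner_self_eq_norm_sq_to_K,
    inner_self_eq_norm_sq_to_K] at this
  exact_mod_cast this

theorem sum_smul_join {n : ℕ} (c : Fin n → ℂ) (x y : Fin n → SeqSpace E) :
    ∑ i, c i • join (x i) (y i) = join (∑ i, c i • x i) (∑ i, c i • y i) := by
  have h0 := map_sum (lp.singleContinuousLinearMap ℂ (fun _ : ℕ => SeqSpace E) 2 0)
    (fun i => c i • x i) Finset.univ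
  have h1 := map_sum (lp.singleContinuousLinearMap ℂ (fun _ : ℕ => SeqSpace E) 2 1)
    (fun i => c i • y i) Finset.univ
  simp only [map_smul, lp.singleContinuousLinearMap_apply] at h0 h1
  simp only [join, ← map_smul, ← map_sum, smul_add, Finset.sum_add_distrib]
  rw [← h0, ← h1]

end Join

/-! ### Bounded functionals on the Fourier algebra. -/

section Functional

variable {G : Type u} [Group G] [TopologicalSpace G] [IsTopologicalGroup G]
  [MeasurableSpace G] [BorelSpace G] (μ : Measure G) [μ.IsHaarMeasure] {n : ℕ}

theorem coefficient_add_left (ξ ξ' η : SeqSpace (Lp ℂ 2 μ)) :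
    coefficient μ (ξ + ξ') η = coefficient μ ξ η + coefficient μ ξ' η := by
  ext s
  simp [coefficient_apply]

theorem coefficient_add_right (ξ η η' : SeqSpace (Lp ℂ 2 μ)) :
    coefficient μ ξ (η + η') = coefficient μ ξ η + coefficient μ ξ η' := by
  ext s
  simp [coefficient_apply]

theorem coefficient_smul_left (c : ℂ) (ξ η : SeqSpace (Lp ℂ 2 μ)) :
    coefficient μ (c • ξ) η = c • coefficient μ ξ η := by
  ext s
  simp [coefficient_apply]

theorem coefficient_smul_right (c : ℂ) (ξ η : SeqSpace (Lp ℂ 2 μ)) :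
    coefficient μ ξ (c • η) = star c • coefficient μ ξ η := by
  ext s
  simp [coefficient_apply, mul_comm]

theorem coefficient_single (k : ℕ) (f : Lp ℂ 2 μ) (η : SeqSpace (Lp ℂ 2 μ)) :
    coefficient μ (lp.single 2 k f) η
      = coefficient μ (lp.single 2 0 f) (lp.single 2 0 (η k)) := by
  ext s
  rw [coefficient_apply, coefficient_apply, inner_ampMap_single, inner_ampMap_single]
  simp

/-- A functional on `A(G)` that is bounded on coefficients is given by an element of `VN(G)`. -/
theorem exists_mem_groupVN_of_bounded (L : fourierAlgebra μ →ₗ[ℂ] ℂ) {C : ℝ}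
    (hL : ∀ ξ η, ‖L (coefficient μ ξ η)‖ ≤ C * ‖ξ‖ * ‖η‖) :
    ∃ T ∈ groupVN μ, ∀ u, L u = pairing μ T u := by
  have hL' : ∀ η ξ, ‖L (coefficient μ ξ η)‖ ≤ C * ‖η‖ * ‖ξ‖ := fun η ξ => by
    rw [mul_right_comm]; exact hL ξ η
  let ι := lp.singleContinuousLinearMap ℂ (fun _ : ℕ => Lp ℂ 2 μ) 2 0
  have ι_apply : ∀ f, ι f = lp.single 2 0 f := fun f => rfl
  have ι_norm : ∀ f, ‖ι f‖ = ‖f‖ := fun f => by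
    rw [ι_apply, lp.norm_single (by norm_num)]
  -- The operator is obtained by Riesz representation from the sesquilinear form that `L` induces on
  -- rank-one coefficients.
  let B : Lp ℂ 2 μ →L⋆[ℂ] Lp ℂ 2 μ →L[ℂ] ℂ := LinearMap.mkContinuous₂
    (LinearMap.mk₂'ₛₗ (starRingEnd ℂ) (RingHom.id ℂ)
      (fun g f => L (coefficient μ (ι f) (ι g)))
      (fun g g' f => by rw [map_add, coefficient_add_right, map_add])
      (fun c g f => by rw [map_smul, coefficient_smul_right, map_smul]; rfl)
      (fun g f f' => by rw [map_add, coefficient_add_left, map_add])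
      (fun c g f => by rw [map_smul, coefficient_smul_left, map_smul]; rfl)) C
    (fun g f => by
      rw [LinearMap.mk₂'ₛₗ_apply]
      refine (hL' _ _).trans_eq ?_
      rw [ι_norm, ι_norm])
  let T := ContinuousLinearMap.adjoint (InnerProductSpace.continuousLinearMapOfBilin B)
  have hT : ∀ g f, inner ℂ g (T f) = L (coefficient μ (ι f) (ι g)) := fun g f => by
    rw [ContinuousLinearMap.adjoint_inner_right,
      InnerProductSpace.continuousLinearMapOfBilin_apply]
    rfl
  -- For `S` in the commutant, `⟨λ(s) f | S* g⟩ = ⟨λ(s) S f | g⟩` for all `s`. Both sides are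
  -- therefore the same element of `A(G)`, and `L` cannot tell them apart; so `T` commutes with `S`.
  have hTmem : T ∈ groupVN μ := by
    rw [mem_groupVN]
    intro S hS
    refine ContinuousLinearMap.ext fun f => ext_inner_left ℂ fun g => ?_
    change inner ℂ g (S (T f)) = inner ℂ g (T (S f))
    rw [← ContinuousLinearMap.adjoint_inner_left, hT, hT]
    congr 1
    ext s
    rw [coefficient_apply, coefficient_apply, ι_apply, ι_apply, ι_apply, ι_apply,
      inner_ampMap_single, inner_ampMap_single]
    simp only [lp.single_apply_self]
    rw [ContinuousLinearMap.adjoint_inner_left]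
    exact congrArg _ (DFunLike.congr_fun (hS (leftRegular μ s) ⟨s, rfl⟩) f).symm
  refine ⟨T, hTmem, fun u => ?_⟩
  obtain ⟨ξ, η, rfl⟩ := exists_eq_coefficient μ u
  rw [pairing_coefficient μ hTmem]
  -- For fixed `η` both sides are continuous in `ξ`, so it is enough to compare them on vectors with
  -- one nonzero coordinate.
  let A : SeqSpace (Lp ℂ 2 μ) →L[ℂ] ℂ := LinearMap.mkContinuous
    { toFun := fun ξ => L (coefficient μ ξ η)
      map_add' := fun ξ ξ' => by rw [coefficient_add_left, map_add]
      map_smul' := fun c ξ => by rw [coefficient_smul_left, map_smul]; rfl } (C * ‖η‖)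
    (fun ξ => hL' η ξ)
  let A' : SeqSpace (Lp ℂ 2 μ) →L[ℂ] ℂ := (innerSL ℂ η).comp (ampMap T)
  have hA := A.hasSum (lp.hasSum_single (by norm_num) ξ)
  have hA' := A'.hasSum (lp.hasSum_single (by norm_num) ξ)
  have heq : ∀ k, A (lp.single 2 k (ξ k)) = A' (lp.single 2 k (ξ k)) := fun k => by
    change L (coefficient μ (lp.single 2 k (ξ k)) η)
      = inner ℂ η (ampMap T (lp.single 2 k (ξ k)))
    rw [inner_ampMap_single, hT, coefficient_single]
    rfl
  simp only [heq] at hA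
  exact hA.unique hA'

end Functional

/-! ### Perturbed factorization bounds and Hahn-Banach. -/

section Extension

variable {G : Type u} [Group G] [TopologicalSpace G] [IsTopologicalGroup G]
  [MeasurableSpace G] [BorelSpace G] (μ : Measure G) [μ.IsHaarMeasure] {n : ℕ}

theorem besselBound_single {E : Type*} [NormedAddCommGroup E] [InnerProductSpace ℂ E]
    (i : Fin n) (η : E) : BesselBound (Pi.single i η) (‖η‖ ^ 2) := fun x => by
  have : ∑ k, x k • (Pi.single i η : Fin n → E) k = x i • η := by
    rw [Finset.sum_eq_single i (fun k _ hk => by rw [Pi.single_eq_of_ne hk, smul_zero])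
      (fun h => absurd (Finset.mem_univ i) h), Pi.single_eq_same]
  rw [this, norm_smul, mul_pow, mul_comm]
  gcongr
  exact Finset.single_le_sum (f := fun i => ‖x i‖ ^ 2) (fun _ _ => by positivity)
    (Finset.mem_univ i)

theorem coefficient_pi_single (i j : Fin n) (ξ η : SeqSpace (Lp ℂ 2 μ)) (i' j' : Fin n) :
    Matrix.single i j (coefficient μ ξ η) i' j' = coefficient μ
      ((Pi.single j ξ : Fin n → SeqSpace (Lp ℂ 2 μ)) j')
      ((Pi.single i η : Fin n → SeqSpace (Lp ℂ 2 μ)) i') := by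
  by_cases hi : i = i'
  · subst hi
    by_cases hj : j = j'
    · subst hj; simp
    · rw [Matrix.single_apply, if_neg (by simp [hj]), Pi.single_eq_of_ne (Ne.symm hj)]
      ext s; simp [coefficient_apply]
  · rw [Matrix.single_apply, if_neg (by simp [hi]), Pi.single_eq_of_ne (Ne.symm hi)]
    ext s; simp [coefficient_apply]

theorem exists_hasFactorization (v : Matrix (Fin n) (Fin n) (fourierAlgebra μ)) :
    ∃ c, HasFactorization μ (fun i j => (v i j : G → ℂ)) c := by
  induction v using Matrix.induction_on' with
  | h_zero => exact ⟨0, HasFactorization.zero⟩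
  | h_add p q hp hq =>
    obtain ⟨c, hc⟩ := hp
    obtain ⟨d, hd⟩ := hq
    exact ⟨c + d, hc.add hd⟩
  | h_std_basis i j x =>
    obtain ⟨ξ, η, rfl⟩ := exists_eq_coefficient μ x
    refine ⟨‖ξ‖ ^ 2 + ‖η‖ ^ 2, by positivity, Pi.single i η, Pi.single j ξ,
      (besselBound_single i η).mono (by linarith [sq_nonneg ‖ξ‖]),
      (besselBound_single j ξ).mono (by linarith [sq_nonneg ‖η‖]), fun i' j' s => ?_⟩
    exact congrArg (fun w : fourierAlgebra μ => (w : G → ℂ) s)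
      (coefficient_pi_single μ i j ξ η i' j')

/-- Matrices over `A(G)`, with two scalar matrices which stand for quadratic forms. -/
abbrev PerturbationSpace (n : ℕ) := Matrix (Fin n) (Fin n) (fourierAlgebra μ) ×
  (Fin n → Fin n → ℂ) × (Fin n → Fin n → ℂ)

/-- `r = s + t` bounds a matrix `v` over `A(G)`, perturbed by the quadratic forms `P` and `Q`, if
`v` factors through rows whose Gram matrices are at most `s - P` and `t - Q`. -/
def IsPerturbedBound (X : PerturbationSpace μ n) (r : ℝ) : Prop :=
  ∃ (s t : ℝ) (a b : Fin n → SeqSpace (Lp ℂ 2 μ)), 0 ≤ s ∧ 0 ≤ t ∧ r = s + t ∧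
    (∀ x : Fin n → ℂ, quadForm X.2.1 x + ‖∑ i, x i • a i‖ ^ 2 ≤ s * ∑ i, ‖x i‖ ^ 2) ∧
    (∀ x : Fin n → ℂ, quadForm X.2.2 x + ‖∑ i, x i • b i‖ ^ 2 ≤ t * ∑ i, ‖x i‖ ^ 2) ∧
    ∀ i j, X.1 i j = coefficient μ (b j) (a i)

variable {μ}

theorem IsPerturbedBound.nonneg {X : PerturbationSpace μ n} {r : ℝ} (h : IsPerturbedBound μ X r) : 0 ≤ r := by
  obtain ⟨s, t, -, -, hs, ht, rfl, -⟩ := h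
  positivity

/-- Orthogonal sums of rows add Gram matrices, and the forms `P`, `Q` enter linearly. Carrying the
forms along lets one separating functional produce both the operators that represent it and the
positive functionals that dominate them. -/
theorem IsPerturbedBound.add {X Y : PerturbationSpace μ n} {r r' : ℝ} (h : IsPerturbedBound μ X r)
    (h' : IsPerturbedBound μ Y r') : IsPerturbedBound μ (X + Y) (r + r') := by
  obtain ⟨s, t, a, b, hs, ht, rfl, ha, hb, hv⟩ := h
  obtain ⟨s', t', a', b', hs', ht', rfl, ha', hb', hv'⟩ := h'
  refine ⟨s + s', t + t', fun i => join (a i) (a' i), fun i => join (b i) (b' i), by positivity,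
    by positivity, by ring, fun x => ?_, fun x => ?_, fun i j => ?_⟩
  · rw [sum_smul_join, norm_sq_join, Prod.snd_add, Prod.fst_add, quadForm_add]
    linarith [ha x, ha' x]
  · rw [sum_smul_join, norm_sq_join, Prod.snd_add, Prod.snd_add, quadForm_add]
    linarith [hb x, hb' x]
  · rw [Prod.fst_add, Matrix.add_apply, hv, hv']
    ext s
    simp [coefficient_apply, inner_join_ampMap]

theorem IsPerturbedBound.smul {X : PerturbationSpace μ n} {r : ℝ} (h : IsPerturbedBound μ X r) {c : ℝ}
    (hc : 0 < c) : IsPerturbedBound μ (c • X) (c * r) := by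
  obtain ⟨s, t, a, b, hs, ht, rfl, ha, hb, hv⟩ := h
  have hw : ‖((Real.sqrt c : ℝ) : ℂ)‖ ^ 2 = c := by
    rw [Complex.norm_real, Real.norm_eq_abs, sq_abs, Real.sq_sqrt hc.le]
  have key : ∀ (a : Fin n → SeqSpace (Lp ℂ 2 μ)) (x : Fin n → ℂ),
      ‖∑ i, x i • ((Real.sqrt c : ℝ) : ℂ) • a i‖ ^ 2 = c * ‖∑ i, x i • a i‖ ^ 2 := fun a x => by
    have : ∑ i, x i • ((Real.sqrt c : ℝ) : ℂ) • a i
        = ((Real.sqrt c : ℝ) : ℂ) • ∑ i, x i • a i := by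
      rw [Finset.smul_sum]; exact Finset.sum_congr rfl fun i _ => smul_comm _ _ _
    rw [this, norm_smul, mul_pow, hw]
  refine ⟨c * s, c * t, fun i => ((Real.sqrt c : ℝ) : ℂ) • a i,
    fun i => ((Real.sqrt c : ℝ) : ℂ) • b i, by positivity, by positivity, by ring,
    fun x => ?_, fun x => ?_, fun i j => ?_⟩
  · rw [key, Prod.smul_snd, Prod.smul_fst, quadForm_smul, ← mul_add, mul_assoc]
    exact mul_le_mul_of_nonneg_left (ha x) hc.le
  · rw [key, Prod.smul_snd, Prod.smul_snd, quadForm_smul, ← mul_add, mul_assoc]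
    exact mul_le_mul_of_nonneg_left (hb x) hc.le
  · rw [coefficient_smul_left, coefficient_smul_right, smul_smul, Prod.smul_fst, Matrix.smul_apply,
      hv, Complex.star_def, Complex.conj_ofReal, ← Complex.ofReal_mul, Real.mul_self_sqrt hc.le,
      Complex.coe_smul]

theorem exists_isPerturbedBound (X : PerturbationSpace μ n) : ∃ r, IsPerturbedBound μ X r := by
  obtain ⟨v, P, Q⟩ := X
  obtain ⟨c, h0, a, b, ha, hb, hv⟩ := exists_hasFactorization μ v
  refine ⟨_, ∑ i, ∑ j, ‖P i j‖ + c, ∑ i, ∑ j, ‖Q i j‖ + c, a, b, by positivity, by positivity, rfl,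
    fun x => ?_, fun x => ?_, fun i j => ?_⟩
  · rw [add_mul]
    exact add_le_add (quadForm_le P x) (ha x)
  · rw [add_mul]
    exact add_le_add (quadForm_le Q x) (hb x)
  · ext s
    exact hv i j s

/-- Hahn-Banach, for the infimum of the perturbed bounds. -/
theorem exists_functional_of_perturbedBound (v : Matrix (Fin n) (Fin n) (fourierAlgebra μ)) {c : ℝ}
    (hc : ∀ r, IsPerturbedBound μ (v, 0, 0) r → c ≤ r) (hc0 : 0 < c) :
    ∃ F : PerturbationSpace μ n →ₗ[ℝ] ℝ, F (v, 0, 0) = c ∧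
        ∀ X r, IsPerturbedBound μ X r → F X ≤ r := by
  -- The infimum of the perturbed bounds is sublinear. It is finite because every matrix over `A(G)`
  -- has some factorization and every form is bounded by a multiple of the identity.
  set N : PerturbationSpace μ n → ℝ := fun X => sInf {r | IsPerturbedBound μ X r} with hN
  have hbdd : ∀ X : PerturbationSpace μ n, BddBelow {r | IsPerturbedBound μ X r} := fun X => ⟨0, fun r hr => hr.nonneg⟩
  have N_le : ∀ X r, IsPerturbedBound μ X r → N X ≤ r := fun X r hr => csInf_le (hbdd X) hr
  have N_nonneg : ∀ X, 0 ≤ N X := fun X => Real.sInf_nonneg fun r hr => hr.nonneg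
  have N_smul_le : ∀ c : ℝ, 0 < c → ∀ X : PerturbationSpace μ n, N (c • X) ≤ c * N X := fun c hc X => by
    rw [← div_le_iff₀' hc]
    refine le_csInf (exists_isPerturbedBound X) fun r hr => ?_
    rw [div_le_iff₀' hc]
    exact N_le _ _ (hr.smul hc)
  have N_smul : ∀ c : ℝ, 0 < c → ∀ X, N (c • X) = c * N X := fun c hc X => by
    refine le_antisymm (N_smul_le c hc X) ?_
    have := N_smul_le c⁻¹ (inv_pos.2 hc) (c • X)
    rw [smul_smul, inv_mul_cancel₀ hc.ne', one_smul] at this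
    rwa [← le_inv_mul_iff₀ hc]
  have N_add : ∀ X Y, N (X + Y) ≤ N X + N Y := fun X Y => by
    refine le_of_forall_pos_lt_add fun ε hε => ?_
    obtain ⟨r, hr, hr'⟩ := exists_lt_of_csInf_lt (exists_isPerturbedBound X)
      (show N X < N X + ε / 2 by linarith)
    obtain ⟨t, ht, ht'⟩ := exists_lt_of_csInf_lt (exists_isPerturbedBound Y)
      (show N Y < N Y + ε / 2 by linarith)
    linarith [N_le _ _ (IsPerturbedBound.add hr ht)]
  have hcN : c ≤ N (v, 0, 0) := le_csInf (exists_isPerturbedBound _) hc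
  have N_zero : N 0 = 0 := by
    have := N_smul 2 (by norm_num) 0
    rw [smul_zero] at this
    linarith
  have hv : ((v, 0, 0) : PerturbationSpace μ n) ≠ 0 := fun h => by
    rw [h, N_zero] at hcN
    linarith
  let f := LinearPMap.mkSpanSingleton (K := ℝ) (L := ℝ) (σ := RingHom.id ℝ) _ c hv
  obtain ⟨F, hF, hFN⟩ := exists_extension_of_le_sublinear f N N_smul N_add (by
    rintro ⟨X, hX⟩
    obtain ⟨t, rfl⟩ := Submodule.mem_span_singleton.1 hX
    rw [LinearPMap.mkSpanSingleton'_apply]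
    simp only [RingHom.id_apply, smul_eq_mul]
    rcases le_or_gt t 0 with ht | ht
    · exact (mul_nonpos_of_nonpos_of_nonneg ht hc0.le).trans (N_nonneg _)
    · rw [N_smul t ht]
      exact mul_le_mul_of_nonneg_left hcN ht.le)
  refine ⟨F, ?_, fun X r hr => (hFN X).trans (N_le X r hr)⟩
  have hmem : ((v, 0, 0) : PerturbationSpace μ n) ∈ f.domain := Submodule.mem_span_singleton_self _
  rw [hF ⟨_, hmem⟩]
  exact LinearPMap.mkSpanSingleton'_apply_self _ _ _ _

end Extension

/-! ### Two-sided multiplication by scalar matrices. -/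

section Compress

variable {n : ℕ} {X : Type*} [AddCommGroup X] [Module ℂ X]

/-- The product `Aᴴ T B`, for scalar matrices `A` and `B`. -/
noncomputable def compress (A B : Matrix (Fin n) (Fin n) ℂ) (T : Matrix (Fin n) (Fin n) X) :
    Matrix (Fin n) (Fin n) X :=
  Matrix.of fun p q => ∑ i, ∑ j, (star (A i p) * B j q) • T i j

theorem compress_apply (A B : Matrix (Fin n) (Fin n) ℂ) (T : Matrix (Fin n) (Fin n) X)
    (p q : Fin n) : compress A B T p q = ∑ i, ∑ j, (star (A i p) * B j q) • T i j := rfl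

theorem sum_four_comm {M : Type*} [AddCommMonoid M] (f : Fin n → Fin n → Fin n → Fin n → M) :
    ∑ i, ∑ j, ∑ p, ∑ q, f i j p q = ∑ p, ∑ q, ∑ i, ∑ j, f i j p q := by
  calc _ = ∑ ij : Fin n × Fin n, ∑ pq : Fin n × Fin n, f ij.1 ij.2 pq.1 pq.2 := by
        simp only [Fintype.sum_prod_type]
    _ = ∑ pq : Fin n × Fin n, ∑ ij : Fin n × Fin n, f ij.1 ij.2 pq.1 pq.2 := Finset.sum_comm
    _ = _ := by simp only [Fintype.sum_prod_type]

theorem compress_compress (A B A' B' : Matrix (Fin n) (Fin n) ℂ) (T : Matrix (Fin n) (Fin n) X) :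
    compress A' B' (compress A B T) = compress (A * A') (B * B') T := by
  ext p q
  simp only [compress_apply, Finset.smul_sum, smul_smul]
  rw [sum_four_comm]
  refine Finset.sum_congr rfl fun i _ => Finset.sum_congr rfl fun j _ => ?_
  simp only [← Finset.sum_smul]
  congr 1
  rw [Matrix.mul_apply, Matrix.mul_apply, star_sum, Finset.sum_mul_sum]
  refine Finset.sum_congr rfl fun k _ => Finset.sum_congr rfl fun l _ => ?_
  rw [star_mul']
  ring

theorem compress_one (T : Matrix (Fin n) (Fin n) X) : compress 1 1 T = T := by
  ext p q
  simp [compress_apply, Matrix.one_apply, apply_ite, ite_smul]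

theorem sum_inner_compress {E : Type*} [NormedAddCommGroup E] [InnerProductSpace ℂ E]
    (A B : Matrix (Fin n) (Fin n) ℂ) (T : Matrix (Fin n) (Fin n) (E →L[ℂ] E)) (w ξ : Fin n → E) :
    ∑ i, ∑ j, inner ℂ (∑ p, A i p • w p) (T i j (∑ q, B j q • ξ q))
      = ∑ p, inner ℂ (w p) (∑ q, compress A B T p q (ξ q)) := by
  simp only [compress_apply, map_sum, map_smul, sum_inner, inner_sum, inner_smul_left,
    inner_smul_right, _root_.sum_apply, _root_.smul_apply]
  have h := sum_four_comm (fun i j p q : Fin n =>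
    (star (A i p) * B j q) * inner ℂ (w p) (T i j (ξ q)))
  rw [← h]
  refine Finset.sum_congr rfl fun i _ => Finset.sum_congr rfl fun j _ => ?_
  rw [Finset.sum_comm]
  refine Finset.sum_congr rfl fun q _ => ?_
  rw [Finset.mul_sum]
  refine Finset.sum_congr rfl fun p _ => ?_
  simp only [Complex.star_def]
  ring

end Compress

/-! ### Matrix norm and factorization constant. -/

section Factor

variable {G : Type u} [Group G] [TopologicalSpace G] [IsTopologicalGroup G]
  [MeasurableSpace G] [BorelSpace G] {μ : Measure G} [μ.IsHaarMeasure] {n : ℕ}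

/-- A matrix with one nonzero entry `coefficient μ ξ η` has perturbed bound `‖ξ‖² + ‖η‖²`. Rotating
the phase turns this into a bound on the modulus, and normalizing both vectors gives the constant `2
= 1 + 1`. -/
theorem norm_functional_coefficient_le {F : PerturbationSpace μ n →ₗ[ℝ] ℝ}
    (hF : ∀ X r, IsPerturbedBound μ X r → F X ≤ r)
    (Fc : Matrix (Fin n) (Fin n) (fourierAlgebra μ) →ₗ[ℂ] ℂ) (hFc : ∀ v, (Fc v).re = F (v, 0, 0))
    (i j : Fin n) (ξ η : SeqSpace (Lp ℂ 2 μ)) :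
    ‖Fc (Matrix.single i j (coefficient μ ξ η))‖ ≤ 2 * ‖ξ‖ * ‖η‖ := by
  have hquad0 : ∀ x : Fin n → ℂ, quadForm 0 x = 0 := fun x => by simp [quadForm]
  have hre : ∀ ξ η, (Fc (Matrix.single i j (coefficient μ ξ η))).re ≤ ‖ξ‖ ^ 2 + ‖η‖ ^ 2 := by
    intro ξ η
    rw [hFc]
    refine hF _ _ ⟨‖η‖ ^ 2, ‖ξ‖ ^ 2, Pi.single i η, Pi.single j ξ, by positivity, by positivity,
      by ring, fun x => ?_, fun x => ?_, fun i' j' => coefficient_pi_single μ i j ξ η i' j'⟩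
    · rw [hquad0, zero_add]; exact besselBound_single i η x
    · rw [hquad0, zero_add]; exact besselBound_single j ξ x
  have hsmul : ∀ (c : ℂ) ξ η, Fc (Matrix.single i j (coefficient μ (c • ξ) η))
      = c * Fc (Matrix.single i j (coefficient μ ξ η)) := fun c ξ η => by
    rw [coefficient_smul_left, ← Matrix.smul_single, map_smul, smul_eq_mul]
  have hnorm : ∀ ξ η, ‖Fc (Matrix.single i j (coefficient μ ξ η))‖ ≤ ‖ξ‖ ^ 2 + ‖η‖ ^ 2 := by
    intro ξ η
    set z := Fc (Matrix.single i j (coefficient μ ξ η)) with hz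
    rcases eq_or_ne z 0 with h0 | h0
    · rw [h0, norm_zero]; positivity
    have hz0 : (‖z‖ : ℂ) ≠ 0 := by exact_mod_cast (norm_pos_iff.2 h0).ne'
    have h1 := hre ((star z / ‖z‖) • ξ) η
    rw [hsmul, ← hz, norm_smul, norm_div, norm_star, Complex.norm_real, norm_norm,
      div_self (norm_pos_iff.2 h0).ne', one_mul] at h1
    have h2 : star z / ‖z‖ * z = ‖z‖ := by
      rw [div_mul_eq_mul_div, Complex.star_def, Complex.conj_mul', sq, mul_div_cancel_right₀ _ hz0]
    rwa [h2, Complex.ofReal_re] at h1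
  rcases eq_or_ne ξ 0 with rfl | hξ
  · have := hsmul 0 0 η
    rw [zero_smul, zero_mul] at this
    rw [this]; simp
  rcases eq_or_ne η 0 with rfl | hη
  · have : coefficient μ ξ (0 : SeqSpace (Lp ℂ 2 μ)) = 0 := by ext s; simp [coefficient_apply]
    rw [this]; simp
  have hξ' := norm_pos_iff.2 hξ
  have hη' := norm_pos_iff.2 hη
  have h1 := hnorm (((‖ξ‖⁻¹ : ℝ) : ℂ) • ξ) (((‖η‖⁻¹ : ℝ) : ℂ) • η)
  rw [hsmul, coefficient_smul_right, ← Matrix.smul_single, map_smul, norm_smul, norm_smul,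
    norm_mul, norm_smul, norm_star] at h1
  simp only [Complex.norm_real, Real.norm_eq_abs, abs_inv, abs_norm,
    inv_mul_cancel₀ hξ'.ne', inv_mul_cancel₀ hη'.ne'] at h1
  rw [← mul_assoc, ← mul_inv, inv_mul_le_iff₀ (by positivity)] at h1
  linarith

/-- The hard half of the description of the norm. The functional `F` is represented by operators `T
i j` in `VN(G)`, and its parts on the two scalar slots are positive functionals of mass at most one.
These dominate the form of `T`, so `T = αᴴ S β` with `‖S‖ ≤ 2` and with `α`, `β` of Hilbert-Schmidt
norm almost at most one. Pairing `S / 2` with `v` gives a scalar matrix of norm at most `C`. -/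
theorem functional_le_of_matrixNorm_le (v : Matrix (Fin n) (Fin n) (fourierAlgebra μ)) {C : ℝ}
    (hC : 0 ≤ C) (hv : fourierMatrixNorm μ n v ≤ ENNReal.ofReal C)
    {F : PerturbationSpace μ n →ₗ[ℝ] ℝ} (hF : ∀ X r, IsPerturbedBound μ X r → F X ≤ r) :
    F (v, 0, 0) ≤ 2 * C := by
  classical
  -- the operators that represent `F` on `M_n(A(G))`
  let Fc : Matrix (Fin n) (Fin n) (fourierAlgebra μ) →ₗ[ℂ] ℂ :=
    Module.Dual.extendRCLike (𝕜 := ℂ) (F.comp (LinearMap.inl ℝ _ _))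
  have hFc : ∀ v, (Fc v).re = F (v, 0, 0) := fun v =>
    Module.Dual.re_extendRCLike_apply (𝕜 := ℂ) (F.comp (LinearMap.inl ℝ _ _)) v
  have hT : ∀ i j, ∃ T ∈ groupVN μ, ∀ u, Fc (Matrix.single i j u) = pairing μ T u := fun i j =>
    exists_mem_groupVN_of_bounded μ (Fc.comp (Matrix.singleLinearMap ℂ i j))
      (norm_functional_coefficient_le hF Fc hFc i j)
  choose T hTmem hT using hT
  have hFcT : ∀ u, Fc u = ∑ i, ∑ j, pairing μ (T i j) (u i j) := fun u => by
    conv_lhs => rw [Matrix.matrix_eq_sum_single u]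
    simp only [map_sum, hT]
  -- the quadratic forms that dominate `F`
  have hquad0 : ∀ x : Fin n → ℂ, quadForm 0 x = 0 := fun x => by simp [quadForm]
  have hvzero : ∀ i j, (0 : Matrix (Fin n) (Fin n) (fourierAlgebra μ)) i j
      = coefficient μ (0 : SeqSpace (Lp ℂ 2 μ)) 0 := fun i j => by
    ext s; simp [coefficient_apply]
  let F₁ : (Fin n → Fin n → ℂ) →ₗ[ℝ] ℝ :=
    F.comp ((LinearMap.inr ℝ _ _).comp (LinearMap.inl ℝ _ _))
  let F₂ : (Fin n → Fin n → ℂ) →ₗ[ℝ] ℝ :=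
    F.comp ((LinearMap.inr ℝ _ _).comp (LinearMap.inr ℝ _ _))
  have hF₁ : ∀ P, F₁ P = F (0, P, 0) := fun P => rfl
  have hF₂ : ∀ P, F₂ P = F (0, 0, P) := fun P => rfl
  have hone : ∀ x : Fin n → ℂ,
      quadForm (fun i j => if i = j then 1 else 0) x = ∑ i, ‖x i‖ ^ 2 := fun x => by
    have : ∑ i, ∑ j, star (x i) * x j * (if i = j then (1 : ℂ) else 0)
        = ((∑ i, ‖x i‖ ^ 2 : ℝ) : ℂ) := by
      push_cast
      refine Finset.sum_congr rfl fun i _ => ?_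
      simp [Complex.conj_mul']
    rw [quadForm, this, Complex.ofReal_re]
  have hsum0 : ∀ x : Fin n → ℂ, ‖∑ i, x i • (0 : SeqSpace (Lp ℂ 2 μ))‖ ^ 2 = 0 := fun x => by simp
  -- A form that is nowhere positive has perturbed bound `0`, and the identity form has perturbed
  -- bound `1`, both with zero rows.
  have h₁ := fun ε (hε : 0 < ε) => exists_factor_of_le_quadForm F₁
    (fun P hP => by
      rw [hF₁]
      refine hF _ _ ⟨0, 0, fun _ => 0, fun _ => 0, le_rfl, le_rfl, by simp, fun x => ?_,
        fun x => ?_, hvzero⟩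
      · simpa using hP x
      · simp [hquad0])
    (by
      rw [hF₁]
      refine hF _ _ ⟨1, 0, fun _ => 0, fun _ => 0, zero_le_one, le_rfl, by simp, fun x => ?_,
        fun x => ?_, hvzero⟩
      · rw [hsum0, hone, add_zero, one_mul]
      · simp [hquad0]) (ε := ε) hε
  have h₂ := fun ε (hε : 0 < ε) => exists_factor_of_le_quadForm F₂
    (fun P hP => by
      rw [hF₂]
      refine hF _ _ ⟨0, 0, fun _ => 0, fun _ => 0, le_rfl, le_rfl, by simp, fun x => ?_,
        fun x => ?_, hvzero⟩
      · simp [hquad0]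
      · simpa using hP x)
    (by
      rw [hF₂]
      refine hF _ _ ⟨0, 1, fun _ => 0, fun _ => 0, le_rfl, zero_le_one, by simp, fun x => ?_,
        fun x => ?_, hvzero⟩
      · simp [hquad0]
      · rw [hsum0, hone, add_zero, one_mul]) (ε := ε) hε
  have hdom : ∀ a b : Fin n → Lp ℂ 2 μ,
      (∑ i, ∑ j, inner ℂ (a i) (T i j (b j))).re ≤ F₁ (gram a) + F₂ (gram b) := by
    intro a b
    set a' : Fin n → SeqSpace (Lp ℂ 2 μ) := fun i => lp.single 2 0 (a i) with ha'
    set b' : Fin n → SeqSpace (Lp ℂ 2 μ) := fun i => lp.single 2 0 (b i) with hb'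
    have hnorm : ∀ (a : Fin n → Lp ℂ 2 μ) (x : Fin n → ℂ),
        ‖∑ i, x i • (lp.single 2 0 (a i) : SeqSpace (Lp ℂ 2 μ))‖ ^ 2 = ‖∑ i, x i • a i‖ ^ 2 := by
      intro a x
      have := map_sum (lp.singleContinuousLinearMap ℂ (fun _ : ℕ => Lp ℂ 2 μ) 2 0)
        (fun i => x i • a i) Finset.univ
      simp only [map_smul, lp.singleContinuousLinearMap_apply] at this
      rw [← this, lp.norm_single (by norm_num)]
    -- Subtracting the Gram matrices of the rows themselves brings the perturbed bound down to `0`.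
    have h0 := hF (Matrix.of fun i j => coefficient μ (b' j) (a' i), -gram a, -gram b) 0
      ⟨0, 0, a', b', le_rfl, le_rfl, by simp, fun x => by
        rw [quadForm_neg, quadForm_gram, hnorm]; simp, fun x => by
        rw [quadForm_neg, quadForm_gram, hnorm]; simp, fun i j => rfl⟩
    have hsplit : ((Matrix.of fun i j => coefficient μ (b' j) (a' i), -gram a, -gram b) :
        PerturbationSpace μ n) = (Matrix.of fun i j => coefficient μ (b' j) (a' i), 0, 0)
          - ((0, gram a, 0) + (0, 0, gram b)) := by
      refine Prod.ext ?_ (Prod.ext ?_ ?_) <;> simp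
    rw [hsplit, map_sub, map_add, ← hF₁, ← hF₂, ← hFc, hFcT] at h0
    have : ∑ i, ∑ j, pairing μ (T i j) (Matrix.of (fun i j => coefficient μ (b' j) (a' i)) i j)
        = ∑ i, ∑ j, inner ℂ (a i) (T i j (b j)) :=
      Finset.sum_congr rfl fun i _ => Finset.sum_congr rfl fun j _ => by
        rw [Matrix.of_apply, pairing_coefficient μ (hTmem i j), inner_ampMap_single]
        simp [ha']
    rw [this] at h0
    linarith
  -- up to `ε`, the matrix of operators is a contraction between scalar matrices
  have key : ∀ ε : ℝ, 0 < ε → F (v, 0, 0) ≤ 2 * C * (1 + n * ε) := by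
    intro ε hε
    obtain ⟨α, hα, hα2, hαF⟩ := h₁ ε hε
    obtain ⟨β, hβ, hβ2, hβF⟩ := h₂ ε hε
    obtain ⟨A, hA⟩ := hα.exists_right_inv
    obtain ⟨B, hB⟩ := hβ.exists_right_inv
    have hA' : A * α = 1 := mul_eq_one_comm.1 hA
    have hB' : B * β = 1 := mul_eq_one_comm.1 hB
    set S : Matrix (Fin n) (Fin n) (Lp ℂ 2 μ →L[ℂ] Lp ℂ 2 μ) := compress A B (Matrix.of T) with hS
    have hST : compress α β S = Matrix.of T := by
      rw [hS, compress_compress, hA', hB', compress_one]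
    have hSmem : ∀ p q, S p q ∈ groupVN μ := fun p q => by
      have : ∑ i, ∑ j, (star (A i p) * B j q) • T i j ∈ (groupVN μ).toStarSubalgebra :=
        sum_mem fun i _ => sum_mem fun j _ =>
          (groupVN μ).toStarSubalgebra.smul_mem (hTmem i j) _
      exact this
    have hSnorm : ∀ ξ : Fin n → Lp ℂ 2 μ,
        ∑ p, ‖∑ q, S p q (ξ q)‖ ^ 2 ≤ 4 * ∑ q, ‖ξ q‖ ^ 2 := by
      intro ξ
      -- Domination reads `Re ⟨w, Sξ⟩ ≤ ‖w‖² + ‖ξ‖²`. The choice `w = Sξ / 2` optimizes it and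
      -- yields `‖Sξ‖² ≤ 4 ‖ξ‖²`.
      set w : Fin n → Lp ℂ 2 μ := fun p => (1 / 2 : ℂ) • ∑ q, S p q (ξ q) with hw
      have h1 := hdom (fun i => ∑ p, A i p • w p) (fun j => ∑ q, B j q • ξ q)
      have h2 : ∀ (α A : Matrix (Fin n) (Fin n) ℂ), α * A = 1 → ∀ w : Fin n → Lp ℂ 2 μ, ∀ p,
          ∑ i, α p i • ∑ q, A i q • w q = w p := by
        intro α A hA w p
        simp only [Finset.smul_sum, smul_smul]
        rw [Finset.sum_comm]
        simp only [← Finset.sum_smul, ← Matrix.mul_apply, hA]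
        simp [Matrix.one_apply, ite_smul]
      have h3 := hαF (fun i => ∑ p, A i p • w p)
      have h4 := hβF (fun j => ∑ q, B j q • ξ q)
      simp only [h2 α A hA] at h3
      simp only [h2 β B hB] at h4
      have h5 := sum_inner_compress A B (Matrix.of T) w ξ
      have h6 : ∀ p, inner ℂ (w p) (∑ q, compress A B (Matrix.of T) p q (ξ q))
          = ((1 / 2 * ‖∑ q, S p q (ξ q)‖ ^ 2 : ℝ) : ℂ) := fun p => by
        rw [hw, inner_smul_left, ← hS, inner_self_eq_norm_sq_to_K]
        push_cast
        simp [Complex.conj_ofNat]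
      simp only [h6, Matrix.of_apply] at h5
      rw [h5, ← Complex.ofReal_sum, Complex.ofReal_re] at h1
      have h7 : ∀ p, ‖w p‖ ^ 2 = 1 / 4 * ‖∑ q, S p q (ξ q)‖ ^ 2 := fun p => by
        rw [hw, norm_smul, mul_pow]
        norm_num
      simp only [h7] at h3
      rw [← Finset.mul_sum] at h1 h3
      linarith
    set S' : Matrix (Fin n) (Fin n) (Lp ℂ 2 μ →L[ℂ] Lp ℂ 2 μ) :=
      Matrix.of fun p q => (1 / 2 : ℂ) • S p q with hS'
    have hS'mem : ∀ p q, S' p q ∈ groupVN μ := fun p q =>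
      (groupVN μ).toStarSubalgebra.smul_mem (hSmem p q) _
    have hS'contr : IsContractiveMatrix S' := fun ξ => by
      have h1 : ∀ p, ‖∑ q, S' p q (ξ q)‖ ^ 2 = 1 / 4 * ‖∑ q, S p q (ξ q)‖ ^ 2 := fun p => by
        simp only [hS', Matrix.of_apply, _root_.smul_apply]
        rw [← Finset.smul_sum, norm_smul, mul_pow]
        norm_num
      simp only [h1, ← Finset.mul_sum]
      linarith [hSnorm ξ]
    set M : Matrix (Fin n × Fin n) (Fin n × Fin n) ℂ :=
      Matrix.of fun a b => pairing μ (S' a.2 b.2) (v a.1 b.1) with hM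
    have hMC : ‖M‖ ≤ C := by
      have h1 : ‖M‖ₑ ≤ ENNReal.ofReal C := by
        refine le_trans ?_ hv
        refine le_iSup_of_le n (le_iSup_of_le S' (le_iSup_of_le hS'mem
          (le_iSup_of_le hS'contr le_rfl)))
      rwa [← ofReal_norm, ENNReal.ofReal_le_ofReal_iff hC] at h1
    -- This is `T = αᴴ S β` paired with `v`; the factor `2` undoes the normalization `S' = S / 2`.
    have hpair : ∀ i j, pairing μ (T i j) (v i j)
        = ∑ p, ∑ q, 2 * (star (α p i) * M (i, p) (j, q) * β q j) := by
      intro i j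
      obtain ⟨ξ, η, hv⟩ := exists_eq_coefficient μ (v i j)
      have h1 : T i j = ∑ p, ∑ q, (star (α p i) * β q j) • S p q := by
        have := congrFun (congrFun hST i) j
        rw [compress_apply] at this
        exact this.symm
      have h2 : ∀ p q, M (i, p) (j, q) = 1 / 2 * ∑' k, inner ℂ (η k) (S p q (ξ k)) := by
        intro p q
        have : ampMap (S' p q) ξ = (1 / 2 : ℂ) • ampMap (S p q) ξ := rfl
        simp only [hM, Matrix.of_apply]
        rw [hv, pairing_coefficient μ (hS'mem p q), this, inner_smul_right, lp.inner_eq_tsum]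
        rfl
      have h3 : ∀ p q, Summable fun k => inner ℂ (η k) (S p q (ξ k)) := fun p q =>
        summable_inner_apply (sqSummable_coe ξ) (sqSummable_coe η) _
      rw [hv, pairing_coefficient μ (hTmem i j), inner_ampMap_eq_vecFunctional, vecFunctional, h1]
      simp only [_root_.sum_apply, _root_.smul_apply, inner_sum, inner_smul_right]
      rw [Summable.tsum_finsetSum fun p _ => summable_sum fun q _ => (h3 p q).mul_left _]
      refine Finset.sum_congr rfl fun p _ => ?_
      rw [Summable.tsum_finsetSum fun q _ => (h3 p q).mul_left _]
      refine Finset.sum_congr rfl fun q _ => ?_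
      rw [tsum_mul_left, h2]
      ring
    have hfinal : Fc v = 2 * ∑ a : Fin n × Fin n, ∑ b : Fin n × Fin n,
        star (α a.2 a.1) * M a b * β b.2 b.1 := by
      rw [hFcT]
      simp only [hpair, Fintype.sum_prod_type, Finset.mul_sum]
      refine Finset.sum_congr rfl fun i _ => ?_
      rw [Finset.sum_comm]
    have hHS : ∀ α : Matrix (Fin n) (Fin n) ℂ, ∑ p, ∑ i, ‖α p i‖ ^ 2 ≤ 1 + n * ε →
        ∑ a : Fin n × Fin n, ‖α a.2 a.1‖ ^ 2 ≤ 1 + n * ε := by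
      intro α hα
      rwa [Fintype.sum_prod_type_right]
    have hbil := norm_bilinear_le M (fun a => star (α a.2 a.1)) (fun b => β b.2 b.1)
    simp only [norm_star] at hbil
    have h0 : 0 ≤ 1 + n * ε := by positivity
    calc F (v, 0, 0) = (Fc v).re := (hFc v).symm
      _ ≤ ‖Fc v‖ := Complex.re_le_norm _
      _ ≤ 2 * (‖M‖ * Real.sqrt (∑ a : Fin n × Fin n, ‖α a.2 a.1‖ ^ 2)
            * Real.sqrt (∑ a : Fin n × Fin n, ‖β a.2 a.1‖ ^ 2)) := by
          rw [hfinal, norm_mul, Complex.norm_ofNat]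
          gcongr
      _ ≤ 2 * (C * Real.sqrt (1 + n * ε) * Real.sqrt (1 + n * ε)) := by
          gcongr
          · exact hHS α hα2
          · exact hHS β hβ2
      _ = 2 * C * (1 + n * ε) := by
          rw [mul_assoc C, Real.mul_self_sqrt h0, mul_assoc]
  have hlim : Tendsto (fun ε : ℝ => 2 * C * (1 + n * ε)) (𝓝[>] 0) (𝓝 (2 * C * (1 + n * 0))) :=
    (Continuous.tendsto (by fun_prop) 0).mono_left nhdsWithin_le_nhds
  rw [mul_zero, add_zero, mul_one] at hlim
  exact ge_of_tendsto hlim (eventually_mem_nhdsWithin.mono fun ε hε => key ε hε)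

/-- A matrix over `A(G)` of norm less than `c` factors through rows with Gram matrices at most
`c`. -/
theorem hasFactorization_of_matrixNorm_lt (v : Matrix (Fin n) (Fin n) (fourierAlgebra μ)) {c : ℝ}
    (hv : fourierMatrixNorm μ n v < ENNReal.ofReal c) :
    HasFactorization μ (fun i j => (v i j : G → ℂ)) c := by
  by_contra hcon
  have hc : 0 < c := ENNReal.ofReal_pos.1 (bot_le.trans_lt hv)
  have hfin : fourierMatrixNorm μ n v ≠ ∞ := hv.ne_top
  set C := (fourierMatrixNorm μ n v).toReal with hC
  have hCv : fourierMatrixNorm μ n v = ENNReal.ofReal C := (ENNReal.ofReal_toReal hfin).symm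
  have hCc : C < c := by
    rw [hCv] at hv
    exact (ENNReal.ofReal_lt_ofReal_iff hc).1 hv
  -- Perturbed bounds are sums `s + t` of two Gram bounds, so the threshold is `2 * c`. Without a
  -- factorization of constant `c`, none lies below it, and the separating functional takes the
  -- value `2 * c` at `v`, against `2 * C < 2 * c`.
  obtain ⟨F, hFv, hF⟩ := exists_functional_of_perturbedBound (μ := μ) v (c := 2 * c)
    (fun r hr => by
      by_contra hlt
      obtain ⟨s, t, a, b, hs, ht, rfl, ha, hb, hab⟩ := hr
      refine hcon (HasFactorization.of_add_lt hs ht (not_le.1 hlt) (a := a) (b := b)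
        (fun x => ?_) (fun x => ?_) fun i j s => ?_)
      · simpa [quadForm] using ha x
      · simpa [quadForm] using hb x
      · exact congrArg (fun w : fourierAlgebra μ => (w : G → ℂ) s) (hab i j)) (by linarith)
  have := functional_le_of_matrixNorm_le v ENNReal.toReal_nonneg hCv.le hF
  linarith

theorem HasFactorization.matrixNorm_le {v : Matrix (Fin n) (Fin n) (fourierAlgebra μ)} {c : ℝ}
    (h : HasFactorization μ (fun i j => (v i j : G → ℂ)) c) :
    fourierMatrixNorm μ n v ≤ ENNReal.ofReal c := by
  obtain ⟨hc, a, b, ha, hb, h⟩ := h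
  have hv : ∀ i j, v i j = coefficient μ (b j) (a i) := fun i j => by
    ext s
    exact h i j s
  refine iSup_le fun r => iSup_le fun T => iSup_le fun hT => iSup_le fun hT' => ?_
  rw [← ofReal_norm]
  refine ENNReal.ofReal_le_ofReal ?_
  have := norm_inner_matrix_le hT' hc ha hb
  simpa only [hv, pairing_coefficient μ (hT _ _)] using this

end Factor

/-! ### Estimates for the matrix norm of the Segal algebra. -/

section Segal

variable {G : Type u} [Group G] [TopologicalSpace G] [IsTopologicalGroup G]
  [MeasurableSpace G] [BorelSpace G] {μ : Measure G} [μ.IsHaarMeasure] {n : ℕ}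

/-- The test vectors are moved under the integral and the bound on `φ` is used pointwise. Summing
the `L¹` norms of the entries is crude, but suffices because lifts have arbitrarily small `L¹`
norms. -/
theorem norm_integral_matrix_le {r : ℕ} {φ : Matrix (Fin r) (Fin r) (Lp ℂ ∞ μ)}
    (hφ : ∀ᵐ s ∂μ, ‖(Matrix.of fun p q => φ p q s : Matrix (Fin r) (Fin r) ℂ)‖ ≤ 1)
    {u : Fin n → Fin n → G → ℂ} (hu : ∀ i j, Integrable (u i j) μ) :
    ‖(Matrix.of fun a b : Fin n × Fin r => ∫ s, φ a.2 b.2 s * u a.1 b.1 s ∂μ :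
      Matrix (Fin n × Fin r) (Fin n × Fin r) ℂ)‖ ≤ ∑ i, ∑ j, ∫ s, ‖u i j s‖ ∂μ := by
  have hint : ∀ p q i j, Integrable (fun s => φ p q s * u i j s) μ := fun p q i j =>
    (hu i j).mul_of_top_right (Lp.memLp (φ p q))
  refine l2_opNorm_le_of_bilinear _ (by positivity) fun y x => ?_
  have hint' : ∀ p q i j, Integrable (fun s => y (i, p) * φ p q s * x (j, q) * u i j s) μ :=
    fun p q i j => (((hint p q i j).const_mul (y (i, p))).mul_const (x (j, q))).congr
      (Eventually.of_forall fun s => by ring)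
  have h1 : ∑ a : Fin n × Fin r, ∑ b : Fin n × Fin r, y a *
      (Matrix.of fun a b : Fin n × Fin r => ∫ s, φ a.2 b.2 s * u a.1 b.1 s ∂μ) a b * x b
      = ∑ i, ∑ j, ∫ s, (∑ p, ∑ q, y (i, p) * φ p q s * x (j, q)) * u i j s ∂μ := by
    simp only [Fintype.sum_prod_type, Matrix.of_apply]
    refine Finset.sum_congr rfl fun i _ => ?_
    rw [Finset.sum_comm]
    refine Finset.sum_congr rfl fun j _ => ?_
    simp only [Finset.sum_mul]
    rw [integral_finsetSum _ fun p _ => integrable_finsetSum _ fun q _ => hint' p q i j]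
    refine Finset.sum_congr rfl fun p _ => ?_
    rw [integral_finsetSum _ fun q _ => hint' p q i j]
    refine Finset.sum_congr rfl fun q _ => ?_
    rw [← integral_const_mul, ← integral_mul_const]
    refine integral_congr_ae (Eventually.of_forall fun s => ?_)
    ring
  have hle : ∀ (z : Fin n × Fin r → ℂ) i, Real.sqrt (∑ p, ‖z (i, p)‖ ^ 2)
      ≤ Real.sqrt (∑ a, ‖z a‖ ^ 2) := fun z i => by
    refine Real.sqrt_le_sqrt ?_
    rw [Fintype.sum_prod_type]
    exact Finset.single_le_sum (f := fun i => ∑ p, ‖z (i, p)‖ ^ 2) (fun _ _ => by positivity)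
      (Finset.mem_univ i)
  rw [h1, mul_assoc, Finset.sum_mul]
  refine (norm_sum_le _ _).trans (Finset.sum_le_sum fun i _ => ?_)
  rw [Finset.sum_mul]
  refine (norm_sum_le _ _).trans (Finset.sum_le_sum fun j _ => ?_)
  rw [mul_comm, ← integral_const_mul]
  refine norm_integral_le_of_norm_le ((hu i j).norm.const_mul _) ?_
  filter_upwards [hφ] with s hs
  rw [norm_mul]
  gcongr
  calc ‖∑ p, ∑ q, y (i, p) * φ p q s * x (j, q)‖
      ≤ ‖(Matrix.of fun p q => φ p q s : Matrix (Fin r) (Fin r) ℂ)‖ *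
          Real.sqrt (∑ p, ‖y (i, p)‖ ^ 2) * Real.sqrt (∑ q, ‖x (j, q)‖ ^ 2) :=
        norm_bilinear_le (Matrix.of fun p q => φ p q s) (fun p => y (i, p)) fun q => x (j, q)
    _ ≤ 1 * Real.sqrt (∑ a, ‖y a‖ ^ 2) * Real.sqrt (∑ a, ‖x a‖ ^ 2) := by
        gcongr ?_ * ?_ * ?_
        · exact hle y i
        · exact hle x j
    _ = _ := by rw [one_mul]

theorem HasFactorization.segalMatrixNorm_le {u : Matrix (Fin n) (Fin n) (segalFourierAlgebra μ)}
    {c : ℝ} (h : HasFactorization μ (fun i j => ((u i j : fourierAlgebra μ) : G → ℂ)) c) :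
    segalFourierMatrixNorm μ n u ≤ ENNReal.ofReal
      (c + ∑ i, ∑ j, ∫ s, ‖((u i j : fourierAlgebra μ) : G → ℂ) s‖ ∂μ) := by
  obtain ⟨hc, a, b, ha, hb, h⟩ := h
  have hv : ∀ i j, (u i j : fourierAlgebra μ) = coefficient μ (b j) (a i) := fun i j => by
    ext s
    exact h i j s
  refine iSup_le fun r => iSup_le fun T => iSup_le fun hT => iSup_le fun hT' => iSup_le fun φ =>
    iSup_le fun hφ => ?_
  rw [← ofReal_norm]
  refine ENNReal.ofReal_le_ofReal ?_
  have h1 := norm_inner_matrix_le hT' hc ha hb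
  have h2 := norm_integral_matrix_le hφ
    (u := fun i j => ((u i j : fourierAlgebra μ) : G → ℂ)) fun i j => (u i j).2
  refine le_trans ?_ (add_le_add h1 h2)
  refine le_trans (le_of_eq ?_) (norm_add_le _ _)
  congr 1
  ext p q
  simp only [Matrix.of_apply, Matrix.add_apply]
  rw [← pairing_coefficient μ (hT _ _), hv]

theorem fourierMatrixNorm_le_segalMatrixNorm (u : Matrix (Fin n) (Fin n) (segalFourierAlgebra μ)) :
    fourierMatrixNorm μ n (u.map Subtype.val) ≤ segalFourierMatrixNorm μ n u := by
  refine iSup_le fun r => iSup_le fun T => iSup_le fun hT => iSup_le fun hT' => ?_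
  have h0 : ∀ᵐ s ∂μ, ‖(Matrix.of fun p q => (0 : Matrix (Fin r) (Fin r) (Lp ℂ ∞ μ)) p q s :
      Matrix (Fin r) (Fin r) ℂ)‖ ≤ 1 := by
    filter_upwards [Lp.coeFn_zero ℂ ∞ μ] with s hs
    have : (Matrix.of fun p q => (0 : Matrix (Fin r) (Fin r) (Lp ℂ ∞ μ)) p q s :
      Matrix (Fin r) (Fin r) ℂ) = 0 := by
      ext p q
      exact hs
    rw [this, norm_zero]
    exact zero_le_one
  refine le_trans (le_of_eq ?_) (le_iSup_of_le r (le_iSup_of_le T (le_iSup_of_le hT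
    (le_iSup_of_le hT' (le_iSup_of_le 0 (le_iSup_of_le h0 le_rfl))))))
  congr 2
  ext p q
  have : ∫ s, (0 : Matrix (Fin r) (Fin r) (Lp ℂ ∞ μ)) p.2 q.2 s *
      ((u p.1 q.1 : fourierAlgebra μ) : G → ℂ) s ∂μ = 0 := by
    refine (integral_congr_ae ?_).trans (integral_zero' G ℂ)
    filter_upwards [Lp.coeFn_zero ℂ ∞ μ] with s hs
    change (0 : Lp ℂ ∞ μ) s * _ = 0
    rw [hs, Pi.zero_apply, zero_mul]
  exact (add_zero _).symm.trans (congrArg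
    (fun z => pairing μ (T p.2 q.2) (u p.1 q.1 : fourierAlgebra μ) + z) this.symm)

end Segal

/-! ### Density of test functions in `L²`. -/

section CompactSupport

variable {X : Type*} [TopologicalSpace X] [MeasurableSpace X] [BorelSpace X]
  (μ : Measure X) [IsFiniteMeasureOnCompacts μ]

/-- The continuous, compactly supported, complex-valued functions on `X`. -/
abbrev TestFunction (X : Type*) [TopologicalSpace X] := CompactlySupportedContinuousMap X ℂ

theorem TestFunction.memLp (f : TestFunction X) : MemLp f 2 μ :=
  f.continuous.memLp_of_hasCompactSupport f.hasCompactSupport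

/-- Test functions as elements of `L²`. -/
noncomputable def toL2 : TestFunction X →ₗ[ℂ] Lp ℂ 2 μ where
  toFun f := (TestFunction.memLp μ f).toLp f
  map_add' _ _ := rfl
  map_smul' _ _ := rfl

theorem coeFn_toL2 (f : TestFunction X) : toL2 μ f =ᵐ[μ] f := MemLp.coeFn_toLp (TestFunction.memLp μ f)

theorem inner_toL2 (f g : TestFunction X) :
    inner ℂ (toL2 μ f) (toL2 μ g) = ∫ t, (starRingEnd ℂ) (f t) * g t ∂μ := by
  rw [L2.inner_def]
  refine integral_congr_ae ?_
  filter_upwards [coeFn_toL2 μ f, coeFn_toL2 μ g] with t h1 h2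
  rw [h1, h2, RCLike.inner_apply, mul_comm]

theorem norm_sq_toL2 (f : TestFunction X) : ‖toL2 μ f‖ ^ 2 = ∫ t, ‖f t‖ ^ 2 ∂μ := by
  have h := inner_toL2 μ f f
  have h2 : ∀ t, (starRingEnd ℂ) (f t) * f t = ((‖f t‖ ^ 2 : ℝ) : ℂ) := fun t => by
    rw [RCLike.conj_mul]; norm_cast
  simp_rw [h2] at h
  rw [inner_self_eq_norm_sq_to_K, integral_complex_ofReal] at h
  refine Complex.ofReal_injective ?_
  rw [Complex.ofReal_pow]
  exact h

/-- An indicator function is approximated by that of a compact subset `s`, and the latter by an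
Urysohn function supported near `s`, where regularity makes `V \ s` small. -/
theorem denseRange_toL2 [LocallyCompactSpace X] [T2Space X] (μ : Measure X) [μ.Regular] : DenseRange (toL2 μ) := by
  rw [Metric.denseRange_iff]
  intro F r hr
  have hε : ENNReal.ofReal (r / 2) ≠ 0 := by simpa using hr
  obtain ⟨g, hg, g', rfl⟩ : ∃ g : X → ℂ, eLpNorm ((F : X → ℂ) - g) 2 μ ≤ ENNReal.ofReal (r / 2) ∧
      ∃ g' : TestFunction X, (g' : X → ℂ) = g := by
    refine MemLp.induction_dense (by norm_num) (fun g => ∃ g' : TestFunction X, (g' : X → ℂ) = g)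
      ?_ ?_ ?_ (Lp.memLp F) hε
    · intro c t ht htμ ε hε
      rcases exists_Lp_half ℂ μ 2 hε with ⟨δ, δpos, hδ⟩
      obtain ⟨η, ηpos, hη⟩ := exists_eLpNorm_indicator_le (μ := μ) (p := 2) (by norm_num) c δpos.ne'
      have hη0 : (η : ℝ≥0∞) ≠ 0 := by exact_mod_cast ηpos.ne'
      obtain ⟨s, st, s_compact, s_closed, μs⟩ :=
        ht.exists_isCompact_isClosed_sdiff_lt htμ.ne hη0
      obtain ⟨V, sV, V_open, -, hV⟩ := s_closed.measurableSet.exists_isOpen_sdiff_lt (μ := μ)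
        s_compact.measure_lt_top.ne hη0
      obtain ⟨φ, h1, h0, hc, hφ⟩ := exists_continuous_one_zero_of_isCompact s_compact
        V_open.isClosed_compl (Set.disjoint_compl_right_iff_subset.2 sV)
      have hgc : Continuous fun x => (φ x : ℂ) * c := by fun_prop
      have hgs : HasCompactSupport fun x => (φ x : ℂ) * c :=
        HasCompactSupport.mul_right (hc.comp_left (g := fun r : ℝ => (r : ℂ)) (by simp))
      refine ⟨fun x => (φ x : ℂ) * c, ?_, ⟨⟨_, hgc⟩, hgs⟩, rfl⟩
      have I1 : eLpNorm ((fun x => (φ x : ℂ) * c) - s.indicator fun _ => c) 2 μ ≤ δ := by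
        refine (eLpNorm_mono fun x => ?_).trans (hη (V \ s) hV.le)
        by_cases hxs : x ∈ s
        · simp [hxs, h1 hxs]
        · by_cases hxV : x ∈ V
          · simp only [Pi.sub_apply, hxs, hxV, Set.indicator, Set.mem_sdiff]
            simp only [if_false, sub_zero, not_false_eq_true, and_self, if_true, norm_mul,
              Complex.norm_real, Real.norm_eq_abs, abs_of_nonneg (hφ x).1]
            exact mul_le_of_le_one_left (norm_nonneg _) (hφ x).2
          · simp [hxs, h0 hxV]
      have I2 : eLpNorm ((s.indicator fun _ => c) - t.indicator fun _ => c) 2 μ ≤ δ := by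
        rw [← eLpNorm_neg, neg_sub, ← Set.indicator_sdiff st]
        exact hη _ μs.le
      have := hδ _ _ (hgc.aestronglyMeasurable.sub
          (aestronglyMeasurable_const.indicator s_closed.measurableSet))
          ((aestronglyMeasurable_const.indicator s_closed.measurableSet).sub
            (aestronglyMeasurable_const.indicator ht)) I1 I2
      rw [sub_add_sub_cancel] at this
      exact this.le
    · rintro f g ⟨f', rfl⟩ ⟨g', rfl⟩
      exact ⟨f' + g', rfl⟩
    · rintro f ⟨f', rfl⟩
      exact f'.continuous.aestronglyMeasurable
  refine ⟨g', ?_⟩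
  rw [dist_eq_norm]
  have h1 : F - toL2 μ g' = ((Lp.memLp F).sub (TestFunction.memLp μ g')).toLp _ := by
    rw [MemLp.toLp_sub (Lp.memLp F) (TestFunction.memLp μ g'), Lp.toLp_coeFn]; rfl
  rw [h1, Lp.norm_toLp]
  refine (ENNReal.toReal_mono ENNReal.ofReal_ne_top hg).trans_lt ?_
  rw [ENNReal.toReal_ofReal (by positivity)]
  linarith

end CompactSupport

/-! ### Iterated integrals of compactly supported kernels. -/

section Fubini

variable {X Y : Type*} [TopologicalSpace X] [TopologicalSpace Y] [MeasurableSpace Y] [BorelSpace Y]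
  {ν : Measure Y} [IsFiniteMeasureOnCompacts ν] {F : X → Y → ℝ}

theorem HasCompactSupport.section_right (hs : HasCompactSupport F.uncurry) (x : X) [T2Space Y] :
    HasCompactSupport (F x) := by
  refine HasCompactSupport.intro (IsCompact.image hs continuous_snd) fun y hy => ?_
  by_contra h
  exact hy ⟨(x, y), subset_tsupport _ h, rfl⟩

theorem integrable_section (hF : Continuous F.uncurry) (hs : HasCompactSupport F.uncurry) (x : X)
    [T2Space Y] : Integrable (F x) ν :=
  (hF.comp (by fun_prop : Continuous fun y => (x, y))).integrable_of_hasCompactSupport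
    (HasCompactSupport.section_right hs x)

theorem integrable_integral_section [MeasurableSpace X] [BorelSpace X] {μ : Measure X}
    [IsFiniteMeasureOnCompacts μ] [T2Space X]
    (hF : Continuous F.uncurry) (hs : HasCompactSupport F.uncurry) :
    Integrable (fun x => ∫ y, F x y ∂ν) μ := by
  refine Continuous.integrable_of_hasCompactSupport ?_ ?_
  · rw [← continuousOn_univ]
    refine continuousOn_integral_of_compact_support (IsCompact.image hs continuous_snd)
      hF.continuousOn fun x y _ hy => ?_
    by_contra h
    exact hy ⟨(x, y), subset_tsupport _ h, rfl⟩
  · refine HasCompactSupport.intro (IsCompact.image hs continuous_fst) fun x hx => ?_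
    have : ∀ y, F x y = 0 := fun y => by
      by_contra h
      exact hx ⟨(x, y), subset_tsupport _ h, rfl⟩
    simp [this]

end Fubini

/-! ### The left regular representation on test functions. -/

section Regular

variable {G : Type u} [Group G] [TopologicalSpace G] [IsTopologicalGroup G]
  [LocallyCompactSpace G] [T2Space G] [MeasurableSpace G] [BorelSpace G]
  (μ : Measure G) [μ.IsHaarMeasure] [μ.Regular]

theorem continuous_leftRegular_apply (x : Lp ℂ 2 μ) : Continuous fun s => leftRegular μ s x := by
  let g : C(G, C(G, G)) := ContinuousMap.curry ⟨fun p : G × G => p.1⁻¹ * p.2, by fun_prop⟩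
  exact Continuous.compMeasurePreservingLp (f := fun _ : G => x) continuous_const g.continuous
    (fun s => measurePreserving_mul_left μ s⁻¹) (by norm_num)

theorem inner_leftRegular (s : G) (x y : Lp ℂ 2 μ) :
    inner ℂ (leftRegular μ s x) (leftRegular μ s y) = inner ℂ x y :=
  (Lp.compMeasurePreservingₗᵢ ℂ (fun t : G => s⁻¹ * t)
    (measurePreserving_mul_left μ s⁻¹)).inner_map_map x y

/-- Left translation of test functions. -/
noncomputable def translate (s : G) (f : TestFunction G) : TestFunction G :=
  ⟨⟨fun t => f (s⁻¹ * t), by fun_prop⟩, f.hasCompactSupport.comp_homeomorph (Homeomorph.mulLeft s⁻¹)⟩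

@[simp] theorem translate_apply (s t : G) (f : TestFunction G) : translate s f t = f (s⁻¹ * t) := rfl

theorem leftRegular_toL2 (s : G) (f : TestFunction G) :
    leftRegular μ s (toL2 μ f) = toL2 μ (translate s f) :=
  Lp.toLp_compMeasurePreserving (TestFunction.memLp μ f) (measurePreserving_mul_left μ s⁻¹)

end Regular

/-! ### Smearing a vector along a unitary representation. -/

section Smear

variable {Γ : Type*} [Group Γ] [TopologicalSpace Γ] [IsTopologicalGroup Γ]
  [LocallyCompactSpace Γ] [T2Space Γ] [MeasurableSpace Γ] [BorelSpace Γ]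
  {E : Type*} [NormedAddCommGroup E] [InnerProductSpace ℂ E] [CompleteSpace E]

/-- A strongly continuous unitary representation, as a homomorphism into the bounded operators. -/
structure IsUnitaryRep (π : Γ →* (E →L[ℂ] E)) : Prop where
  inner_map_map : ∀ s x y, inner ℂ (π s x) (π s y) = inner ℂ x y
  continuous_apply : ∀ x, Continuous fun s => π s x

variable {π : Γ →* (E →L[ℂ] E)} (k : E)

theorem rep_inv_apply (π : Γ →* (E →L[ℂ] E)) (s : Γ) (x : E) : π s⁻¹ (π s x) = x := by
  change (π s⁻¹ * π s) x = x
  rw [← map_mul, inv_mul_cancel, map_one]; rfl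

theorem IsUnitaryRep.inner_apply_apply (hπ : IsUnitaryRep π) (s t : Γ) :
    inner ℂ (π s k) (π t k) = inner ℂ k (π (s⁻¹ * t) k) := by
  rw [← hπ.inner_map_map s⁻¹, rep_inv_apply, map_mul]; rfl

theorem IsUnitaryRep.norm_inner_inv (hπ : IsUnitaryRep π) (s : Γ) :
    ‖(inner ℂ k (π s⁻¹ k) : ℂ)‖ = ‖(inner ℂ k (π s k) : ℂ)‖ := by
  rw [← hπ.inner_map_map s, norm_inner_symm]
  have := rep_inv_apply π s⁻¹ k
  rw [inv_inv] at this
  rw [this]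

theorem IsUnitaryRep.continuous_coefficient (hπ : IsUnitaryRep π) : Continuous fun s => (inner ℂ k (π s k) : ℂ) :=
  continuous_const.inner (hπ.continuous_apply k)

variable (ν : Measure Γ) [ν.IsHaarMeasure]

theorem IsUnitaryRep.integrable_smul (hπ : IsUnitaryRep π) (f : TestFunction Γ) :
    Integrable (fun h => f h • π h k) ν :=
  (f.continuous.smul (hπ.continuous_apply k)).integrable_of_hasCompactSupport
    f.hasCompactSupport.smul_right

/-- The vectors `∫ f(h) π(h) k dh` for test functions `f`. -/
noncomputable def smear (hπ : IsUnitaryRep π) : TestFunction Γ →ₗ[ℂ] E where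
  toFun f := ∫ h, f h • π h k ∂ν
  map_add' f g := by
    rw [← integral_add (hπ.integrable_smul k ν f) (hπ.integrable_smul k ν g)]
    exact integral_congr_ae (Eventually.of_forall fun h => add_smul _ _ _)
  map_smul' c f := by
    rw [RingHom.id_apply, ← integral_smul]
    exact integral_congr_ae (Eventually.of_forall fun h => smul_assoc c (f h) (π h k))

theorem smear_apply (hπ : IsUnitaryRep π) (f : TestFunction Γ) : smear k ν hπ f = ∫ h, f h • π h k ∂ν := rfl

theorem smear_translate (hπ : IsUnitaryRep π) (s : Γ) (f : TestFunction Γ) :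
    smear k ν hπ (translate s f) = π s (smear k ν hπ f) := by
  rw [smear_apply, smear_apply, ← ContinuousLinearMap.integral_comp_comm _
    (hπ.integrable_smul k ν f), ← integral_mul_left_eq_self _ s]
  refine integral_congr_ae (Eventually.of_forall fun h => ?_)
  simp only [translate_apply, inv_mul_cancel_left, map_smul, map_mul]
  rfl

theorem inner_smear (hπ : IsUnitaryRep π) (f : TestFunction Γ) (y : E) :
    inner ℂ (smear k ν hπ f) y = ∫ h, (starRingEnd ℂ) (f h) * inner ℂ (π h k) y ∂ν := by
  rw [← inner_conj_symm, smear_apply, ← integral_inner (hπ.integrable_smul k ν f), ← integral_conj]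
  refine integral_congr_ae (Eventually.of_forall fun h => ?_)
  simp only [inner_smul_right, map_mul, inner_conj_symm]

theorem inner_smear_right (hπ : IsUnitaryRep π) (f : TestFunction Γ) (y : E) :
    inner ℂ y (smear k ν hπ f) = ∫ h, f h * inner ℂ y (π h k) ∂ν := by
  rw [smear_apply, ← integral_inner (hπ.integrable_smul k ν f)]
  refine integral_congr_ae (Eventually.of_forall fun h => ?_)
  simp only [inner_smul_right]

theorem inner_smear_smear (hπ : IsUnitaryRep π) (f g : TestFunction Γ) :
    inner ℂ (smear k ν hπ f) (smear k ν hπ g) =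
      ∫ h, (starRingEnd ℂ) (f h) * ∫ x, g x * inner ℂ k (π (h⁻¹ * x) k) ∂ν ∂ν := by
  rw [inner_smear]
  simp only [inner_smear_right, hπ.inner_apply_apply]

/-- A Schur test. The left side is the double integral of `conj (f h) * f x * ⟨k, π(h⁻¹ x) k⟩`, and
`|f h| |f x|` is at most half the sum of squares. Left invariance evaluates one half; the other
reduces to it by exchanging variables, because the modulus of the kernel is symmetric. Hence no
modular function appears. As the Haar measure need not be σ-finite, the exchange relies on compact
support. -/
theorem norm_sq_smear_le (hπ : IsUnitaryRep π) (hk : HasCompactSupport fun s => (inner ℂ k (π s k) : ℂ))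
    (f : TestFunction Γ) :
    ‖smear k ν hπ f‖ ^ 2 ≤ (∫ s, ‖(inner ℂ k (π s k) : ℂ)‖ ∂ν) * ‖toL2 ν f‖ ^ 2 := by
  set ψ : Γ → ℝ := fun s => ‖(inner ℂ k (π s k) : ℂ)‖ with hψ
  have hψc : Continuous ψ := (hπ.continuous_coefficient k).norm
  set A : Γ → Γ → ℝ := fun h x => ‖f h‖ ^ 2 * ψ (h⁻¹ * x) with hA
  have hAc : Continuous A.uncurry := by
    change Continuous fun p : Γ × Γ => ‖f p.1‖ ^ 2 * ψ (p.1⁻¹ * p.2)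
    fun_prop
  have hAs : HasCompactSupport A.uncurry := by
    refine HasCompactSupport.intro
      ((IsCompact.prod f.hasCompactSupport hk).image
        (f := fun p : Γ × Γ => (p.1, p.1 * p.2)) (by fun_prop)) ?_
    rintro ⟨h, x⟩ hhx
    by_contra hne
    have h1 : ‖f h‖ ^ 2 * ψ (h⁻¹ * x) ≠ 0 := hne
    refine hhx ⟨(h, h⁻¹ * x), ⟨subset_tsupport _ fun h0 => h1 ?_, subset_tsupport _ fun h0 => h1 ?_⟩,
      by simp⟩
    · simp [h0]
    · simp only [hψ, h0, norm_zero, mul_zero]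
  set B : Γ → Γ → ℝ := fun h x => A x h with hB
  have hBc : Continuous B.uncurry := hAc.comp continuous_swap
  have hBs : HasCompactSupport B.uncurry := hAs.comp_homeomorph (Homeomorph.prodComm Γ Γ)
  have hAI := integrable_integral_section (μ := ν) (ν := ν) hAc hAs
  have hBI := integrable_integral_section (μ := ν) (ν := ν) hBc hBs
  have hint : ∫ h, ∫ x, A h x ∂ν ∂ν = (∫ s, ψ s ∂ν) * ‖toL2 ν f‖ ^ 2 := by
    rw [norm_sq_toL2, mul_comm, ← integral_mul_const]
    refine integral_congr_ae (Eventually.of_forall fun h => ?_)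
    simp only [hA]
    rw [integral_const_mul, integral_mul_left_eq_self ψ]
  have hswap : ∫ h, ∫ x, B h x ∂ν ∂ν = ∫ h, ∫ x, A h x ∂ν ∂ν :=
    integral_integral_swap_of_hasCompactSupport hBc hBs
  have key : ‖(inner ℂ (smear k ν hπ f) (smear k ν hπ f) : ℂ)‖ ≤
      ∫ h, (2⁻¹ * ∫ x, A h x ∂ν) + 2⁻¹ * ∫ x, B h x ∂ν ∂ν := by
    rw [inner_smear_smear]
    refine norm_integral_le_of_norm_le ((hAI.const_mul _).add (hBI.const_mul _))
      (Eventually.of_forall fun h => ?_)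
    have hA1 := (integrable_section (ν := ν) hAc hAs h).const_mul 2⁻¹
    have hB1 := (integrable_section (ν := ν) hBc hBs h).const_mul 2⁻¹
    rw [← integral_const_mul, ← integral_const_mul, ← integral_const_mul, ← integral_add hA1 hB1]
    refine norm_integral_le_of_norm_le (hA1.add hB1) (Eventually.of_forall fun x => ?_)
    have h1 : ψ (x⁻¹ * h) = ψ (h⁻¹ * x) := by
      rw [hψ]
      have := hπ.norm_inner_inv k (h⁻¹ * x)
      rwa [mul_inv_rev, inv_inv] at this
    have h2 : 0 ≤ ψ (h⁻¹ * x) := norm_nonneg _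
    simp only [hA, hB, h1, norm_mul, RCLike.norm_conj]
    change ‖f h‖ * (‖f x‖ * ψ (h⁻¹ * x)) ≤ _
    nlinarith [mul_nonneg (sq_nonneg (‖f h‖ - ‖f x‖)) h2]
  rw [integral_add (hAI.const_mul _) (hBI.const_mul _), integral_const_mul, integral_const_mul,
    hswap, hint, inner_self_eq_norm_sq_to_K] at key
  have h3 : ‖((‖smear k ν hπ f‖ : ℂ)) ^ 2‖ = ‖smear k ν hπ f‖ ^ 2 := by
    rw [norm_pow, Complex.norm_real, norm_norm]
  have h4 := h3.symm.le.trans key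
  linarith

variable [ν.Regular]

/-- The operator `L²(Γ) → E` given by `f ↦ ∫ f(h) π(h) k dh` on test functions. -/
noncomputable def smearCLM (hπ : IsUnitaryRep π) : Lp ℂ 2 ν →L[ℂ] E := (smear k ν hπ).extendOfNorm (toL2 ν)

theorem norm_smear_le (hπ : IsUnitaryRep π)
    (hk : HasCompactSupport fun s => (inner ℂ k (π s k) : ℂ)) (f : TestFunction Γ) :
    ‖smear k ν hπ f‖ ≤ √(∫ s, ‖(inner ℂ k (π s k) : ℂ)‖ ∂ν) * ‖toL2 ν f‖ := by
  refine le_of_sq_le_sq ?_ (by positivity)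
  rw [mul_pow, Real.sq_sqrt (integral_nonneg fun _ => norm_nonneg _)]
  exact norm_sq_smear_le k ν hπ hk f

theorem smearCLM_toL2 (hπ : IsUnitaryRep π)
    (hk : HasCompactSupport fun s => (inner ℂ k (π s k) : ℂ)) (f : TestFunction Γ) : smearCLM k ν hπ (toL2 ν f) = smear k ν hπ f :=
  LinearMap.extendOfNorm_eq (denseRange_toL2 ν) ⟨_, norm_smear_le k ν hπ hk⟩ f

theorem norm_smearCLM_le (hπ : IsUnitaryRep π)
    (hk : HasCompactSupport fun s => (inner ℂ k (π s k) : ℂ)) : ‖smearCLM k ν hπ‖ ≤ √(∫ s, ‖(inner ℂ k (π s k) : ℂ)‖ ∂ν) :=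
  LinearMap.opNorm_extendOfNorm_le (denseRange_toL2 ν) (Real.sqrt_nonneg _)
    (norm_smear_le k ν hπ hk)

theorem smearCLM_leftRegular (hπ : IsUnitaryRep π)
    (hk : HasCompactSupport fun s => (inner ℂ k (π s k) : ℂ)) (s : Γ) (x : Lp ℂ 2 ν) :
    smearCLM k ν hπ (leftRegular ν s x) = π s (smearCLM k ν hπ x) := by
  refine (denseRange_toL2 ν).induction_on x (isClosed_eq (by fun_prop) (by fun_prop)) fun f => ?_
  rw [leftRegular_toL2, smearCLM_toL2 k ν hπ hk, smearCLM_toL2 k ν hπ hk, smear_translate]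

end Smear

/-! ### How far a smearing operator is from an isometry. -/

section Defect

variable {E F : Type*} [NormedAddCommGroup E] [InnerProductSpace ℂ E] [CompleteSpace E]
  [NormedAddCommGroup F] [InnerProductSpace ℂ F] [CompleteSpace F]

/-- Expanding the square gives `‖V*Vx‖² - 2 ‖Vx‖² + ‖x‖²`. So for a contraction, almost preserving
the norm of `x` already forces `V*V x ≈ x`. -/
theorem norm_sq_adjoint_apply_sub_le {V : E →L[ℂ] F} (hV : ‖V‖ ≤ 1) (x : E) :
    ‖V.adjoint (V x) - x‖ ^ 2 ≤ ‖x‖ ^ 2 - ‖V x‖ ^ 2 := by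
  have h1 : ‖V.adjoint (V x)‖ ≤ ‖V x‖ :=
    (V.adjoint.le_opNorm _).trans (mul_le_of_le_one_left (norm_nonneg _)
      ((ContinuousLinearMap.adjoint.norm_map V).trans_le hV))
  have h2 : RCLike.re (inner ℂ (V.adjoint (V x)) x) = ‖V x‖ ^ 2 := by
    rw [ContinuousLinearMap.adjoint_inner_left, inner_self_eq_norm_sq]
  rw [norm_sub_sq (𝕜 := ℂ), h2]
  nlinarith [norm_nonneg (V.adjoint (V x))]

variable {Γ : Type*} [Group Γ] [TopologicalSpace Γ] [IsTopologicalGroup Γ]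
  [LocallyCompactSpace Γ] [T2Space Γ] [MeasurableSpace Γ] [BorelSpace Γ]
  {π : Γ →* (E →L[ℂ] E)} (k : E) (ν : Measure Γ) [ν.IsHaarMeasure]

/-- The function `⟨k, π(x) k⟩` is a probability density, and `⟨π(h) k, smear f⟩` is the average of
`f(h x)` against it. Where this density lives, right translation moves `f` by at most `ε`, so the
average differs from `f h` by at most `ε`; the difference of squared norms is the integral of `conj
f` against that error. -/
theorem norm_sq_sub_norm_sq_smear_le (hπ : IsUnitaryRep π)
    (hk : HasCompactSupport fun s => (inner ℂ k (π s k) : ℂ))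
    (hpos : ∀ s, (inner ℂ k (π s k) : ℂ) = ‖(inner ℂ k (π s k) : ℂ)‖)
    (hone : ∫ s, ‖(inner ℂ k (π s k) : ℂ)‖ ∂ν = 1) {ε : ℝ} (f : TestFunction Γ)
    (hf : ∀ x, inner ℂ k (π x k) ≠ 0 → ∀ h, ‖f h - f (h * x)‖ ≤ ε) :
    ‖toL2 ν f‖ ^ 2 - ‖smear k ν hπ f‖ ^ 2 ≤ ε * ∫ h, ‖f h‖ ∂ν := by
  set ψ : Γ → ℂ := fun s => inner ℂ k (π s k) with hψ
  have hψc : Continuous ψ := hπ.continuous_coefficient k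
  have hψi : Integrable ψ ν := hψc.integrable_of_hasCompactSupport hk
  have hψ1 : ∫ s, ψ s ∂ν = 1 := by
    rw [integral_congr_ae (Eventually.of_forall hpos), integral_complex_ofReal]
    exact_mod_cast hone
  have hfi : Integrable f ν := f.continuous.integrable_of_hasCompactSupport f.hasCompactSupport
  have h1 : ∀ h, inner ℂ (π h k) (smear k ν hπ f) = ∫ x, f (h * x) * ψ x ∂ν := fun h => by
    rw [inner_smear_right, ← integral_mul_left_eq_self _ h]
    simp only [hπ.inner_apply_apply, inv_mul_cancel_left, hψ]
  have hI1 : Integrable (fun h => (starRingEnd ℂ) (f h) * f h) ν :=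
    Continuous.integrable_of_hasCompactSupport (by fun_prop) f.hasCompactSupport.mul_left
  have hI2 : Integrable (fun h => (starRingEnd ℂ) (f h) * inner ℂ (π h k) (smear k ν hπ f)) ν := by
    refine Continuous.integrable_of_hasCompactSupport ?_ ?_
    · exact (Complex.continuous_conj.comp f.continuous).mul
        ((hπ.continuous_apply k).inner continuous_const)
    · exact (f.hasCompactSupport.comp_left (g := starRingEnd ℂ) (map_zero _)).mul_right
  have h2 : inner ℂ (toL2 ν f) (toL2 ν f) - inner ℂ (smear k ν hπ f) (smear k ν hπ f) =
      ∫ h, (starRingEnd ℂ) (f h) * (f h - inner ℂ (π h k) (smear k ν hπ f)) ∂ν := by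
    rw [inner_toL2, inner_smear, ← integral_sub hI1 hI2]
    simp only [mul_sub]
  have h3 : ∀ h, ‖f h - inner ℂ (π h k) (smear k ν hπ f)‖ ≤ ε := fun h => by
    have e1 : f h = ∫ x, f h * ψ x ∂ν := by rw [integral_const_mul, hψ1, mul_one]
    have i2 : Integrable (fun x => f (h * x) * ψ x) ν :=
      Continuous.integrable_of_hasCompactSupport (by fun_prop) hk.mul_left
    rw [h1]
    nth_rewrite 1 [e1]
    rw [← integral_sub (hψi.const_mul _) i2]
    refine (norm_integral_le_of_norm_le (g := fun x => ε * ‖ψ x‖) (hψi.norm.const_mul _)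
      (Eventually.of_forall fun x => ?_)).trans ?_
    · rw [← sub_mul, norm_mul]
      by_cases hx : ψ x = 0
      · simp [hx]
      · gcongr
        exact hf x hx h
    · rw [integral_const_mul, hone, mul_one]
  have h4 : ‖inner ℂ (toL2 ν f) (toL2 ν f) - inner ℂ (smear k ν hπ f) (smear k ν hπ f)‖ ≤
      ∫ h, ε * ‖f h‖ ∂ν := by
    rw [h2]
    refine norm_integral_le_of_norm_le (hfi.norm.const_mul _) (Eventually.of_forall fun h => ?_)
    rw [norm_mul, RCLike.norm_conj, mul_comm]
    gcongr
    exact h3 h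
  rw [integral_const_mul] at h4
  refine le_trans ?_ h4
  refine le_trans (le_of_eq ?_) (RCLike.re_le_norm _)
  rw [map_sub, inner_self_eq_norm_sq, inner_self_eq_norm_sq]

/-- Uniform continuity by the tube lemma over the support of `f`. When only `h * x` lies in the
support, the estimate is applied at `h * x` with `x⁻¹`, which is why the neighbourhood is made
symmetric. -/
theorem exists_nhds_norm_sub_le (f : TestFunction Γ) {ε : ℝ} (hε : 0 < ε) :
    ∃ N ∈ 𝓝 (1 : Γ), ∀ x ∈ N, ∀ h, ‖f h - f (h * x)‖ ≤ ε := by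
  have hopen : IsOpen {p : Γ × Γ | ‖f p.1 - f (p.1 * p.2)‖ < ε} :=
    isOpen_lt (by fun_prop) (by fun_prop)
  obtain ⟨u, v, -, hv, hu, h1, huv⟩ := generalized_tube_lemma f.hasCompactSupport
    (isCompact_singleton (x := (1 : Γ))) hopen (by
      rintro ⟨h, x⟩ ⟨-, rfl : x = 1⟩
      simpa using hε)
  have hv1 : v ∈ 𝓝 (1 : Γ) := hv.mem_nhds (h1 rfl)
  refine ⟨v ∩ v⁻¹, inter_mem hv1 (inv_mem_nhds_one Γ hv1), fun x hx h => ?_⟩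
  by_cases hh : h ∈ tsupport f
  · have : (h, x) ∈ u ×ˢ v := ⟨hu hh, hx.1⟩
    exact (huv this).le
  by_cases hhx : h * x ∈ tsupport f
  · have hmem : (h * x, x⁻¹) ∈ u ×ˢ v := ⟨hu hhx, hx.2⟩
    have : ‖f (h * x) - f (h * x * x⁻¹)‖ < ε := huv hmem
    rw [mul_inv_cancel_right, norm_sub_rev] at this
    exact this.le
  · rw [image_eq_zero_of_notMem_tsupport hh, image_eq_zero_of_notMem_tsupport hhx]
    simpa using hε.le

end Defect

/-! ### Bumps at the identity and null sets in the subgroup. -/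

section Subgroup

open scoped Pointwise

variable {G : Type u} [Group G] [TopologicalSpace G] [IsTopologicalGroup G]
  [LocallyCompactSpace G] [T2Space G] [MeasurableSpace G] [BorelSpace G]
  (μ : Measure G) [μ.IsHaarMeasure] [μ.Regular] {H : Subgroup G}

theorem mem_mul_inv_of_inner_ne_zero {κ κ' : TestFunction G} {s : G}
    (h : inner ℂ (toL2 μ κ) (leftRegular μ s (toL2 μ κ')) ≠ 0) :
    s ∈ tsupport κ * (tsupport κ')⁻¹ := by
  by_contra hs
  refine h ?_
  rw [leftRegular_toL2, inner_toL2]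
  refine integral_eq_zero_of_ae (Eventually.of_forall fun t => ?_)
  by_contra hne
  change ¬((starRingEnd ℂ) (κ t) * κ' (s⁻¹ * t) = 0) at hne
  have h1 : κ t ≠ 0 := fun h0 => hne (by simp [h0])
  have h2 : κ' (s⁻¹ * t) ≠ 0 := fun h0 => hne (by simp [h0])
  exact hs ⟨t, subset_tsupport _ h1, (s⁻¹ * t)⁻¹, by simpa using subset_tsupport _ h2, by simp⟩

/-- The left regular representation of a group, restricted to a subgroup. -/
noncomputable abbrev restrictedRegular (H : Subgroup G) : H →* (Lp ℂ 2 μ →L[ℂ] Lp ℂ 2 μ) :=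
  (leftRegular μ).comp H.subtype

theorem isUnitaryRep_restrictedRegular : IsUnitaryRep (restrictedRegular μ H) where
  inner_map_map s := inner_leftRegular μ (s : G)
  continuous_apply x := (continuous_leftRegular_apply μ x).comp continuous_subtype_val

theorem hasCompactSupport_restrictedRegular (hH : IsClosed (H : Set G)) (κ : TestFunction G) :
    HasCompactSupport fun s : H => (inner ℂ (toL2 μ κ) (restrictedRegular μ H s (toL2 μ κ)) : ℂ) := by
  refine HasCompactSupport.intro (hH.isClosedEmbedding_subtypeVal.isCompact_preimage
    (IsCompact.mul κ.hasCompactSupport (IsCompact.inv κ.hasCompactSupport))) fun s hs => ?_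
  by_contra h
  exact hs (mem_mul_inv_of_inner_ne_zero μ h)

/-- For a nonnegative bump `κ₀` the coefficient `⟨λ(s) κ₀ | κ₀⟩` is nonnegative, nonzero at the
identity and supported in a quotient of small sets. Its integral over `H` is finite and positive, so
a scaling normalizes it. -/
theorem exists_normalized_bump (hH : IsClosed (H : Set G)) (ν : Measure H) [ν.IsHaarMeasure]
    {W : Set G} (hW : W ∈ 𝓝 (1 : G)) : ∃ κ : TestFunction G,
      (∀ s : G, (inner ℂ (toL2 μ κ) (leftRegular μ s (toL2 μ κ)) : ℂ) =
        ‖(inner ℂ (toL2 μ κ) (leftRegular μ s (toL2 μ κ)) : ℂ)‖) ∧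
      (∫ s : H, ‖(inner ℂ (toL2 μ κ) (restrictedRegular μ H s (toL2 μ κ)) : ℂ)‖ ∂ν = 1) ∧
      ∀ s : G, (inner ℂ (toL2 μ κ) (leftRegular μ s (toL2 μ κ)) : ℂ) ≠ 0 → s ∈ W := by
  obtain ⟨V, hV, hVW⟩ := exists_nhds_split_inv hW
  obtain ⟨C, hC, hCc, hCV⟩ := exists_mem_nhds_isClosed_subset hV
  obtain ⟨φ, h1, h0, hc, hφ⟩ := exists_continuous_one_zero_of_isCompact
    (isCompact_singleton (x := (1 : G))) (isOpen_interior (s := C)).isClosed_compl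
    (Set.disjoint_compl_right_iff_subset.2
      (Set.singleton_subset_iff.2 (mem_interior_iff_mem_nhds.2 hC)))
  let κ₀ : TestFunction G := ⟨⟨fun x => (φ x : ℂ), by fun_prop⟩,
    hc.comp_left (g := fun r : ℝ => (r : ℂ)) (by simp)⟩
  have hκ₀ : ∀ t, κ₀ t = (φ t : ℂ) := fun t => rfl
  have hsupp : tsupport κ₀ ⊆ C := by
    refine closure_minimal (fun t ht => ?_) hCc
    by_contra hn
    exact ht (by rw [hκ₀, h0 (fun hi => hn (interior_subset hi))]; simp)
  set Ψ : G → ℂ := fun s => inner ℂ (toL2 μ κ₀) (leftRegular μ s (toL2 μ κ₀)) with hΨ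
  have hreal : ∀ s, Ψ s = ((∫ t, φ t * φ (s⁻¹ * t) ∂μ : ℝ) : ℂ) := fun s => by
    simp only [hΨ]
    rw [leftRegular_toL2, inner_toL2, ← integral_complex_ofReal]
    refine integral_congr_ae (Eventually.of_forall fun t => ?_)
    simp [hκ₀]
  have hpos : ∀ s, Ψ s = ‖Ψ s‖ := fun s => by
    rw [hreal, Complex.norm_real, Real.norm_of_nonneg]
    exact integral_nonneg fun t => mul_nonneg (hφ t).1 (hφ _).1
  have hΨc : Continuous Ψ := continuous_const.inner (continuous_leftRegular_apply μ _)
  have hΨs := hasCompactSupport_restrictedRegular μ hH κ₀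
  have hc0 : 0 < ∫ s : H, ‖Ψ s‖ ∂ν := by
    refine Continuous.integral_pos_of_hasCompactSupport_nonneg_nonzero (x := 1)
      (by fun_prop) hΨs.norm (fun s => norm_nonneg _) ?_
    rw [norm_ne_zero_iff, hreal, Complex.ofReal_ne_zero]
    refine (Continuous.integral_pos_of_hasCompactSupport_nonneg_nonzero (x := (1 : G))
      (by fun_prop) hc.mul_right (fun t => mul_nonneg (hφ t).1 (hφ _).1) ?_).ne'
    have : φ 1 = 1 := h1 rfl
    simp [this]
  set c := ∫ s : H, ‖Ψ s‖ ∂ν with hcdef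
  -- The vector occurs in both slots, so the factor `(√c)⁻¹` scales the coefficient by `c⁻¹`.
  have hscale : ∀ s, (inner ℂ (toL2 μ (((√c)⁻¹ : ℂ) • κ₀))
      (leftRegular μ s (toL2 μ (((√c)⁻¹ : ℂ) • κ₀))) : ℂ) = ((c⁻¹ : ℝ) : ℂ) * Ψ s := fun s => by
    rw [map_smul, map_smul, inner_smul_left, inner_smul_right, ← mul_assoc, ← Complex.ofReal_inv,
      Complex.conj_ofReal, ← Complex.ofReal_mul, ← mul_inv, Real.mul_self_sqrt hc0.le]
  refine ⟨((√c)⁻¹ : ℂ) • κ₀, fun s => ?_, ?_, fun s hs => ?_⟩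
  · rw [hscale, norm_mul, Complex.norm_real, Real.norm_of_nonneg (inv_nonneg.2 hc0.le),
      Complex.ofReal_mul, ← hpos]
  · have : ∀ s : H, ‖(inner ℂ (toL2 μ (((√c)⁻¹ : ℂ) • κ₀))
      (restrictedRegular μ H s (toL2 μ (((√c)⁻¹ : ℂ) • κ₀))) : ℂ)‖ = c⁻¹ * ‖Ψ s‖ := fun s => by
      have := congrArg norm (hscale s)
      rw [norm_mul, Complex.norm_real, Real.norm_of_nonneg (inv_nonneg.2 hc0.le)] at this
      exact this
    simp only [this]
    rw [integral_const_mul, ← hcdef, inv_mul_cancel₀ hc0.ne']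
  · rw [hscale] at hs
    obtain ⟨a, ha, b, hb, rfl⟩ := mem_mul_inv_of_inner_ne_zero μ (right_ne_zero_of_mul hs)
    have := hVW a (hCV (hsupp ha)) b⁻¹ (hCV (hsupp hb))
    rwa [div_inv_eq_mul] at this

/-- Steinhaus: if `K` had positive measure, `K / K` would be a neighbourhood of the identity inside
`H`, and `H` would be open. -/
theorem measure_eq_zero_of_subset_subgroup (hH : ¬ IsOpen (H : Set G)) {K : Set G}
    (hK : IsCompact K) (hKH : K ⊆ H) : μ K = 0 := by
  by_contra hne
  have := Measure.div_mem_nhds_one_of_haar_pos_ne_top μ K hK.measurableSet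
    (pos_iff_ne_zero.2 hne) hK.measure_lt_top.ne
  refine hH (H.isOpen_of_mem_nhds (mem_of_superset this ?_))
  rintro _ ⟨a, ha, b, hb, rfl⟩
  exact H.div_mem (hKH ha) (hKH hb)

variable [LocallyCompactSpace H]

/-- The smeared vectors are averages of the translates `λ(h) κ`, `λ(x) κ` with `h`, `x` in `K`. The
coefficient of two such translates is that of `κ` at `h⁻¹ s x`, which vanishes unless `s` lies in `K
W K⁻¹`. -/
theorem inner_smear_leftRegular_smear_eq_zero (ν : Measure H) [ν.IsHaarMeasure]
    {κ : TestFunction G} {W K : Set G} (hκ : ∀ s : G,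
      (inner ℂ (toL2 μ κ) (leftRegular μ s (toL2 μ κ)) : ℂ) ≠ 0 → s ∈ W)
    {f g : TestFunction H} (hf : ∀ h : H, f h ≠ 0 → (h : G) ∈ K) (hg : ∀ h : H, g h ≠ 0 → (h : G) ∈ K)
    {s : G} (hs : s ∉ (fun p : (G × G) × G => p.1.1 * p.2 * p.1.2⁻¹) '' ((K ×ˢ K) ×ˢ W)) :
    (inner ℂ (smear (toL2 μ κ) ν (isUnitaryRep_restrictedRegular μ) f)
      (leftRegular μ s (smear (toL2 μ κ) ν (isUnitaryRep_restrictedRegular μ) g)) : ℂ) = 0 := by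
  rw [inner_smear]
  refine integral_eq_zero_of_ae (Eventually.of_forall fun h => ?_)
  by_cases hfh : f h = 0
  · simp [hfh]
  have e1 : (inner ℂ (restrictedRegular μ H h (toL2 μ κ)) (leftRegular μ s
      (smear (toL2 μ κ) ν (isUnitaryRep_restrictedRegular μ) g)) : ℂ) =
      inner ℂ (leftRegular μ (s⁻¹ * h) (toL2 μ κ))
        (smear (toL2 μ κ) ν (isUnitaryRep_restrictedRegular μ) g) := by
    rw [← inner_leftRegular μ s⁻¹, rep_inv_apply, map_mul]; rfl
  have e2 : (inner ℂ (leftRegular μ (s⁻¹ * h) (toL2 μ κ))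
        (smear (toL2 μ κ) ν (isUnitaryRep_restrictedRegular μ) g) : ℂ) = 0 := by
    rw [inner_smear_right]
    refine integral_eq_zero_of_ae (Eventually.of_forall fun x => ?_)
    by_cases hgx : g x = 0
    · simp [hgx]
    by_contra hne
    have h3 : (inner ℂ (leftRegular μ (s⁻¹ * h) (toL2 μ κ))
      (restrictedRegular μ H x (toL2 μ κ)) : ℂ) ≠ 0 := right_ne_zero_of_mul hne
    have h4 : (inner ℂ (leftRegular μ (s⁻¹ * h) (toL2 μ κ))
      (restrictedRegular μ H x (toL2 μ κ)) : ℂ) =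
      inner ℂ (toL2 μ κ) (leftRegular μ ((h : G)⁻¹ * s * x) (toL2 μ κ)) := by
      rw [← inner_leftRegular μ (s⁻¹ * h : G)⁻¹, rep_inv_apply, mul_inv_rev, inv_inv, map_mul _ _ (x : G)]
      rfl
    rw [h4] at h3
    exact hs ⟨((h, x), (h : G)⁻¹ * s * x), ⟨⟨hf h hfh, hg x hgx⟩, hκ _ h3⟩, by simp [mul_assoc]⟩
  simp only [e1, e2, mul_zero, Pi.zero_apply]

end Subgroup

/-! ### Almost isometric intertwiners with small coefficients. -/

section Contraction

variable {G : Type u} [Group G] [TopologicalSpace G] [IsTopologicalGroup G]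
  [LocallyCompactSpace G] [T2Space G] [MeasurableSpace G] [BorelSpace G]
  (μ : Measure G) [μ.IsHaarMeasure] [μ.Regular] {H : Subgroup G} [LocallyCompactSpace H]

/-- Bounded operators from `L²(H)` to `L²(G)` which intertwine the left regular representation of
`H` and the restriction to `H` of that of `G`. -/
def IsIntertwiner (μ : Measure G) [μ.IsHaarMeasure] (ν : Measure H) [ν.IsHaarMeasure]
    (V : Lp ℂ 2 ν →L[ℂ] Lp ℂ 2 μ) : Prop :=
  ∀ (s : H) x, V (leftRegular ν s x) = leftRegular μ (s : G) (V x)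

theorem exists_open_conjugate_subset {O K : Set G} (hO : IsOpen O) (hK : IsCompact K)
    (hKO : ∀ a ∈ K, ∀ b ∈ K, a * b⁻¹ ∈ O) :
    ∃ W ∈ 𝓝 (1 : G), (fun p : (G × G) × G => p.1.1 * p.2 * p.1.2⁻¹) '' ((K ×ˢ K) ×ˢ W) ⊆ O := by
  obtain ⟨u, v, -, hv, hu, h1, huv⟩ := generalized_tube_lemma (hK.prod hK)
    (isCompact_singleton (x := (1 : G)))
    (hO.preimage (f := fun p : (G × G) × G => p.1.1 * p.2 * p.1.2⁻¹) (by fun_prop)) (by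
      rintro ⟨⟨a, b⟩, x⟩ ⟨⟨ha, hb⟩, rfl : x = 1⟩
      simpa using hKO a ha b hb)
  refine ⟨v, hv.mem_nhds (h1 rfl), ?_⟩
  rintro _ ⟨⟨ab, x⟩, ⟨hab, hx⟩, rfl⟩
  have hmem : (ab, x) ∈ u ×ˢ v := ⟨hu hab, hx⟩
  exact huv hmem

theorem integrable_of_eq_zero_off {g : G → ℂ} (hg : Continuous g) {O : Set G} (hO : IsOpen O)
    {M r : ℝ} (hM : ∀ s, ‖g s‖ ≤ M) (hM0 : 0 ≤ M) (hμO : μ O < ENNReal.ofReal r)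
    (h0 : ∀ s, s ∉ O → g s = 0) : Integrable g μ ∧ ∫ s, ‖g s‖ ∂μ ≤ M * r := by
  have hr : 0 ≤ r := (ENNReal.ofReal_pos.1 (bot_le.trans_lt hμO)).le
  have hi : Integrable (O.indicator fun _ => M) μ :=
    (integrable_indicator_iff hO.measurableSet).2 (integrableOn_const (hμO.trans_le le_top).ne)
  have hle : ∀ s, ‖g s‖ ≤ O.indicator (fun _ => M) s := fun s => by
    by_cases hs : s ∈ O
    · rw [Set.indicator_of_mem hs]; exact hM s
    · rw [Set.indicator_of_notMem hs, h0 s hs, norm_zero]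
  have hgi := hi.mono' hg.aestronglyMeasurable (Eventually.of_forall hle)
  refine ⟨hgi, (integral_mono hgi.norm hi hle).trans ?_⟩
  rw [integral_indicator_const _ hO.measurableSet, smul_eq_mul, mul_comm]
  gcongr
  exact ENNReal.toReal_le_of_le_ofReal hr hμO.le

/-- The bump is concentrated enough for two purposes: within `W₁` right translation hardly moves the
functions in `S`, which makes `V*V` almost the identity on them; and `K W₂ K⁻¹` lies in an open set
of small measure, which makes the coefficients small in `L¹`. -/
theorem exists_contraction (hH : IsClosed (H : Set G)) (hno : ¬ IsOpen (H : Set G))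
    (ν : Measure H) [ν.IsHaarMeasure] [ν.Regular] (S : Finset (TestFunction H)) {ε : ℝ}
    (hε : 0 < ε) : ∃ V : Lp ℂ 2 ν →L[ℂ] Lp ℂ 2 μ, IsIntertwiner μ ν V ∧ ‖V‖ ≤ 1 ∧
      (∀ f ∈ S, ‖V.adjoint (V (toL2 ν f)) - toL2 ν f‖ ≤ ε) ∧
      ∀ f ∈ S, ∀ g ∈ S,
        Integrable (fun s => (inner ℂ (V (toL2 ν f)) (leftRegular μ s (V (toL2 ν g))) : ℂ)) μ ∧
        ∫ s, ‖(inner ℂ (V (toL2 ν f)) (leftRegular μ s (V (toL2 ν g))) : ℂ)‖ ∂μ ≤ ε := by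
  set L : ℝ := ∑ f ∈ S, ∫ h, ‖f h‖ ∂ν with hL
  have hL0 : 0 ≤ L := Finset.sum_nonneg fun f _ => integral_nonneg fun h => norm_nonneg _
  have hLf : ∀ f ∈ S, ∫ h, ‖f h‖ ∂ν ≤ L := fun f hf =>
    Finset.single_le_sum (f := fun f : TestFunction H => ∫ h, ‖f h‖ ∂ν)
      (fun f _ => integral_nonneg fun h => norm_nonneg _) hf
  set M : ℝ := ∑ f ∈ S, ‖toL2 ν f‖ with hM
  have hM0 : 0 ≤ M := Finset.sum_nonneg fun f _ => norm_nonneg _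
  have hMf : ∀ f ∈ S, ‖toL2 ν f‖ ≤ M := fun f hf =>
    Finset.single_le_sum (f := fun f : TestFunction H => ‖toL2 ν f‖) (fun f _ => norm_nonneg _) hf
  -- The squared defect is at most `δ * L`, and it must not exceed `ε ^ 2`.
  set δ := ε ^ 2 / (L + 1) with hδ
  have hδ0 : 0 < δ := by positivity
  choose N hN hNf using fun f : TestFunction H => exists_nhds_norm_sub_le f hδ0
  obtain ⟨W₁, hW₁, hW₁N⟩ := (mem_nhds_subtype _ _ _).1
    ((Filter.biInter_finset_mem S).2 fun f _ => hN f : (⋂ f ∈ S, N f) ∈ 𝓝 (1 : H))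
  set K : Set G := Subtype.val '' ⋃ f ∈ S, tsupport (f : H → ℂ) with hK
  have hKc : IsCompact K :=
    (S.isCompact_biUnion fun f _ => f.hasCompactSupport).image continuous_subtype_val
  have hKH : K ⊆ H := by rintro _ ⟨h, -, rfl⟩; exact h.2
  -- `K K⁻¹` is a compact subset of `H`, hence null, and so has open neighbourhoods of arbitrarily
  -- small measure.
  set K' : Set G := (fun p : G × G => p.1 * p.2⁻¹) '' (K ×ˢ K) with hK'
  have hK'0 : μ K' = 0 := by
    refine measure_eq_zero_of_subset_subgroup μ hno ((hKc.prod hKc).image (by fun_prop)) ?_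
    rintro _ ⟨⟨a, b⟩, ⟨ha, hb⟩, rfl⟩
    exact H.mul_mem (hKH ha) (H.inv_mem (hKH hb))
  -- The coefficients are bounded by `M * M`, so an open set of measure below `r` leaves an `L¹`
  -- norm of at most `ε`.
  set r := ε / (M * M + 1) with hr
  have hr0 : 0 < r := by positivity
  obtain ⟨O, hKO, hO, hμO⟩ := K'.exists_isOpen_lt_of_lt (μ := μ) (ENNReal.ofReal r)
    (by rw [hK'0]; simpa using hr0)
  obtain ⟨W₂, hW₂, hW₂O⟩ := exists_open_conjugate_subset hO hKc
    fun a ha b hb => hKO ⟨(a, b), ⟨ha, hb⟩, rfl⟩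
  obtain ⟨κ, hpos, hone, hsupp⟩ := exists_normalized_bump μ hH ν (inter_mem hW₁ hW₂)
  have hπ := isUnitaryRep_restrictedRegular μ (H := H)
  have hs := hasCompactSupport_restrictedRegular μ hH κ
  have hV : ‖smearCLM (toL2 μ κ) ν hπ‖ ≤ 1 :=
    (norm_smearCLM_le (toL2 μ κ) ν hπ hs).trans (by rw [hone, Real.sqrt_one])
  have hVf := smearCLM_toL2 (toL2 μ κ) ν hπ hs
  have hmemK : ∀ f ∈ S, ∀ h : H, f h ≠ 0 → (h : G) ∈ K := fun f hf h hfh =>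
    ⟨h, Set.mem_biUnion hf (subset_tsupport _ hfh), rfl⟩
  refine ⟨smearCLM (toL2 μ κ) ν hπ, smearCLM_leftRegular (toL2 μ κ) ν hπ hs, hV,
    fun f hf => ?_, fun f hf g hg => ?_⟩
  · refine le_of_sq_le_sq ?_ hε.le
    refine (norm_sq_adjoint_apply_sub_le hV _).trans ?_
    rw [hVf]
    refine (norm_sq_sub_norm_sq_smear_le (toL2 μ κ) ν hπ hs (fun s => hpos s) hone (ε := δ) f
      fun x hx => hNf f x (Set.mem_iInter₂.1 (hW₁N (hsupp _ hx).1) f hf)).trans ?_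
    calc δ * ∫ h, ‖f h‖ ∂ν ≤ δ * (L + 1) := by gcongr; linarith [hLf f hf]
      _ = ε ^ 2 := by rw [hδ]; field_simp
  · have hnorm : ∀ f ∈ S, ‖smearCLM (toL2 μ κ) ν hπ (toL2 ν f)‖ ≤ M := fun f hf =>
      ((ContinuousLinearMap.le_opNorm _ _).trans
        (mul_le_of_le_one_left (norm_nonneg _) hV)).trans (hMf f hf)
    have h := integrable_of_eq_zero_off μ (g := fun s => (inner ℂ (smearCLM (toL2 μ κ) ν hπ (toL2 ν f))
        (leftRegular μ s (smearCLM (toL2 μ κ) ν hπ (toL2 ν g))) : ℂ)) (M := M * M)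
      (continuous_const.inner (continuous_leftRegular_apply μ _)) hO (fun s => ?_)
      (by positivity) hμO fun s hs => ?_
    · refine ⟨h.1, h.2.trans ?_⟩
      rw [hr, mul_div_assoc', div_le_iff₀ (by positivity)]
      nlinarith
    · refine (norm_inner_le_norm _ _).trans ?_
      gcongr
      · exact hnorm f hf
      · refine le_trans (le_of_eq ?_) (hnorm g hg)
        exact Lp.norm_compMeasurePreserving _ (measurePreserving_mul_left μ s⁻¹)
    · rw [hVf, hVf]
      exact inner_smear_leftRegular_smear_eq_zero μ ν (fun s hs => (hsupp s hs).2) (hmemK f hf)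
        (hmemK g hg) fun hmem => hs (hW₂O hmem)

end Contraction

/-! ### Approximate lifts with small `L¹` norm. -/

section Lift

section Amplification

variable {E F : Type*} [NormedAddCommGroup E] [InnerProductSpace ℂ E] [CompleteSpace E]
  [NormedAddCommGroup F] [InnerProductSpace ℂ F] [CompleteSpace F]

theorem inner_ampMap_left (V : E →L[ℂ] F) (x : SeqSpace E) (y : SeqSpace F) :
    inner ℂ (ampMap V x) y = inner ℂ x (ampMap V.adjoint y) := by
  simp only [lp.inner_eq_tsum, ampMap_apply, ContinuousLinearMap.adjoint_inner_right]

theorem inner_apply_sub_inner_apply (T : E →L[ℂ] E) (a b d e : E) :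
    (inner ℂ a (T b) : ℂ) - inner ℂ d (T e) = inner ℂ a (T (b - e)) + inner ℂ (a - d) (T e) := by
  rw [map_sub, inner_sub_right, inner_sub_left]
  ring

variable {n : ℕ}

theorem besselBound_of_norm_le {a : Fin n → E} {η : ℝ} (h : ∀ i, ‖a i‖ ≤ η) :
    BesselBound a (((n + 1) * η) ^ 2) := by
  refine (besselBound_sum_sq a).mono ?_
  calc ∑ i, ‖a i‖ ^ 2 ≤ ∑ _i : Fin n, η ^ 2 := by gcongr with i; exact h i
    _ = n * η ^ 2 := by simp
    _ ≤ ((n + 1) * η) ^ 2 := by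
      rw [mul_pow]
      gcongr
      have : (0 : ℝ) ≤ n := n.cast_nonneg
      nlinarith

theorem BesselBound.add {a b : Fin n → E} {p q : ℝ} (hp : 0 ≤ p) (hq : 0 ≤ q)
    (ha : BesselBound a (p ^ 2)) (hb : BesselBound b (q ^ 2)) :
    BesselBound (fun i => a i + b i) ((p + q) ^ 2) := by
  intro x
  have h1 := ha x
  have h2 := hb x
  have hsum : 0 ≤ ∑ i, ‖x i‖ ^ 2 := Finset.sum_nonneg fun i _ => by positivity
  rw [← Real.sq_sqrt hsum, ← mul_pow] at h1 h2 ⊢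
  have h1 := le_of_sq_le_sq h1 (by positivity)
  have h2 := le_of_sq_le_sq h2 (by positivity)
  simp only [smul_add, Finset.sum_add_distrib]
  gcongr
  refine (norm_add_le _ _).trans ?_
  linarith

end Amplification

theorem exists_toL2_approx {X : Type*} [TopologicalSpace X] [MeasurableSpace X] [BorelSpace X]
    [LocallyCompactSpace X] [T2Space X] (ν : Measure X) [ν.Regular] (x : SeqSpace (Lp ℂ 2 ν))
    {η : ℝ} (hη : 0 < η) : ∃ (α : ℕ → TestFunction X) (N : ℕ) (y : SeqSpace (Lp ℂ 2 ν)),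
      (∀ k, N ≤ k → α k = 0) ∧ (∀ k, y k = toL2 ν (α k)) ∧ ‖x - y‖ ≤ η := by
  obtain ⟨N, hN⟩ := (Metric.tendsto_atTop.1
    (lp.hasSum_single (by norm_num) x).tendsto_sum_nat (η / 2) (by positivity))
  have hN := hN N le_rfl
  choose β hβ using fun k => Metric.denseRange_iff.1 (denseRange_toL2 ν) (x k)
    (η / (2 * (N + 1))) (by positivity)
  set α : ℕ → TestFunction X := fun k => if k < N then β k else 0 with hα
  refine ⟨α, N, ∑ k ∈ Finset.range N, lp.single 2 k (toL2 ν (α k)), fun k hk => ?_, fun k => ?_, ?_⟩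
  · rw [hα]; exact if_neg (not_lt.2 hk)
  · have := map_sum (lp.evalCLM ℂ (fun _ : ℕ => Lp ℂ 2 ν) 2 k)
      (fun k => lp.single 2 k (toL2 ν (α k))) (Finset.range N)
    refine this.trans ?_
    have hterm : ∀ j, (lp.evalCLM ℂ (fun _ : ℕ => Lp ℂ 2 ν) 2 k) (lp.single 2 j (toL2 ν (α j))) =
        if k = j then toL2 ν (α k) else 0 := fun j => by
      change (lp.single 2 j (toL2 ν (α j)) : SeqSpace (Lp ℂ 2 ν)) k = _
      by_cases hkj : k = j
      · subst hkj; simp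
      · simp [hkj]
    simp only [hterm, Finset.sum_ite_eq, Finset.mem_range]
    by_cases hk : k < N
    · rw [if_pos hk]
    · rw [if_neg hk, hα]; simp [hk]
  · have h1 : ‖x - ∑ k ∈ Finset.range N, lp.single 2 k (x k)‖ ≤ η / 2 := by
      rw [dist_comm, dist_eq_norm] at hN
      exact hN.le
    have h2 : ‖∑ k ∈ Finset.range N, lp.single 2 k (x k) -
        ∑ k ∈ Finset.range N, (lp.single 2 k (toL2 ν (α k)) : SeqSpace (Lp ℂ 2 ν))‖ ≤ η / 2 := by
      rw [← Finset.sum_sub_distrib]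
      refine (norm_sum_le_of_le (f := fun k => lp.single 2 k (x k) -
        (lp.single 2 k (toL2 ν (α k)) : SeqSpace (Lp ℂ 2 ν))) _
        (n := fun _ => η / (2 * (N + 1))) fun k hk => ?_).trans ?_
      · have hsub := map_sub (lp.singleContinuousLinearMap ℂ (fun _ : ℕ => Lp ℂ 2 ν) 2 k)
          (x k) (toL2 ν (α k))
        refine (congrArg norm hsub.symm).trans_le ?_
        refine (lp.norm_single (E := fun _ : ℕ => Lp ℂ 2 ν) (p := 2) (by norm_num) k
          (x k - toL2 ν (α k))).trans_le ?_
        rw [hα]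
        simp only [Finset.mem_range.1 hk, if_true]
        rw [← dist_eq_norm]
        exact (hβ k).le
      · rw [Finset.sum_const, Finset.card_range, nsmul_eq_mul, mul_div_assoc', div_le_div_iff₀
          (by positivity) (by positivity)]
        nlinarith
    refine (norm_sub_le_norm_sub_add_norm_sub _ (∑ k ∈ Finset.range N, lp.single 2 k (x k)) _).trans ?_
    linarith

variable {G : Type u} [Group G] [TopologicalSpace G] [IsTopologicalGroup G]
  [LocallyCompactSpace G] [T2Space G] [MeasurableSpace G] [BorelSpace G]
  (μ : Measure G) [μ.IsHaarMeasure] [μ.Regular] {H : Subgroup G} [LocallyCompactSpace H]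

theorem IsIntertwiner.ampMap {ν : Measure H} [ν.IsHaarMeasure] {V : Lp ℂ 2 ν →L[ℂ] Lp ℂ 2 μ}
    (hV : IsIntertwiner μ ν V) (s : H) (x : SeqSpace (Lp ℂ 2 ν)) :
    ampMap (leftRegular μ (s : G)) (ampMap V x) = ampMap V (ampMap (leftRegular ν s) x) :=
  lp.ext (funext fun k => (hV s (x k)).symm)

set_option maxHeartbeats 800000 in
-- The rows `a`, `b` are replaced by finitely supported rows `a'`, `b'` of test functions and pushed
-- to `L²(G)` by `V`. Since `V` intertwines, the new function restricts on `H` to `⟨λ(h) b' | V*V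
-- a'⟩`. The error splits into `⟨λ(h)(b - b') | a⟩` and `⟨λ(h) b' | a - V*V a'⟩`, each with one
-- small row.
theorem exists_approximate_lift (hH : IsClosed (H : Set G)) (hno : ¬ IsOpen (H : Set G))
    {ν : Measure H} [ν.IsHaarMeasure] [ν.Regular] {n : ℕ} {v : Fin n → Fin n → H → ℂ} {c : ℝ}
    (hv : HasFactorization ν v c) {ε : ℝ} (hε : 0 < ε) :
    ∃ u : Fin n → Fin n → G → ℂ, HasFactorization μ u (c + ε) ∧
      (∀ i j, Integrable (u i j) μ ∧ ∫ s, ‖u i j s‖ ∂μ ≤ ε) ∧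
      HasFactorization ν (fun i j (h : H) => v i j h - u i j h) ε := by
  obtain ⟨hc, a, b, ha, hb, hab⟩ := hv
  set q := √c with hq
  have hq0 : 0 ≤ q := Real.sqrt_nonneg c
  have hqc : q ^ 2 = c := Real.sq_sqrt hc
  rw [← hqc] at ha hb
  -- With this choice `(q + t)² ≤ c + ε`, and the two error terms `(q + 1) t` and `2 t (q + 1)` add
  -- up to at most `ε`.
  set t := min 1 (ε / (3 * (q + 1))) with ht
  have ht0 : 0 < t := lt_min one_pos (by positivity)
  have ht1 : t ≤ 1 := min_le_left _ _
  have htε : 3 * (q + 1) * t ≤ ε := by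
    have := min_le_right 1 (ε / (3 * (q + 1)))
    rw [← ht, le_div_iff₀ (by positivity)] at this
    linarith
  -- A family of `n` vectors of norm at most `η` has Gram matrix at most `t²`.
  set η := t / (n + 1) with hη
  have hη0 : 0 < η := by positivity
  have hηt : (n + 1) * η = t := by rw [hη]; field_simp
  have hηle : η ≤ t := div_le_self ht0.le (by linarith [n.cast_nonneg (α := ℝ)])
  choose α Na a' hα ha' haa' using fun i => exists_toL2_approx ν (a i) hη0
  choose β _ b' _ hb' hbb' using fun i => exists_toL2_approx ν (b i) hη0
  -- Truncation is needed only for the left rows: past `N` the coordinates of `a'` vanish, and so do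
  -- the corresponding terms of the coefficient.
  set N := ∑ i, Na i with hN
  have hαN : ∀ i k, N ≤ k → α i k = 0 := fun i k hk => hα i k
    ((Finset.single_le_sum (f := Na) (fun _ _ => Nat.zero_le _) (Finset.mem_univ i)).trans hk)
  classical
  set S : Finset (TestFunction H) := (Finset.univ ×ˢ Finset.range N).image (fun p => α p.1 p.2) ∪
    (Finset.univ ×ˢ Finset.range N).image (fun p => β p.1 p.2) with hS
  have hαS : ∀ i k, k < N → α i k ∈ S := fun i k hk => Finset.mem_union_left _
    (Finset.mem_image.2 ⟨(i, k), by simpa using hk, rfl⟩)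
  have hβS : ∀ i k, k < N → β i k ∈ S := fun i k hk => Finset.mem_union_right _
    (Finset.mem_image.2 ⟨(i, k), by simpa using hk, rfl⟩)
  -- At most `N` coordinates contribute, each with an error of at most `δ`.
  set δ := η / (N + 1) with hδ
  have hδ0 : 0 < δ := by positivity
  have hNδ : N * δ ≤ η := by
    rw [hδ, mul_div_assoc', div_le_iff₀ (by positivity)]; nlinarith
  obtain ⟨V, hV, hV1, hVS, hVint⟩ := exists_contraction μ hH hno ν S hδ0
  have hbound : ∀ {a a' : Fin n → SeqSpace (Lp ℂ 2 ν)}, BesselBound a (q ^ 2) →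
      (∀ i, ‖a i - a' i‖ ≤ η) → BesselBound a' ((q + t) ^ 2) := fun {a a'} ha h => by
    have := BesselBound.add hq0 ht0.le ha (hηt ▸ besselBound_of_norm_le
      (a := fun i => a' i - a i) fun i => by rw [norm_sub_rev]; exact h i)
    simpa using this
  have ha'B := hbound ha haa'
  have hb'B := hbound hb hbb'
  have hVB : ∀ {a' : Fin n → SeqSpace (Lp ℂ 2 ν)}, BesselBound a' ((q + t) ^ 2) →
      BesselBound (fun i => ampMap V (a' i)) (c + ε) := fun {a'} h =>
    ((h.map (ampMap V).toLinearMap fun x => norm_ampMap_le_of_contraction hV1 x).mono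
      (by nlinarith))
  set u : Fin n → Fin n → G → ℂ := fun i j s =>
    inner ℂ (ampMap V (a' i)) (ampMap (leftRegular μ s) (ampMap V (b' j))) with hu
  have husum : ∀ i j s, u i j s = ∑ k ∈ Finset.range N,
      inner ℂ (V (toL2 ν (α i k))) (leftRegular μ s (V (toL2 ν (β j k)))) := fun i j s => by
    simp only [hu, lp.inner_eq_tsum]
    rw [tsum_eq_sum (s := Finset.range N) fun k hk => ?_]
    · simp only [ampMap_apply, ha', hb']
    · rw [ampMap_apply, ha', hαN i k (by simpa using hk), map_zero, map_zero, inner_zero_left]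
  have hdefect : ∀ i, ‖a i - ampMap V.adjoint (ampMap V (a' i))‖ ≤ 2 * η := fun i => by
    have h1 : ‖a' i - ampMap V.adjoint (ampMap V (a' i))‖ ≤ η := by
      refine le_of_sq_le_sq ((sq_norm_le_of_hasSum_le (hasSum_sum_of_ne_finset_zero
        (f := fun k => if k < N then δ ^ 2 else 0) (s := Finset.range N)
        (L := .unconditional ℕ) fun k hk => if_neg (by simpa using hk)) fun k => ?_).trans ?_) hη0.le
      · have hk : (a' i - ampMap V.adjoint (ampMap V (a' i)) : SeqSpace (Lp ℂ 2 ν)) k =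
          toL2 ν (α i k) - V.adjoint (V (toL2 ν (α i k))) := by
          rw [lp.coeFn_sub, Pi.sub_apply, ampMap_apply, ampMap_apply, ha']
        rw [hk]
        split_ifs with hkN
        · gcongr
          rw [norm_sub_rev]
          exact hVS _ (hαS i k hkN)
        · simp [hαN i k (not_lt.1 hkN)]
      · rw [Finset.sum_congr rfl fun k hk => if_pos (Finset.mem_range.1 hk), Finset.sum_const,
          Finset.card_range, nsmul_eq_mul]
        have : (N : ℝ) ≤ N ^ 2 := by exact_mod_cast Nat.le_self_pow two_ne_zero N
        calc (N : ℝ) * δ ^ 2 ≤ N ^ 2 * δ ^ 2 := by gcongr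
          _ = (N * δ) ^ 2 := by ring
          _ ≤ η ^ 2 := by gcongr
    refine (norm_sub_le_norm_sub_add_norm_sub _ (a' i) _).trans ?_
    linarith [haa' i]
  refine ⟨u, ⟨by positivity, _, _, hVB ha'B, hVB hb'B, fun i j s => rfl⟩, fun i j => ⟨?_, ?_⟩, ?_⟩
  · simp only [funext (husum i j)]
    exact integrable_finsetSum _ fun k hk =>
      (hVint _ (hαS i k (Finset.mem_range.1 hk)) _ (hβS j k (Finset.mem_range.1 hk))).1
  · have hterm := fun k hk =>
      hVint _ (hαS i k (Finset.mem_range.1 hk)) _ (hβS j k (Finset.mem_range.1 hk))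
    simp only [husum]
    calc _ ≤ ∫ s, ∑ k ∈ Finset.range N,
          ‖(inner ℂ (V (toL2 ν (α i k))) (leftRegular μ s (V (toL2 ν (β j k)))) : ℂ)‖ ∂μ :=
        integral_mono_of_nonneg (Eventually.of_forall fun s => norm_nonneg _)
          (integrable_finsetSum _ fun k hk => (hterm k hk).1.norm)
          (Eventually.of_forall fun s => norm_sum_le _ _)
      _ ≤ ∑ k ∈ Finset.range N, δ := by
        rw [integral_finsetSum _ fun k hk => (hterm k hk).1.norm]
        exact Finset.sum_le_sum fun k hk => (hterm k hk).2
      _ ≤ ε := by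
        rw [Finset.sum_const, Finset.card_range, nsmul_eq_mul]
        nlinarith
  · have hf1 : HasFactorization ν (fun i j h => inner ℂ (a i) (ampMap (leftRegular ν h) (b j - b' j)))
        ((q + 1) * t) :=
      HasFactorization.of_mul (by positivity) ht0 (ha.mono (by gcongr; linarith))
        (hηt ▸ besselBound_of_norm_le hbb') fun i j s => rfl
    have hf2 : HasFactorization ν (fun i j h => inner ℂ (a i - ampMap V.adjoint (ampMap V (a' i)))
        (ampMap (leftRegular ν h) (b' j))) ((2 * t) * (q + 1)) := by
      refine HasFactorization.of_mul (by positivity) (by positivity)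
        ((besselBound_of_norm_le hdefect).mono (le_of_eq ?_)) (hb'B.mono (by gcongr))
        fun i j s => rfl
      rw [← hηt]; ring
    have heq : (fun i j (h : H) => v i j h - u i j h) =
        (fun i j h => inner ℂ (a i) (ampMap (leftRegular ν h) (b j - b' j))) +
          fun i j h => inner ℂ (a i - ampMap V.adjoint (ampMap V (a' i)))
            (ampMap (leftRegular ν h) (b' j)) := by
      funext i j h
      have h1 : u i j h = inner ℂ (ampMap V.adjoint (ampMap V (a' i)))
          (ampMap (leftRegular ν h) (b' j)) := by
        rw [inner_ampMap_left V.adjoint, ContinuousLinearMap.adjoint_adjoint, ← hV.ampMap]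
      simp only [Pi.add_apply]
      rw [h1, hab]
      exact inner_apply_sub_inner_apply _ _ _ _ _
    rw [heq]
    exact (hf1.add hf2).mono (by linarith)

end Lift

/-! ### Exact lifts by successive approximation. -/

section Series

theorem integrable_of_hasSum {X : Type*} [MeasurableSpace X] {μ : Measure X} {f : ℕ → X → ℂ}
    {g : X → ℂ} {ε : ℕ → ℝ} {δ : ℝ} (hf : ∀ m, Integrable (f m) μ ∧ ∫ s, ‖f m s‖ ∂μ ≤ ε m)
    (hε : HasSum ε δ) (hg : ∀ s, HasSum (fun m => f m s) (g s)) :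
    Integrable g μ ∧ ∫ s, ‖g s‖ ∂μ ≤ δ := by
  have hε0 : ∀ m, 0 ≤ ε m := fun m => (integral_nonneg fun s => norm_nonneg _).trans (hf m).2
  have hgm : AEStronglyMeasurable g μ :=
    aestronglyMeasurable_of_tendsto_ae atTop
      (fun N => Finset.aestronglyMeasurable_fun_sum (Finset.range N)
        fun m _ => (hf m).1.aestronglyMeasurable)
      (Eventually.of_forall fun s => (hg s).tendsto_sum_nat)
  have hle : ∫⁻ s, ‖g s‖ₑ ∂μ ≤ ENNReal.ofReal δ := by
    calc ∫⁻ s, ‖g s‖ₑ ∂μ ≤ ∫⁻ s, ∑' m, ‖f m s‖ₑ ∂μ := by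
          refine lintegral_mono fun s => ?_
          rw [← (hg s).tsum_eq]
          exact enorm_tsum_le_tsum_enorm
      _ = ∑' m, ∫⁻ s, ‖f m s‖ₑ ∂μ :=
        lintegral_tsum fun m => (hf m).1.aestronglyMeasurable.enorm
      _ ≤ ∑' m, ENNReal.ofReal (ε m) := by
        refine ENNReal.tsum_le_tsum fun m => ?_
        rw [← ofReal_integral_norm_eq_lintegral_enorm (hf m).1]
        exact ENNReal.ofReal_le_ofReal (hf m).2
      _ = ENNReal.ofReal δ := by
        rw [← ENNReal.ofReal_tsum_of_nonneg hε0 hε.summable, hε.tsum_eq]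
  have hgi : Integrable g μ := ⟨hgm, hle.trans_lt ENNReal.ofReal_lt_top⟩
  refine ⟨hgi, ?_⟩
  rw [← ofReal_integral_norm_eq_lintegral_enorm hgi] at hle
  exact (ENNReal.ofReal_le_ofReal_iff (hε.nonneg hε0)).1 hle

variable {G : Type u} [Group G] [TopologicalSpace G] [IsTopologicalGroup G]
  [LocallyCompactSpace G] [T2Space G] [MeasurableSpace G] [BorelSpace G]
  (μ : Measure G) [μ.IsHaarMeasure] [μ.Regular] {H : Subgroup G} [LocallyCompactSpace H]

/-- Each residual is factorable with a small constant and can be lifted in turn. Only the first lift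
costs `c`; all later constants and all `L¹` norms form geometric series. -/
theorem exists_lift (hH : IsClosed (H : Set G)) (hno : ¬ IsOpen (H : Set G))
    {ν : Measure H} [ν.IsHaarMeasure] [ν.Regular] {n : ℕ} {v : Fin n → Fin n → H → ℂ} {c : ℝ}
    (hv : HasFactorization ν v c) {ε : ℝ} (hε : 0 < ε) :
    ∃ u : Fin n → Fin n → G → ℂ, HasFactorization μ u (c + ε) ∧
      (∀ i j, Integrable (u i j) μ ∧ ∫ s, ‖u i j s‖ ∂μ ≤ ε) ∧
      ∀ i j (h : H), u i j h = v i j h := by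
  -- The sum of this series is `ε / 2`. It is spent twice: on the constants of the residuals and on
  -- the loss in each lift.
  set e : ℕ → ℝ := fun m => ε / 2 / 2 / 2 ^ m with he
  have he0 : ∀ m, 0 < e m := fun m => by positivity
  have hesum : HasSum e (ε / 2) := hasSum_geometric_two' (ε / 2)
  choose U hU1 hU2 hU3 using fun (m : ℕ)
    (p : {p : (Fin n → Fin n → H → ℂ) × ℝ // HasFactorization ν p.1 p.2}) =>
      exists_approximate_lift μ hH hno p.2 (he0 m)
  -- Each residual is carried together with its factorization constant: `c` at the start, then `e m`
  -- after step `m`.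
  let P : ℕ → {p : (Fin n → Fin n → H → ℂ) × ℝ // HasFactorization ν p.1 p.2} := fun m =>
    Nat.rec ⟨(v, c), hv⟩ (fun m p => ⟨(fun i j h => p.1.1 i j h - U m p i j h, e m), hU3 m p⟩) m
  set u : ℕ → Fin n → Fin n → G → ℂ := fun m => U m (P m) with hu
  have hPv : ∀ m i j (h : H), (P (m + 1)).1.1 i j h = (P m).1.1 i j h - u m i j h :=
    fun m i j h => rfl
  have hPc : ∀ m, (P (m + 1)).1.2 = e m := fun m => rfl
  have hcost : HasSum (fun m => (P m).1.2 + e m) (c + ε) := by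
    have h1 : HasSum (fun m => (P m).1.2) (c + ε / 2) := by
      rw [← hasSum_nat_add_iff' 1]
      simp only [hPc, Finset.range_one, Finset.sum_singleton]
      change HasSum e (c + ε / 2 - c)
      rwa [add_sub_cancel_left]
    have := h1.add hesum
    rwa [add_assoc, add_halves] at this
  have hsummable : ∀ i j s, Summable fun m => u m i j s := fun i j s =>
    Summable.of_norm_bounded hcost.summable fun m => (hU1 m (P m)).norm_apply_le i j s
  have hsum : ∀ i j s, HasSum (fun m => u m i j s) (∑' m, u m i j s) := fun i j s =>
    (hsummable i j s).hasSum
  refine ⟨fun i j s => ∑' m, u m i j s,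
    HasFactorization.hasSum (fun m => hU1 m (P m)) hcost hsum, fun i j => ?_, fun i j h => ?_⟩
  · have := integrable_of_hasSum (fun m => hU2 m (P m) i j) hesum (hsum i j)
    exact ⟨this.1, this.2.trans (by linarith)⟩
  -- The partial sums telescope on `H`, and the residuals tend to zero pointwise since a
  -- factorization constant bounds the values.
  · have hpart : ∀ N, ∑ m ∈ Finset.range N, u m i j h = v i j h - (P N).1.1 i j h := fun N => by
      induction N with
      | zero => simp [P]
      | succ N ih => rw [Finset.sum_range_succ, ih, hPv]; ring
    have h0 : Tendsto (fun N => (P N).1.1 i j h) atTop (𝓝 0) := by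
      rw [← tendsto_add_atTop_iff_nat 1]
      refine squeeze_zero_norm (fun m => ?_) hesum.summable.tendsto_atTop_zero
      exact (P (m + 1)).2.norm_apply_le i j h
    have h1 := (hsum i j h).tendsto_sum_nat
    simp only [hpart] at h1
    have h2 := (tendsto_const_nhds (x := v i j h)).sub h0
    rw [sub_zero] at h2
    exact tendsto_nhds_unique h1 h2

end Series

/-! ### Polar decomposition compatible with intertwining. -/

section Polar

variable {E F : Type*} [NormedAddCommGroup E] [InnerProductSpace ℂ E] [CompleteSpace E]
  [NormedAddCommGroup F] [InnerProductSpace ℂ F] [CompleteSpace F]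

theorem exists_sqrt {A : Type*} [CStarAlgebra A] [PartialOrder A] [StarOrderedRing A] {a : A}
    (ha : 0 ≤ a) : ∃ r : A, r * r = a ∧ star r = r ∧ ∀ b, Commute a b → Commute r b :=
  ⟨CFC.sqrt a, CFC.sqrt_mul_sqrt_self a ha, (CFC.sqrt_nonneg a).isSelfAdjoint,
    fun _ h => h.cfcₙ_nnreal NNReal.sqrt⟩

/-- `R` is the absolute value of `W`. As a function of `W*W` it commutes with everything that
commutes with `W*W`. -/
theorem exists_sqrt_adjoint_comp_self (W : E →L[ℂ] F) : ∃ R : E →L[ℂ] E,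
    (∀ x, R (R x) = W.adjoint (W x)) ∧ R.adjoint = R ∧
    ∀ A : E →L[ℂ] E, (∀ x, W.adjoint (W (A x)) = A (W.adjoint (W x))) → ∀ x, R (A x) = A (R x) := by
  have hpos : 0 ≤ W.adjoint ∘L W := (ContinuousLinearMap.nonneg_iff_isPositive _).2
    (ContinuousLinearMap.isPositive_adjoint_comp_self W)
  obtain ⟨R, h1, h2, h3⟩ := exists_sqrt hpos
  refine ⟨R, fun x => ?_, h2, fun A hA x => ?_⟩
  · rw [← ContinuousLinearMap.comp_apply W.adjoint, ← h1]; rfl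
  · have hcomm : Commute (W.adjoint ∘L W) A := ContinuousLinearMap.ext hA
    exact congrArg (fun T : E →L[ℂ] E => T x) (h3 A hcomm).eq

/-- The partially isometric factor of the polar decomposition of `W` intertwines what `W` does. -/
theorem exists_partialIsometry (W : E →L[ℂ] F) : ∃ J : E →L[ℂ] F, ‖J‖ ≤ 1 ∧
    (∀ x ∈ W.kerᗮ, J.adjoint (J x) = x) ∧
    ∀ (A : E →L[ℂ] E) (B : F →L[ℂ] F), (∀ x, W (A x) = B (W x)) →
      (∀ y, W.adjoint (B y) = A (W.adjoint y)) → ∀ x, J (A x) = B (J x) := by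
  obtain ⟨R, hRR, hRsa, hRcomm⟩ := exists_sqrt_adjoint_comp_self W
  have hRinner : ∀ x y, (inner ℂ (R x) y : ℂ) = inner ℂ x (R y) := fun x y => by
    rw [← ContinuousLinearMap.adjoint_inner_right, hRsa]
  have hWR : ∀ x y, (inner ℂ (W x) (W y) : ℂ) = inner ℂ (R x) (R y) := fun x y => by
    rw [hRinner, hRR, ContinuousLinearMap.adjoint_inner_right]
  have hnorm : ∀ x, ‖W x‖ = ‖R x‖ := fun x => by
    have := congrArg RCLike.re (hWR x x)
    rw [inner_self_eq_norm_sq, inner_self_eq_norm_sq] at this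
    exact (sq_eq_sq₀ (norm_nonneg _) (norm_nonneg _)).1 this
  have hker : ∀ x, R x = 0 ↔ W x = 0 := fun x => by
    rw [← norm_eq_zero, ← hnorm, norm_eq_zero]
  -- `J` is determined by `R x + y ↦ W x` for `y` in the kernel of `R`. Such sums are dense, and
  -- orthogonality of the range and the kernel gives the norm bound, so one extension defines `J`
  -- everywhere.
  let e : E × R.ker →ₗ[ℂ] E := LinearMap.coprod R.toLinearMap R.ker.subtype
  have he : ∀ p, e p = R p.1 + p.2 := fun p => rfl
  let f : E × R.ker →ₗ[ℂ] F := W.toLinearMap.comp (LinearMap.fst ℂ E R.ker)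
  have hf : ∀ p, f p = W p.1 := fun p => rfl
  have horth : ∀ x (y : R.ker), (inner ℂ (R x) (y : E) : ℂ) = 0 := fun x y => by
    rw [hRinner, show R (y : E) = 0 from LinearMap.mem_ker.1 y.2, inner_zero_right]
  have hdense : DenseRange e := by
    have h1 : (LinearMap.range e)ᗮ = ⊥ := by
      rw [Submodule.eq_bot_iff]
      intro z hz
      have h2 : R z = 0 := by
        have := hz (e (R z, 0)) ⟨_, rfl⟩
        rw [he, ZeroMemClass.coe_zero, add_zero, hRinner] at this
        exact inner_self_eq_zero.1 this
      have := hz (e (0, ⟨z, LinearMap.mem_ker.2 h2⟩)) ⟨_, rfl⟩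
      rw [he, map_zero, zero_add] at this
      exact inner_self_eq_zero.1 this
    have := Submodule.dense_iff_topologicalClosure_eq_top.2
      ((Submodule.topologicalClosure_eq_top_iff).2 h1)
    rwa [LinearMap.coe_range] at this
  have hle : ∀ p, ‖f p‖ ≤ 1 * ‖e p‖ := fun p => by
    rw [one_mul, hf, he, hnorm]
    refine le_of_sq_le_sq ?_ (norm_nonneg _)
    rw [norm_add_sq (𝕜 := ℂ), horth, map_zero]
    nlinarith [norm_nonneg (p.2 : E)]
  set J : E →L[ℂ] F := f.extendOfNorm e with hJ
  have hJe : ∀ p : E × R.ker, J (R p.1 + p.2) = W p.1 := LinearMap.extendOfNorm_eq hdense ⟨1, hle⟩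
  have hJR : ∀ x, J (R x) = W x := fun x => by simpa using hJe (x, 0)
  refine ⟨J, LinearMap.opNorm_extendOfNorm_le hdense zero_le_one hle, fun x hx => ?_,
    fun A B hA hB x => ?_⟩
  · have h1 : ∀ z, J.adjoint (J (R z)) = R z := fun z => by
      refine ext_inner_left ℂ fun y => ?_
      refine hdense.induction_on y (isClosed_eq (by fun_prop) (by fun_prop)) fun p => ?_
      rw [ContinuousLinearMap.adjoint_inner_right, he, hJe, hJR, hWR, inner_add_left,
        inner_eq_zero_symm.1 (horth z p.2), add_zero]
    have h2 : x ∈ closure (Set.range R) := by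
      have hkerR : W.ker = R.ker := by ext y; exact (hker y).symm
      rw [hkerR, ContinuousLinearMap.orthogonal_ker, hRsa] at hx
      exact hx
    exact closure_minimal (s := Set.range R) (t := {x | J.adjoint (J x) = x})
      (by rintro _ ⟨z, rfl⟩; exact h1 z) (isClosed_eq (by fun_prop) (by fun_prop)) h2
  · have hRA : ∀ x, R (A x) = A (R x) := hRcomm A fun x => by rw [hA, hB]
    refine hdense.induction_on x (isClosed_eq (by fun_prop) (by fun_prop)) fun p => ?_
    -- `A` preserves the kernel of `R`, so the decomposition is carried along.
    have hp : R (A p.2) = 0 := by rw [hRA, show R (p.2 : E) = 0 from LinearMap.mem_ker.1 p.2.2, map_zero]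
    rw [he, hJe, map_add, ← hRA, ← hA]
    exact hJe (A p.1, ⟨A p.2, LinearMap.mem_ker.2 hp⟩)

/-- The sequence of suitable multiples of the operators `T m`. -/
theorem exists_sequence_operator (T : ℕ → E →L[ℂ] F) : ∃ (W : E →L[ℂ] SeqSpace F) (c : ℕ → ℂ),
    (∀ m, c m ≠ 0) ∧ ∀ x m, W x m = c m • T m x := by
  -- The weights make the squares summable; they are nonzero, so the kernel of `W` is the
  -- intersection of the kernels of the `T m`.
  have hc : ∀ m, (0 : ℝ) < (1 / 2) ^ m / (1 + ‖T m‖) := fun m => by positivity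
  set c : ℕ → ℂ := fun m => (((1 / 2) ^ m / (1 + ‖T m‖) : ℝ) : ℂ) with hcdef
  have hle : ∀ x m, ‖c m • T m x‖ ^ 2 ≤ (1 / 4) ^ m * ‖x‖ ^ 2 := fun x m => by
    have h1 : ‖c m • T m x‖ ≤ (1 / 2) ^ m * ‖x‖ := by
      rw [norm_smul, hcdef, Complex.norm_real, Real.norm_of_nonneg (hc m).le, div_mul_eq_mul_div,
        div_le_iff₀ (by positivity), mul_assoc]
      gcongr
      nlinarith [(T m).le_opNorm x, norm_nonneg x]
    calc ‖c m • T m x‖ ^ 2 ≤ ((1 / 2) ^ m * ‖x‖) ^ 2 := by gcongr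
      _ = (1 / 4) ^ m * ‖x‖ ^ 2 := by rw [mul_pow, ← pow_mul, mul_comm m 2, pow_mul]; norm_num
  have hgeom : HasSum (fun m : ℕ => (1 / 4 : ℝ) ^ m) (4 / 3) := by
    have := hasSum_geometric_of_lt_one (r := (1 / 4 : ℝ)) (by norm_num) (by norm_num)
    norm_num at this ⊢
    exact this
  have hs : ∀ x, SqSummable fun m => c m • T m x := fun x =>
    Summable.of_nonneg_of_le (fun m => by positivity) (hle x) (hgeom.mul_right _).summable
  refine ⟨LinearMap.mkContinuous
    { toFun := fun x => ⟨fun m => c m • T m x, memℓp_two_of_summable (hs x)⟩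
      map_add' := fun x y => lp.ext (funext fun m => by
        change c m • T m (x + y) = c m • T m x + c m • T m y
        rw [map_add, smul_add])
      map_smul' := fun z x => lp.ext (funext fun m => by
        change c m • T m (z • x) = z • c m • T m x
        rw [map_smul, smul_comm]) } 2 fun x => ?_, c, fun m => ?_, fun x m => rfl⟩
  · refine le_of_sq_le_sq ((sq_norm_le_of_hasSum_le (hgeom.mul_right _) (hle x)).trans ?_)
      (by positivity)
    nlinarith [sq_nonneg ‖x‖]
  · exact Complex.ofReal_ne_zero.2 (hc m).ne'

end Polar

/-! ### Restriction to a closed subgroup. -/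

section Herz

theorem adjoint_leftRegular {G : Type u} [Group G] [TopologicalSpace G] [IsTopologicalGroup G]
    [MeasurableSpace G] [BorelSpace G] (μ : Measure G) [μ.IsHaarMeasure] (s : G) : (leftRegular μ s).adjoint = leftRegular μ s⁻¹ := by
  rw [← ContinuousLinearMap.star_eq_adjoint, star_leftRegular]

section Adjoint

variable {E F : Type*} [NormedAddCommGroup E] [InnerProductSpace ℂ E] [CompleteSpace E]
  [NormedAddCommGroup F] [InnerProductSpace ℂ F] [CompleteSpace F]

theorem adjoint_apply_of_intertwines (W : E →L[ℂ] F) (A : E →L[ℂ] E) (B : F →L[ℂ] F)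
    (h : ∀ x, W (A.adjoint x) = B.adjoint (W x)) (y : F) :
    W.adjoint (B y) = A (W.adjoint y) := by
  refine ext_inner_left ℂ fun x => ?_
  rw [ContinuousLinearMap.adjoint_inner_right, ← ContinuousLinearMap.adjoint_inner_left, ← h,
    ← ContinuousLinearMap.adjoint_inner_right, ContinuousLinearMap.adjoint_inner_left]

theorem adjoint_ampMap (V : E →L[ℂ] F) : (ampMap V).adjoint = ampMap V.adjoint := by
  rw [eq_comm, ContinuousLinearMap.eq_adjoint_iff]
  intro x y
  rw [inner_ampMap_left, ContinuousLinearMap.adjoint_adjoint]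

/-- Since `J*J` fixes the coordinates of `a`, the coefficient can be computed after applying `J` to
both vectors. Nothing is required of `b`. -/
theorem inner_ampMap_eq_inner_flatten (J : E →L[ℂ] SeqSpace F) (A : E →L[ℂ] E) (B : F →L[ℂ] F)
    (hJ : ∀ x, J (A x) = ampMap B (J x)) {a : SeqSpace E} (ha : ∀ k, J.adjoint (J (a k)) = a k)
    (b : SeqSpace E) : (inner ℂ a (ampMap A b) : ℂ) =
      inner ℂ (flatten (ampMap J a)) (ampMap B (flatten (ampMap J b))) := by
  rw [inner_flatten_ampMap, lp.inner_eq_tsum]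
  refine tsum_congr fun k => ?_
  rw [ampMap_apply, ampMap_apply, ampMap_apply, ← hJ, ← ContinuousLinearMap.adjoint_inner_left J, ha]

end Adjoint

variable {G : Type u} [Group G] [TopologicalSpace G] [IsTopologicalGroup G]
  [LocallyCompactSpace G] [T2Space G] [MeasurableSpace G] [BorelSpace G]
  (μ : Measure G) [μ.IsHaarMeasure] [μ.Regular] {H : Subgroup G} [LocallyCompactSpace H]

/-- `V` is the smearing operator of `κ`. Testing `V* η = 0` against `f(h) = φ(h) ⟨λ(h)κ, η⟩` (in the
order of `inner`) gives `∫ φ |⟨λ(h)κ, η⟩|² = 0`, and continuity at the identity yields `⟨κ, η⟩ = 0`.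
-/
theorem exists_isIntertwiner_adjoint (hH : IsClosed (H : Set G)) (ν : Measure H) [ν.IsHaarMeasure]
    [ν.Regular] (κ : TestFunction G) : ∃ V : Lp ℂ 2 ν →L[ℂ] Lp ℂ 2 μ, IsIntertwiner μ ν V ∧
      ∀ η, V.adjoint η = 0 → inner ℂ (toL2 μ κ) η = 0 := by
  have hπ := isUnitaryRep_restrictedRegular μ (H := H)
  have hs := hasCompactSupport_restrictedRegular μ hH κ
  refine ⟨smearCLM (toL2 μ κ) ν hπ, smearCLM_leftRegular (toL2 μ κ) ν hπ hs, fun η hη => ?_⟩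
  set g : H → ℂ := fun h => inner ℂ (restrictedRegular μ H h (toL2 μ κ)) η with hg
  have hgc : Continuous g := (hπ.continuous_apply _).inner continuous_const
  by_contra hne
  have hg1 : g 1 ≠ 0 := by
    simp only [hg, map_one]
    exact hne
  obtain ⟨φ, h1, -, hc, hφ⟩ := exists_continuous_one_zero_of_isCompact
    (isCompact_singleton (x := (1 : H))) isClosed_empty (Set.disjoint_empty _)
  let f : TestFunction H := ⟨⟨fun h => (φ h : ℂ) * g h, by fun_prop⟩,
    (hc.comp_left (g := fun r : ℝ => (r : ℂ)) (by simp)).mul_right⟩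
  have hf : inner ℂ (smear (toL2 μ κ) ν hπ f) η = 0 := by
    rw [← smearCLM_toL2 (toL2 μ κ) ν hπ hs, ← ContinuousLinearMap.adjoint_inner_right, hη,
      inner_zero_right]
  have hpos : 0 < ∫ h, φ h * ‖g h‖ ^ 2 ∂ν := by
    refine Continuous.integral_pos_of_hasCompactSupport_nonneg_nonzero (x := (1 : H)) (by fun_prop)
      hc.mul_right (fun h => mul_nonneg (hφ h).1 (by positivity)) ?_
    have : φ 1 = 1 := h1 rfl
    simp [this, hg1]
  rw [inner_smear] at hf
  have hcong : ∀ h, (starRingEnd ℂ) (f h) * inner ℂ (restrictedRegular μ H h (toL2 μ κ)) η =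
      ((φ h * ‖g h‖ ^ 2 : ℝ) : ℂ) := fun h => by
    change (starRingEnd ℂ) ((φ h : ℂ) * g h) * g h = _
    rw [map_mul, Complex.conj_ofReal, mul_assoc, Complex.conj_mul']
    push_cast
    rfl
  rw [integral_congr_ae (Eventually.of_forall hcong), integral_complex_ofReal,
    Complex.ofReal_eq_zero] at hf
  exact hpos.ne' hf

theorem IsIntertwiner.adjoint {ν : Measure H} [ν.IsHaarMeasure] {V : Lp ℂ 2 ν →L[ℂ] Lp ℂ 2 μ}
    (hV : IsIntertwiner μ ν V) (s : H) (y : Lp ℂ 2 μ) :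
    V.adjoint (leftRegular μ (s : G) y) = leftRegular ν s (V.adjoint y) :=
  adjoint_apply_of_intertwines V (leftRegular ν s) (leftRegular μ (s : G)) (fun x => by
    rw [adjoint_leftRegular, adjoint_leftRegular]; exact hV s⁻¹ x) y

/-- Each vector is a limit of test functions, each of which is detected by an intertwiner to
`L²(H)`. A weighted sequence of these countably many operators has all the given vectors orthogonal
to its kernel, and its polar part is `J`. -/
theorem exists_partialIsometry_of_sequence (hH : IsClosed (H : Set G)) (ν : Measure H)
    [ν.IsHaarMeasure] [ν.Regular] (f : ℕ → Lp ℂ 2 μ) :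
    ∃ J : Lp ℂ 2 μ →L[ℂ] SeqSpace (Lp ℂ 2 ν), ‖J‖ ≤ 1 ∧ (∀ l, J.adjoint (J (f l)) = f l) ∧
      ∀ (s : H) x, J (leftRegular μ (s : G) x) = ampMap (leftRegular ν s) (J x) := by
  choose κ hκ using fun l j : ℕ => Metric.denseRange_iff.1 (denseRange_toL2 μ) (f l)
    (1 / (j + 1 : ℝ)) (by positivity)
  choose V hV hVκ using exists_isIntertwiner_adjoint μ hH ν
  obtain ⟨W, c, hc, hW⟩ := exists_sequence_operator fun m : ℕ =>
    (V (κ m.unpair.1 m.unpair.2)).adjoint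
  obtain ⟨J, hJ, hJker, hJc⟩ := exists_partialIsometry W
  have hWc : ∀ (s : H) x, W (leftRegular μ (s : G) x) = ampMap (leftRegular ν s) (W x) :=
    fun s x => lp.ext (funext fun m => by rw [hW, ampMap_apply, hW, map_smul, (hV _).adjoint])
  refine ⟨J, hJ, fun l => hJker _ ?_, fun s => hJc _ _ (hWc s)
    (adjoint_apply_of_intertwines W _ _ fun x => ?_)⟩
  · rw [Submodule.mem_orthogonal]
    intro η hη
    have hWη : W η = 0 := hη
    have h1 : ∀ j, inner ℂ η (toL2 μ (κ l j)) = 0 := fun j => by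
      rw [inner_eq_zero_symm]
      refine hVκ _ η ?_
      have := hW η (Nat.pair l j)
      rw [hWη, Nat.unpair_pair] at this
      exact (smul_eq_zero.1 this.symm).resolve_left (hc _)
    have h2 : Tendsto (fun j => toL2 μ (κ l j)) atTop (𝓝 (f l)) := by
      rw [tendsto_iff_dist_tendsto_zero]
      refine squeeze_zero (fun _ => dist_nonneg) (fun j => ?_) tendsto_one_div_add_atTop_nhds_zero_nat
      rw [dist_comm]
      exact (hκ l j).le
    have h3 := (tendsto_const_nhds (x := η)).inner (𝕜 := ℂ) h2
    simp only [h1] at h3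
    exact (tendsto_nhds_unique h3 tendsto_const_nhds)
  · rw [adjoint_ampMap, adjoint_leftRegular, adjoint_leftRegular]
    exact hWc s⁻¹ x

/-- A contraction applied to the rows does not increase Gram matrices, so the constant survives. -/
theorem HasFactorization.restrict (hH : IsClosed (H : Set G)) (ν : Measure H) [ν.IsHaarMeasure]
    [ν.Regular] {n : ℕ} {u : Fin n → Fin n → G → ℂ} {c : ℝ} (hu : HasFactorization μ u c) :
    HasFactorization ν (fun i j (h : H) => u i j h) c := by
  obtain ⟨hc, a, b, ha, hb, hu⟩ := hu
  -- All coordinates of all `a i` are listed in one sequence; numbers that code no pair are sent to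
  -- `0`.
  obtain ⟨J, hJ, hJf, hJc⟩ := exists_partialIsometry_of_sequence μ hH ν fun l : ℕ =>
    (Encodable.decode (α := Fin n × ℕ) l).elim 0 fun p => a p.1 p.2
  let Φ : SeqSpace (Lp ℂ 2 μ) →ₗ[ℂ] SeqSpace (Lp ℂ 2 ν) :=
    flatten.toLinearMap.comp (ampMap J).toLinearMap
  have hΦ : ∀ x, ‖Φ x‖ ≤ ‖x‖ := fun x =>
    (flatten.norm_map (ampMap J x)).trans_le (norm_ampMap_le_of_contraction hJ x)
  refine ⟨hc, fun i => Φ (a i), fun j => Φ (b j), ha.map Φ hΦ, hb.map Φ hΦ, fun i j s => ?_⟩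
  refine (hu i j s).trans (inner_ampMap_eq_inner_flatten J _ _ (hJc s) (fun k => ?_) (b j))
  simpa using hJf (Encodable.encode (i, k))

end Herz

/-! ### Conclusion: unit balls. -/

theorem exists_hasFactorization_lt_one {G : Type u} [Group G] [TopologicalSpace G]
    [IsTopologicalGroup G] [MeasurableSpace G] [BorelSpace G] {μ : Measure G} [μ.IsHaarMeasure]
    {n : ℕ} {v : Matrix (Fin n) (Fin n) (fourierAlgebra μ)} (hv : fourierMatrixNorm μ n v < 1) :
    ∃ c < 1, HasFactorization μ (fun i j => (v i j : G → ℂ)) c := by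
  obtain ⟨c, -, hc, hc1⟩ := ENNReal.lt_iff_exists_real_btwn.1 hv
  exact ⟨c, ENNReal.ofReal_lt_one.1 hc1, hasFactorization_of_matrixNorm_lt v hc⟩

end SegalFourier

theorem theorem3p2 {G : Type*} [Group G] [TopologicalSpace G] [IsTopologicalGroup G]
    [LocallyCompactSpace G] [T2Space G] [MeasurableSpace G] [BorelSpace G]
    (m : Measure G) [m.IsHaarMeasure] [m.Regular]
    (H : Subgroup G) (hclosed : IsClosed (H : Set G)) (hnotopen : ¬ IsOpen (H : Set G))
    (mH : Measure H) [mH.IsHaarMeasure] [mH.Regular]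
    {ι : Type*} [Preorder ι] [IsDirectedOrder ι] [Nonempty ι] (e : ι → G → ℂ)
    (he : IsBoundedApproximateIndicator m H mH e) :
    ∃ R : segalFourierAlgebra m →ₗ[ℂ] fourierAlgebra mH,
      (∀ (u : segalFourierAlgebra m) (h : H),
        (R u : H → ℂ) h = ((u : fourierAlgebra m) : G → ℂ) h) ∧
      Function.Surjective R ∧
      IsCompleteQuotientMap (segalFourierMatrixNorm m) (fourierMatrixNorm mH) R := by
  have _ : LocallyCompactSpace H := hclosed.isClosedEmbedding_subtypeVal.locallyCompactSpace
  have hmem : ∀ u : fourierAlgebra m, (fun h : H => (u : G → ℂ) h) ∈ fourierAlgebra mH := fun u => by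
    obtain ⟨c, hc⟩ := exists_hasFactorization m (fun _ _ : Fin 1 => u)
    exact (HasFactorization.restrict m hclosed mH hc).mem 0 0
  let R : segalFourierAlgebra m →ₗ[ℂ] fourierAlgebra mH :=
    { toFun := fun u => ⟨fun h => ((u : fourierAlgebra m) : G → ℂ) h, hmem u⟩
      map_add' := fun _ _ => rfl
      map_smul' := fun _ _ => rfl }
  -- Beyond `c + ε` from the factorization, each of the `n²` entries adds at most `ε` from its `L¹`
  -- norm.
  have hlift : ∀ {n : ℕ} {v : Matrix (Fin n) (Fin n) (fourierAlgebra mH)} {c : ℝ},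
      HasFactorization mH (fun i j => (v i j : H → ℂ)) c → ∀ ε > 0,
      ∃ u : Matrix (Fin n) (Fin n) (segalFourierAlgebra m), u.map R = v ∧
        segalFourierMatrixNorm m n u ≤ ENNReal.ofReal (c + ε + ∑ _i : Fin n, ∑ _j : Fin n, ε) := by
    intro n v c hv ε hε
    obtain ⟨u, hu, hui, huv⟩ := exists_lift m hclosed hnotopen hv hε
    refine ⟨fun i j => ⟨⟨u i j, hu.mem i j⟩, (hui i j).1⟩, ?_, ?_⟩
    · ext i j h
      exact huv i j h
    · refine (HasFactorization.segalMatrixNorm_le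
        (u := fun i j => ⟨⟨u i j, hu.mem i j⟩, (hui i j).1⟩) hu).trans (ENNReal.ofReal_le_ofReal ?_)
      gcongr with i _ j
      exact (hui i j).2
  refine ⟨R, fun u h => rfl, fun v => ?_, fun n => Set.Subset.antisymm ?_ fun v hv => ?_⟩
  · obtain ⟨c, hc⟩ := exists_hasFactorization mH (fun _ _ : Fin 1 => v)
    obtain ⟨u, hu, -⟩ := hlift (v := fun _ _ => v) hc 1 one_pos
    exact ⟨u 0 0, congrFun (congrFun hu 0) 0⟩
  · rintro _ ⟨u, hu, rfl⟩
    obtain ⟨c, hc1, hc⟩ :=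
      exists_hasFactorization_lt_one ((fourierMatrixNorm_le_segalMatrixNorm u).trans_lt hu)
    have h : HasFactorization mH (fun i j => ((u.map R) i j : H → ℂ)) c :=
      HasFactorization.restrict m hclosed mH hc
    exact h.matrixNorm_le.trans_lt (ENNReal.ofReal_lt_one.2 hc1)
  · obtain ⟨c, hc1, hc⟩ := exists_hasFactorization_lt_one hv
    -- For this `ε` the total `c + (n² + 1) ε` equals `1 - ε`, which is less than one.
    obtain ⟨u, hu, hu1⟩ := hlift hc ((1 - c) / (n * n + 2))
      (div_pos (sub_pos.2 hc1) (by positivity))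
    refine ⟨u, hu1.trans_lt (ENNReal.ofReal_lt_one.2 ?_), hu⟩
    simp only [Finset.sum_const, Finset.card_univ, Fintype.card_fin, nsmul_eq_mul]
    have hd : (0 : ℝ) < n * n + 2 := by positivity
    have h1 : (1 - c) / (n * n + 2) * (n * n + 2) = 1 - c := div_mul_cancel₀ _ hd.ne'
    have h2 : 0 < (1 - c) / (n * n + 2) := div_pos (sub_pos.2 hc1) hd
    nlinarith
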